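/- Let $F$ be a field of characteristic $p>0$ with $p\neq 2$, let $n\ge 0$ be an integer, let $A(n)=F[x_1,\dots,x_n]/(x_1^p,\dots,x_n^p)$ and let $W(n)=\mathrm{Der}_F A(n)$ be the Witt–Jacobson Lie algebra, with the commutator bracket. Let $D_i=\partial/\partial x_i\in W(n)$ for $1\le i\le n$. For a Lie algebra $\mathfrak g$ over $F$ let $H^2(\mathfrak g,\mathfrak g)=Z^2(\mathfrak g,\mathfrak g)/B^2(\mathfrak g,\mathfrak g)$ be the second (Chevalley–Eilenberg) cohomology of $\mathfrak g$ with values in the adjoint representation, and for a derivation $\gamma$ of $\mathfrak g$ let $\mathrm{Sq}(\gamma)\in Z^2(\mathfrak g,\mathfrak g)$ be the $2$-cocycle $$\mathrm{Sq}(\gamma)(x,y)=\sum_{i=1}^{p-1}\frac{[\gamma^i(x),\gamma^{p-i}(y)]}{i!\,(p-i)!};$$ for $z\in\mathfrak g$ write $\mathrm{Sq}(z)=\mathrm{Sq}(\mathrm{ad}\, z)$. If $(n,p)\neq(1,3)$, then $$H^2(W(n),W(n))=\bigoplus_{i=1}^n F\cdot\langle \mathrm{Sq}(D_i)\rangle ,$$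 that is, the classes of $\mathrm{Sq}(D_1),\dots,\mathrm{Sq}(D_n)$ form an $F$-basis of $H^2(W(n),W(n))$; in particular this space has dimension $n$. If $n=1$ and $p=3$, then $W(1)\cong\mathfrak{sl}_2(F)$ as Lie algebras over $F$ and $H^2(W(1),W(1))=0$. -/

import Mathlib

set_option maxSynthPendingDepth 3

open LieModule.Cohomology

noncomputable section

namespace WittJacobson

section SecondCohomology

variable (R L M : Type*) [CommRing R] [LieRing L] [LieAlgebra R L] [AddCommGroup M] [Module R M]
  [LieRingModule L M] [LieModule R L M]

/-- The 2-coboundaries `B²(L, M)`, as a subspace of the 2-cocycles `Z²(L, M)`. -/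
def twoCoboundary : Submodule R (twoCocycle R L M) :=
  (LinearMap.range (d₁₂ R L M)).comap (twoCocycle R L M).subtype

/-- The second cohomology `H²(L, M) = Z²(L, M) / B²(L, M)` of a Lie algebra `L` with values in
an `L`-module `M`. -/
abbrev H2 : Type _ := twoCocycle R L M ⧸ twoCoboundary R L M

end SecondCohomology

section Squaring

variable {F L : Type*} [Field F] [LieRing L] [LieAlgebra F L]

/-- The bilinear map `Sq(γ)(x, y) = ∑_{i=1}^{p-1} [γ^i(x), γ^{p-i}(y)] / (i! (p-i)!)`. -/
def sqBilin (p : ℕ) (γ : LieDerivation F L L) : L →ₗ[F] L →ₗ[F] L :=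
  LinearMap.mk₂ F
    (fun x y ↦ ∑ i ∈ Finset.Icc 1 (p - 1),
      ((i.factorial : F) * ((p - i).factorial : F))⁻¹ •
        ⁅((γ : L →ₗ[F] L) ^ i) x, ((γ : L →ₗ[F] L) ^ (p - i)) y⁆)
    (fun x x' y ↦ by simp [Finset.sum_add_distrib])
    (fun c x y ↦ by simp [Finset.smul_sum, smul_comm c])
    (fun x y y' ↦ by simp [Finset.sum_add_distrib])
    (fun c x y ↦ by simp [Finset.smul_sum, smul_comm c])

theorem sqBilin_apply (p : ℕ) (γ : LieDerivation F L L) (x y : L) :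
    sqBilin p γ x y = ∑ i ∈ Finset.Icc 1 (p - 1),
      ((i.factorial : F) * ((p - i).factorial : F))⁻¹ •
        ⁅((γ : L →ₗ[F] L) ^ i) x, ((γ : L →ₗ[F] L) ^ (p - i)) y⁆ := rfl

theorem sqBilin_self (p : ℕ) (γ : LieDerivation F L L) (x : L) : sqBilin p γ x x = 0 := by
  rw [sqBilin_apply]
  refine Finset.sum_involution (fun i _ ↦ p - i) ?_ ?_ ?_ ?_
  · intro i hi
    rw [Finset.mem_Icc] at hi
    have h : p - (p - i) = i := by omega
    rw [h, mul_comm ((p - i).factorial : F), ← smul_add, ← lie_skew, neg_add_cancel, smul_zero]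
  · intro i _ hne h
    apply hne
    rw [h, lie_self, smul_zero]
  · intro i hi
    rw [Finset.mem_Icc] at hi ⊢
    omega
  · intro i hi
    rw [Finset.mem_Icc] at hi
    show p - (p - i) = i
    omega

/-- `Sq(γ)` as an alternating 2-cochain. -/
def sqCochain (p : ℕ) (γ : LieDerivation F L L) : twoCochain F L L :=
  ⟨sqBilin p γ, sqBilin_self p γ⟩

theorem sqCochain_apply (p : ℕ) (γ : LieDerivation F L L) (x y : L) :
    sqCochain p γ x y = ∑ i ∈ Finset.Icc 1 (p - 1),
      ((i.factorial : F) * ((p - i).factorial : F))⁻¹ •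
        ⁅((γ : L →ₗ[F] L) ^ i) x, ((γ : L →ₗ[F] L) ^ (p - i)) y⁆ := rfl

/-- The divided power `γ^i / i!`, used in checking that `Sq(γ)` is a cocycle. -/
def divPow (γ : LieDerivation F L L) (i : ℕ) (x : L) : L :=
  (i.factorial : F)⁻¹ • ((γ : L →ₗ[F] L) ^ i) x

theorem divPow_lie (p : ℕ) [Fact p.Prime] [CharP F p] (γ : LieDerivation F L L) (m : ℕ)
    (hm : m < p) (x y : L) :
    divPow γ m ⁅x, y⁆ = ∑ i ∈ Finset.range p, ∑ j ∈ Finset.range p,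
      if i + j = m then ⁅divPow γ i x, divPow γ j y⁆ else 0 := by
  have hfac : ∀ i, i < p → (i.factorial : F) ≠ 0 := fun i hi h ↦ by
    rw [CharP.cast_eq_zero_iff F p, (Fact.out : p.Prime).dvd_factorial] at h
    omega
  rw [← Finset.sum_product', ← Finset.sum_filter]
  have hs : (Finset.range p ×ˢ Finset.range p).filter (fun a ↦ a.1 + a.2 = m)
      = Finset.HasAntidiagonal.antidiagonal m := by
    ext ⟨i, j⟩
    simp only [Finset.mem_filter, Finset.mem_product, Finset.mem_range,
      Finset.HasAntidiagonal.mem_antidiagonal]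
    omega
  rw [hs]
  have h := LieDerivation.iterate_apply_lie γ m x y
  simp only [divPow, Module.End.pow_apply, LieDerivation.coeFn_coe]
  rw [h, Finset.smul_sum]
  refine Finset.sum_congr rfl fun ⟨i, j⟩ hij ↦ ?_
  rw [Finset.HasAntidiagonal.mem_antidiagonal] at hij
  simp only at hij ⊢
  rw [smul_lie, lie_smul, smul_smul, ← Nat.cast_smul_eq_nsmul F, smul_smul]
  congr 1
  have h1 := hfac i (by omega)
  have h2 := hfac j (by omega)
  have h3 := hfac m hm
  have h4 : (m.choose i : F) * i.factorial * j.factorial = m.factorial := by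
    subst hij
    rw [Nat.choose_symm_add]
    rw [← Nat.cast_mul, ← Nat.cast_mul, Nat.add_choose_mul_factorial_mul_factorial]
  field_simp
  linear_combination h4

theorem sqBilin_eq (p : ℕ) (γ : LieDerivation F L L) (x y : L) :
    sqBilin p γ x y = ∑ i ∈ Finset.range p, ∑ j ∈ Finset.range p,
      if i + j = p then ⁅divPow γ i x, divPow γ j y⁆ else 0 := by
  rw [sqBilin_apply, ← Finset.sum_product', ← Finset.sum_filter]
  refine Finset.sum_bij' (fun i _ ↦ (i, p - i)) (fun a _ ↦ a.1) ?_ ?_ ?_ ?_ ?_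
  · intro i hi
    simp only [Finset.mem_Icc, Finset.mem_filter, Finset.mem_product, Finset.mem_range] at hi ⊢
    omega
  · rintro ⟨i, j⟩ hi
    simp only [Finset.mem_Icc, Finset.mem_filter, Finset.mem_product, Finset.mem_range] at hi ⊢
    omega
  · intro i hi
    rfl
  · rintro ⟨i, j⟩ hi
    simp only [Finset.mem_filter, Finset.mem_product, Finset.mem_range] at hi
    simp only [Prod.mk.injEq, true_and]
    omega
  · intro i hi
    simp only [divPow]
    rw [smul_lie, lie_smul, smul_smul, mul_inv]

theorem sqBilin_lie (p : ℕ) [Fact p.Prime] [CharP F p] (γ : LieDerivation F L L) (x y z : L) :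
    sqBilin p γ ⁅x, y⁆ z + ⁅sqBilin p γ x y, z⁆ =
      ∑ i ∈ Finset.range p, ∑ j ∈ Finset.range p, ∑ k ∈ Finset.range p,
        if i + j + k = p then ⁅⁅divPow γ i x, divPow γ j y⁆, divPow γ k z⁆ else 0 := by
  have hp : 0 < p := (Fact.out : p.Prime).pos
  have h1 : sqBilin p γ ⁅x, y⁆ z =
      ∑ i ∈ Finset.range p, ∑ j ∈ Finset.range p, ∑ k ∈ Finset.range p,
        if i + j + k = p ∧ k ≠ 0 then ⁅⁅divPow γ i x, divPow γ j y⁆, divPow γ k z⁆ else 0 := by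
    rw [sqBilin_eq]
    have e : ∀ m ∈ Finset.range p, ∀ k ∈ Finset.range p,
        (if m + k = p then ⁅divPow γ m ⁅x, y⁆, divPow γ k z⁆ else 0) =
        ∑ i ∈ Finset.range p, ∑ j ∈ Finset.range p, if i + j = m then
          (if i + j + k = p then ⁅⁅divPow γ i x, divPow γ j y⁆, divPow γ k z⁆ else 0)
          else 0 := by
      intro m hm k _
      rw [divPow_lie p γ m (Finset.mem_range.1 hm)]
      split_ifs with h
      · simp only [sum_lie]
        refine Finset.sum_congr rfl fun i _ ↦ Finset.sum_congr rfl fun j _ ↦ ?_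
        by_cases h' : i + j = m
        · rw [if_pos h', if_pos h', if_pos (by omega)]
        · rw [if_neg h', if_neg h', zero_lie]
      · refine (Finset.sum_eq_zero fun i _ ↦ Finset.sum_eq_zero fun j _ ↦ ?_).symm
        by_cases h' : i + j = m
        · rw [if_pos h', if_neg (by omega)]
        · rw [if_neg h']
    rw [Finset.sum_congr rfl fun m hm ↦ Finset.sum_congr rfl fun k hk ↦ e m hm k hk]
    rw [Finset.sum_comm]
    have e2 : ∀ k ∈ Finset.range p,
        (∑ m ∈ Finset.range p, ∑ i ∈ Finset.range p, ∑ j ∈ Finset.range p,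
          if i + j = m then
            (if i + j + k = p then ⁅⁅divPow γ i x, divPow γ j y⁆, divPow γ k z⁆ else 0)
          else 0) =
        ∑ i ∈ Finset.range p, ∑ j ∈ Finset.range p,
          if i + j + k = p ∧ k ≠ 0 then ⁅⁅divPow γ i x, divPow γ j y⁆, divPow γ k z⁆ else 0 := by
      intro k _
      rw [Finset.sum_comm]
      refine Finset.sum_congr rfl fun i _ ↦ ?_
      rw [Finset.sum_comm]
      refine Finset.sum_congr rfl fun j _ ↦ ?_
      rw [Finset.sum_ite_eq]
      simp only [Finset.mem_range]
      split_ifs <;> first | rfl | omega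
    rw [Finset.sum_congr rfl e2, Finset.sum_comm]
    refine Finset.sum_congr rfl fun i _ ↦ ?_
    rw [Finset.sum_comm]
  have h2 : ⁅sqBilin p γ x y, z⁆ =
      ∑ i ∈ Finset.range p, ∑ j ∈ Finset.range p, ∑ k ∈ Finset.range p,
        if i + j + k = p ∧ k = 0 then ⁅⁅divPow γ i x, divPow γ j y⁆, divPow γ k z⁆ else 0 := by
    rw [sqBilin_eq]
    simp only [sum_lie]
    refine Finset.sum_congr rfl fun i _ ↦ Finset.sum_congr rfl fun j _ ↦ ?_
    rw [Finset.sum_eq_single_of_mem 0 (Finset.mem_range.2 hp)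
      (fun k _ hk ↦ if_neg fun h ↦ hk h.2)]
    have hz : divPow γ 0 z = z := by simp [divPow]
    simp only [add_zero, and_true, hz]
    split_ifs <;> simp
  rw [h1, h2]
  simp only [← Finset.sum_add_distrib]
  refine Finset.sum_congr rfl fun i _ ↦ Finset.sum_congr rfl fun j _ ↦
    Finset.sum_congr rfl fun k _ ↦ ?_
  by_cases hk : k = 0 <;> simp [hk]

theorem sqCochain_mem_twoCocycle (p : ℕ) [Fact p.Prime] [CharP F p] (γ : LieDerivation F L L) :
    sqCochain p γ ∈ twoCocycle F L L := by
  rw [mem_twoCocycle_iff]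
  ext x y z
  have hxy := sqBilin_lie p γ x y z
  have hxz := sqBilin_lie p γ x z y
  have hyz := sqBilin_lie p γ y z x
  have key : ∑ i ∈ Finset.range p, ∑ j ∈ Finset.range p, ∑ k ∈ Finset.range p,
        (if i + j + k = p then ⁅⁅divPow γ i x, divPow γ j y⁆, divPow γ k z⁆ else 0) -
      (∑ i ∈ Finset.range p, ∑ j ∈ Finset.range p, ∑ k ∈ Finset.range p,
        if i + j + k = p then ⁅⁅divPow γ i x, divPow γ j z⁆, divPow γ k y⁆ else 0) +
      (∑ i ∈ Finset.range p, ∑ j ∈ Finset.range p, ∑ k ∈ Finset.range p,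
        if i + j + k = p then ⁅⁅divPow γ i y, divPow γ j z⁆, divPow γ k x⁆ else 0) = 0 := by
    have r2 : (∑ i ∈ Finset.range p, ∑ j ∈ Finset.range p, ∑ k ∈ Finset.range p,
        if i + j + k = p then ⁅⁅divPow γ i x, divPow γ j z⁆, divPow γ k y⁆ else 0) =
        ∑ i ∈ Finset.range p, ∑ j ∈ Finset.range p, ∑ k ∈ Finset.range p,
        if i + k + j = p then ⁅⁅divPow γ i x, divPow γ k z⁆, divPow γ j y⁆ else 0 :=
      Finset.sum_congr rfl fun i _ ↦ Finset.sum_comm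
    have r3 : (∑ i ∈ Finset.range p, ∑ j ∈ Finset.range p, ∑ k ∈ Finset.range p,
        if i + j + k = p then ⁅⁅divPow γ i y, divPow γ j z⁆, divPow γ k x⁆ else 0) =
        ∑ i ∈ Finset.range p, ∑ j ∈ Finset.range p, ∑ k ∈ Finset.range p,
        if j + k + i = p then ⁅⁅divPow γ j y, divPow γ k z⁆, divPow γ i x⁆ else 0 := by
      rw [Finset.sum_congr rfl fun i _ ↦ Finset.sum_comm, Finset.sum_comm]
    rw [r2, r3]
    simp only [← Finset.sum_sub_distrib, ← Finset.sum_add_distrib]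
    refine Finset.sum_eq_zero fun i _ ↦ Finset.sum_eq_zero fun j _ ↦
      Finset.sum_eq_zero fun k _ ↦ ?_
    have c2 : i + k + j = i + j + k := by omega
    have c3 : j + k + i = i + j + k := by omega
    rw [c2, c3]
    split_ifs
    · generalize divPow γ i x = u
      generalize divPow γ j y = v
      generalize divPow γ k z = w
      have h := lie_jacobi u v w
      rw [← lie_skew u ⁅v, w⁆, ← lie_skew v ⁅w, u⁆, ← lie_skew w ⁅u, v⁆, ← lie_skew w u,
        neg_lie] at h
      rw [← neg_eq_zero, ← h]
      abel
    · simp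
  rw [← hxy, ← hxz, ← hyz] at key
  have v : ∀ a b, sqCochain p γ a b = sqBilin p γ a b := fun _ _ ↦ rfl
  simp only [d₂₃_apply, v, LinearMap.zero_apply]
  rw [← lie_skew x (sqBilin p γ y z), ← lie_skew y (sqBilin p γ x z),
    ← lie_skew z (sqBilin p γ x y), ← neg_eq_zero, ← key]
  abel

/-- The 2-cocycle `Sq(γ) ∈ Z²(L, L)` attached to a derivation `γ` of a Lie algebra `L` over a
field of characteristic `p > 0`. -/
def Sq (p : ℕ) [Fact p.Prime] [CharP F p] (γ : LieDerivation F L L) : twoCocycle F L L :=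
  ⟨sqCochain p γ, sqCochain_mem_twoCocycle p γ⟩

end Squaring

section Algebra

variable (p n : ℕ) (F : Type*) [Field F]

/-- The ideal `(x₁^p, …, xₙ^p)` of `F[x₁, …, xₙ]`. -/
def truncIdeal : Ideal (MvPolynomial (Fin n) F) :=
  Ideal.span (Set.range fun i : Fin n ↦ (MvPolynomial.X i : MvPolynomial (Fin n) F) ^ p)

/-- The ring of truncated polynomials `A(n) = F[x₁, …, xₙ] / (x₁^p, …, xₙ^p)`. -/
abbrev A : Type _ := MvPolynomial (Fin n) F ⧸ truncIdeal p n F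

/-- The Witt–Jacobson algebra `W(n) = Der_F A(n)`, with the commutator bracket. -/
abbrev W : Type _ := Derivation F (A p n F) (A p n F)

variable {n} in
theorem mk_pderiv_eq_zero [CharP F p] (i : Fin n) (f : MvPolynomial (Fin n) F)
    (hf : Ideal.Quotient.mkₐ F (truncIdeal p n F) f = 0) :
    Ideal.Quotient.mkₐ F (truncIdeal p n F) (MvPolynomial.pderiv i f) = 0 := by
  simp only [Ideal.Quotient.mkₐ_eq_mk, Ideal.Quotient.eq_zero_iff_mem] at hf ⊢
  unfold truncIdeal at hf
  induction hf using Submodule.span_induction with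
  | mem x hx =>
    obtain ⟨j, rfl⟩ := hx
    simp [Derivation.leibniz_pow]
  | zero => simp
  | add x y _ _ hx hy => rw [map_add]; exact add_mem hx hy
  | smul a x hx' hx =>
    rw [smul_eq_mul, Derivation.leibniz]
    exact add_mem (Ideal.mul_mem_left _ _ hx) (Ideal.mul_mem_right _ _ hx')

variable {n} in
/-- The derivation `D_i = ∂/∂x_i` of `A(n)`, induced by the partial derivative of polynomials. -/
def D [CharP F p] (i : Fin n) : W p n F :=
  Derivation.liftOfSurjective (f := Ideal.Quotient.mkₐ F (truncIdeal p n F))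
    (Ideal.Quotient.mkₐ_surjective F _) (d := MvPolynomial.pderiv i)
    (mk_pderiv_eq_zero p F i)

variable {n} in
theorem D_mk [CharP F p] (i : Fin n) (f : MvPolynomial (Fin n) F) :
    D p F i (Ideal.Quotient.mkₐ F (truncIdeal p n F) f) =
      Ideal.Quotient.mkₐ F (truncIdeal p n F) (MvPolynomial.pderiv i f) :=
  Derivation.liftOfSurjective_apply (Ideal.Quotient.mkₐ_surjective F _)
    (mk_pderiv_eq_zero p F i) f

variable {n} in
/-- The class in `H²(W(n), W(n))` of the cocycle `Sq(D_i)`, where the element `D_i` of `W(n)` is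
regarded as the inner derivation `ad D_i`. -/
def sqClass [Fact p.Prime] [CharP F p] (i : Fin n) : H2 F (W p n F) (W p n F) :=
  (twoCoboundary F (W p n F) (W p n F)).mkQ (Sq p (LieDerivation.ad F (W p n F) (D p F i)))

end Algebra

end WittJacobson

end

/-! The proof reduces the cohomology of $W(n)$ to that of the isotropy subalgebra $W_0$, the fields
vanishing at the origin, with values in the tangent space $F^n$ there. This is in the manner of
Shapiro's lemma: a family of fields stable under all $\mathrm{ad}\,\partial_i$ is determined by its
values at the origin (`eq_zero_of_stable`).

The truncation $x_i^p=0$ creates an obstruction. Multiplication by $x_m$ and $\partial_m$ satisfy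
the Weyl relation, so $\partial_m$ can be inverted only on $\ker\partial_m^{p-1}$ (`weyl_integ`).
For a 2-cocycle $\Phi$ the obstruction $\partial_m^{p-1}\cdot\Phi(\partial_m,\cdot)$ is a derivation
(`toEnd_pow_isDerivation`), hence inner (`exists_eq_lie`), say $\mathrm{ad}\,z$. Since
$z=\partial_m^{p-1}u$ for some field $u$, a coboundary removes it. So every cocycle is cohomologous
to one vanishing on the constant fields (`exists_normalise`). Such a cocycle is determined by its
value at the origin, a 2-cocycle of $W_0$ in $F^n$, and it is a coboundary as soon as that value is
exact (`mem_twoCoboundary_of_isExact`).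

A 2-cocycle $\omega$ of $W_0$ splits into components of weight in $\mathbb Z^n$. Weights nonzero
modulo $p$ give exact components, by contraction with an Euler field (`Homog.isExact`). In any other
nonzero component each coordinate of the weight is $0$ or $p$, and not all are $0$. Two coordinates
equal to $p$ force vanishing (`Homog.eq_zero_of_two`). With a single coordinate $p$, at place $i$,
the component vanishes once certain coefficients of $\omega(x_i^2\partial_i,\cdot)$ do
(`Homog.eq_zero_of_one`): those at $x_i^{p-2}x_j\partial_j$, which coboundaries can adjust at will,
and one test coefficient at $x_i^{p-1}\partial_j$. These vanishing results rest on the radical of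
$\omega$ being a subalgebra (`lie_mem_radical`), so that it suffices to place generators of $W_0$ in
it; for $n=1$ a recursion replaces generation.

The test coefficient is blind to coboundaries, because $[x_i^2\partial_i,x_i^{p-1}\partial_j]=0$ and
both fields act trivially on the tangent space. On $\mathrm{Sq}(\partial_i)$ it equals $-1$ if $j\ne
i$ and $-3$ if $j=i$ (`sqD_quad_top`). Only $n=1$ forces $j=i$, whence the exception $p=3$: there
the two test fields coincide, nothing is detected and every cocycle is a coboundary, while
$\partial,x\partial,x^2\partial$ span a copy of $\mathfrak{sl}_2$. -/

set_option linter.unusedSectionVars false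

noncomputable section

namespace WittJacobson

/-! ### Monomials and coefficients in the truncated polynomial ring. -/

section Monomials

variable (p : ℕ) {n : ℕ} (F : Type*) [Field F]

/-- The monomial `x^a` of `A(n)`; it vanishes as soon as some exponent is at least `p`. -/
def mon (a : Fin n → ℕ) : A p n F :=
  Ideal.Quotient.mkₐ F (truncIdeal p n F)
    (MvPolynomial.monomial (Finsupp.equivFunOnFinite.symm a) 1)

/-- The coordinate `x_i` of `A(n)`. -/
def coord (i : Fin n) : A p n F := Ideal.Quotient.mkₐ F (truncIdeal p n F) (MvPolynomial.X i)

theorem mon_mul (a b : Fin n → ℕ) : mon p F a * mon p F b = mon p F (a + b) := by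
  have : Finsupp.equivFunOnFinite.symm (a + b) =
      Finsupp.equivFunOnFinite.symm a + Finsupp.equivFunOnFinite.symm b := by ext; rfl
  rw [mon, mon, ← map_mul, MvPolynomial.monomial_mul, one_mul, mon, this]

theorem mon_zero : mon p F (0 : Fin n → ℕ) = 1 := by
  have : (Finsupp.equivFunOnFinite.symm (0 : Fin n → ℕ)) = 0 := by ext; rfl
  rw [mon, this]
  exact map_one _

theorem mon_single (i : Fin n) : mon p F (Pi.single i 1) = coord p F i := by
  have : (Finsupp.equivFunOnFinite.symm (Pi.single i 1 : Fin n → ℕ)) = Finsupp.single i 1 := by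
    ext t; simp [Finsupp.single_apply]
  rw [mon, this]
  rfl

theorem truncIdeal_eq : truncIdeal p n F =
    Ideal.span ((fun s ↦ MvPolynomial.monomial s (1 : F)) ''
      Set.range fun i : Fin n ↦ Finsupp.single i p) := by
  rw [truncIdeal, ← Set.range_comp]
  congr 2
  ext1 i
  simp [MvPolynomial.X_pow_eq_monomial]

/-- The ideal is generated by monomials, so membership is tested on the support. This is what makes
the coefficients with all exponents below `p` well defined on the quotient. -/
theorem mem_truncIdeal_iff {f : MvPolynomial (Fin n) F} :
    f ∈ truncIdeal p n F ↔ ∀ s ∈ f.support, ∃ i, p ≤ s i := by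
  rw [truncIdeal_eq, MvPolynomial.mem_ideal_span_monomial_image]
  simp

theorem mon_eq_zero {a : Fin n → ℕ} {i : Fin n} (h : p ≤ a i) : mon p F a = 0 := by
  rw [mon, Ideal.Quotient.mkₐ_eq_mk, Ideal.Quotient.eq_zero_iff_mem, mem_truncIdeal_iff]
  intro s hs
  classical
  rw [MvPolynomial.support_monomial, if_neg one_ne_zero, Finset.mem_singleton] at hs
  exact ⟨i, by rw [hs]; exact h⟩

/-- The coefficient of the monomial `x^a` (by convention `0` if `x^a = 0`). -/
def coefA (a : Fin n → ℕ) : A p n F →ₗ[F] F :=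
  if h : ∀ i, a i < p then
    (((truncIdeal p n F).restrictScalars F).liftQ
      (MvPolynomial.lcoeff F (Finsupp.equivFunOnFinite.symm a)) (fun f hf ↦ by
        rw [Submodule.restrictScalars_mem, mem_truncIdeal_iff] at hf
        rw [LinearMap.mem_ker, MvPolynomial.lcoeff_apply, ← MvPolynomial.notMem_support_iff]
        intro hs
        obtain ⟨i, hi⟩ := hf _ hs
        exact absurd (h i) (not_lt.2 hi))) ∘ₗ
    (Submodule.Quotient.restrictScalarsEquiv F (truncIdeal p n F)).symm.toLinearMap
  else 0

variable {p F}

theorem coefA_mk {a : Fin n → ℕ} (h : ∀ i, a i < p) (f : MvPolynomial (Fin n) F) :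
    coefA p F a (Ideal.Quotient.mkₐ F (truncIdeal p n F) f) =
      f.coeff (Finsupp.equivFunOnFinite.symm a) := by
  rw [coefA, dif_pos h]
  rfl

theorem coefA_mon {a : Fin n → ℕ} (h : ∀ i, a i < p) (b : Fin n → ℕ) :
    coefA p F a (mon p F b) = if b = a then 1 else 0 := by
  rw [mon, coefA_mk h, MvPolynomial.coeff_monomial]
  simp

theorem coefA_ext {f : A p n F} (h : ∀ a : Fin n → ℕ, (∀ i, a i < p) → coefA p F a f = 0) :
    f = 0 := by
  obtain ⟨f, rfl⟩ := Ideal.Quotient.mkₐ_surjective F _ f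
  rw [Ideal.Quotient.mkₐ_eq_mk, Ideal.Quotient.eq_zero_iff_mem, mem_truncIdeal_iff]
  intro s hs
  by_contra! hc
  have := h s hc
  rw [coefA_mk hc] at this
  rw [MvPolynomial.mem_support_iff] at hs
  apply hs
  convert this
  ext; rfl

theorem mon_mem_span (a : Fin n → ℕ) : mon p F a ∈ Submodule.span F
    (Set.range fun a : Fin n → Fin p ↦ mon p F (fun i ↦ (a i : ℕ))) := by
  by_cases h : ∀ i, a i < p
  · exact Submodule.subset_span ⟨fun i ↦ ⟨a i, h i⟩, rfl⟩
  · push Not at h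
    obtain ⟨i, hi⟩ := h
    rw [mon_eq_zero p F hi]
    exact zero_mem _

theorem span_mon : Submodule.span F
    (Set.range fun a : Fin n → Fin p ↦ mon p F (fun i ↦ (a i : ℕ))) = ⊤ := by
  rw [eq_top_iff]
  rintro f -
  obtain ⟨f, rfl⟩ := Ideal.Quotient.mkₐ_surjective F _ f
  induction f using MvPolynomial.induction_on' with
  | monomial u c =>
    have : (MvPolynomial.monomial u c : MvPolynomial (Fin n) F) =
        c • MvPolynomial.monomial (Finsupp.equivFunOnFinite.symm u) 1 := by
      have : Finsupp.equivFunOnFinite.symm u = u := by ext; rfl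
      rw [MvPolynomial.smul_monomial, smul_eq_mul, mul_one, this]
    rw [this, map_smul]
    exact Submodule.smul_mem _ _ (mon_mem_span u)
  | add f g hf hg => rw [map_add]; exact add_mem hf hg

variable (p F) in
/-- The augmentation `A(n) → F`, evaluation at the origin. -/
def aug [Fact p.Prime] : A p n F →ₐ[F] F :=
  Ideal.Quotient.liftₐ (truncIdeal p n F) (MvPolynomial.aeval (fun _ ↦ 0)) (fun f hf ↦ by
    have : truncIdeal p n F ≤
        RingHom.ker (MvPolynomial.aeval (R := F) (fun _ : Fin n ↦ (0 : F))) := by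
      rw [truncIdeal, Ideal.span_le]
      rintro _ ⟨i, rfl⟩
      simp [(Fact.out : p.Prime).ne_zero]
    exact this hf)

theorem aug_mk [Fact p.Prime] (f : MvPolynomial (Fin n) F) :
    aug p F (Ideal.Quotient.mkₐ F (truncIdeal p n F) f) = MvPolynomial.constantCoeff f := by
  have : aug p F (Ideal.Quotient.mkₐ F (truncIdeal p n F) f) =
    MvPolynomial.aeval (fun _ ↦ (0 : F)) f := rfl
  rw [this, MvPolynomial.aeval_zero']
  rfl

theorem aug_eq_coefA [Fact p.Prime] (f : A p n F) : aug p F f = coefA p F 0 f := by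
  obtain ⟨f, rfl⟩ := Ideal.Quotient.mkₐ_surjective F _ f
  have h0 : (Finsupp.equivFunOnFinite.symm (0 : Fin n → ℕ)) = 0 := by ext; rfl
  rw [aug_mk, coefA_mk (a := 0) (fun _ ↦ (Fact.out : p.Prime).pos),
    MvPolynomial.constantCoeff_eq, h0]

theorem aug_mon [Fact p.Prime] (a : Fin n → ℕ) :
    aug p F (mon p F a) = if a = 0 then 1 else 0 := by
  rw [aug_eq_coefA, coefA_mon (a := 0) (fun _ ↦ (Fact.out : p.Prime).pos)]

theorem aug_coord [Fact p.Prime] (i : Fin n) : aug p F (coord p F i) = 0 := by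
  rw [← mon_single, aug_mon, if_neg]
  intro h
  simpa using congrFun h i

end Monomials

/-! ### Monomial basis of `W(n)`, isotropy subalgebra and tangent space at the origin. -/

section VectorFields

variable {p n : ℕ} {F : Type*} [Field F]

theorem W_ext {d d' : W p n F} (h : ∀ i, d (coord p F i) = d' (coord p F i)) : d = d' := by
  have key : ∀ f, d (Ideal.Quotient.mkₐ F (truncIdeal p n F) f) =
      d' (Ideal.Quotient.mkₐ F (truncIdeal p n F) f) := by
    intro f
    induction f using MvPolynomial.induction_on with
    | C c =>
      have : Ideal.Quotient.mkₐ F (truncIdeal p n F) (MvPolynomial.C c) = algebraMap F _ c :=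
        rfl
      rw [this, Derivation.map_algebraMap, Derivation.map_algebraMap]
    | add f g hf hg => rw [map_add, map_add, map_add, hf, hg]
    | mul_X f i hf =>
      rw [map_mul, Derivation.leibniz, Derivation.leibniz, hf]
      have := h i
      rw [coord] at this
      rw [this]
  ext f
  obtain ⟨f, rfl⟩ := Ideal.Quotient.mkₐ_surjective F _ f
  exact key f

theorem sum_W_apply {ι : Type*} (s : Finset ι) (d : ι → W p n F) (f : A p n F) :
    (∑ i ∈ s, d i) f = ∑ i ∈ s, d i f :=
  map_sum (⟨⟨fun d : W p n F ↦ d f, rfl⟩, fun _ _ ↦ rfl⟩ : W p n F →+ A p n F) d s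

variable [CharP F p]

theorem D_coord (i j : Fin n) : D p F i (coord p F j) = if j = i then 1 else 0 := by
  rw [coord, D_mk, MvPolynomial.pderiv_X, Pi.single_apply]
  split_ifs <;> simp

theorem D_mon (j : Fin n) (b : Fin n → ℕ) :
    D p F j (mon p F b) = (b j : F) • mon p F (b - Pi.single j 1) := by
  have : Finsupp.equivFunOnFinite.symm (b - Pi.single j 1) =
      Finsupp.equivFunOnFinite.symm b - Finsupp.single j 1 := by
    ext t
    simp [Finsupp.single_apply, Pi.single_apply, eq_comm]
  rw [mon, D_mk, MvPolynomial.pderiv_monomial, mon, ← map_smul, MvPolynomial.smul_monomial, this]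
  simp

theorem coefA_D {a : Fin n → ℕ} {j : Fin n} (h : ∀ i, (a + Pi.single j 1 : Fin n → ℕ) i < p)
    (f : A p n F) :
    coefA p F a (D p F j f) = ((a j : F) + 1) * coefA p F (a + Pi.single j 1) f := by
  have h' : ∀ i, a i < p := fun i ↦ lt_of_le_of_lt (Nat.le_add_right _ _) (h i)
  have e : Finsupp.equivFunOnFinite.symm (a + Pi.single j 1) =
      Finsupp.equivFunOnFinite.symm a + Finsupp.single j 1 := by
    ext t
    simp [Finsupp.single_apply, Pi.single_apply, eq_comm]
  obtain ⟨f, rfl⟩ := Ideal.Quotient.mkₐ_surjective F _ f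
  rw [D_mk, coefA_mk h', coefA_mk h, MvPolynomial.coeff_pderiv, mul_comm, e]
  rfl

theorem eq_sum_smul_D (d : W p n F) : d = ∑ i, d (coord p F i) • D p F i := by
  apply W_ext
  intro k
  rw [sum_W_apply]
  simp [D_coord]

theorem apply_eq_sum (d : W p n F) (f : A p n F) :
    d f = ∑ i, d (coord p F i) * D p F i f := by
  conv_lhs => rw [eq_sum_smul_D d]
  rw [sum_W_apply]
  rfl

/-- The vector field `x^a ∂_j`. -/
def E (a : Fin n → ℕ) (j : Fin n) : W p n F := mon p F a • D p F j

theorem E_zero (j : Fin n) : (E 0 j : W p n F) = D p F j := by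
  rw [E, mon_zero, one_smul]

theorem E_eq_zero {a : Fin n → ℕ} {i : Fin n} (h : p ≤ a i) (j : Fin n) :
    (E a j : W p n F) = 0 := by
  rw [E, mon_eq_zero p F h, zero_smul]

theorem E_coord (a : Fin n → ℕ) (j k : Fin n) :
    (E a j : W p n F) (coord p F k) = if k = j then mon p F a else 0 := by
  simp [E, D_coord]

/-- The truncated subtraction in the exponents is harmless: where it would truncate, the coefficient
`b j` or `a l` in front is zero. -/
theorem lie_E (a b : Fin n → ℕ) (j l : Fin n) :
    ⁅(E a j : W p n F), (E b l : W p n F)⁆ =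
      (b j : F) • E (a + b - Pi.single j 1) l - (a l : F) • E (a + b - Pi.single l 1) j := by
  have key : ∀ (a b : Fin n → ℕ) (j : Fin n),
      mon p F a * D p F j (mon p F b) = (b j : F) • mon p F (a + b - Pi.single j 1) := by
    intro a b j
    rw [D_mon, mul_smul_comm, mon_mul]
    by_cases h : b j = 0
    · simp [h]
    · congr 2
      funext t
      simp only [Pi.add_apply, Pi.sub_apply, Pi.single_apply]
      split_ifs with h
      · subst h; omega
      · omega
  apply W_ext
  intro k
  rw [Derivation.commutator_apply]
  simp only [E_coord, Derivation.sub_apply, Derivation.smul_apply]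
  have h1 : ∀ f, (E a j : W p n F) f = mon p F a * D p F j f := fun f ↦ rfl
  have h2 : ∀ f, (E b l : W p n F) f = mon p F b * D p F l f := fun f ↦ rfl
  congr 1
  · split_ifs
    · rw [h1, key]
    · simp
  · split_ifs
    · rw [h2, key, add_comm]
    · simp

/-- The coefficient of `x^a ∂_j`. -/
def coefW (a : Fin n → ℕ) (j : Fin n) : W p n F →ₗ[F] F where
  toFun d := coefA p F a (d (coord p F j))
  map_add' _ _ := by simp
  map_smul' _ _ := by simp

theorem coefW_E {a : Fin n → ℕ} (h : ∀ i, a i < p) (j : Fin n) (b : Fin n → ℕ) (l : Fin n) :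
    coefW a j (E b l : W p n F) = if b = a ∧ l = j then 1 else 0 := by
  show coefA p F a ((E b l : W p n F) (coord p F j)) = _
  rw [E_coord]
  by_cases hl : j = l
  · simp [hl, coefA_mon h]
  · simp [hl, Ne.symm hl]

theorem smul_D_mem_span (f : A p n F) (j : Fin n) : f • D p F j ∈
    Submodule.span F (Set.range fun s : (Fin n → Fin p) × Fin n ↦
      (E (fun i ↦ (s.1 i : ℕ)) s.2 : W p n F)) := by
  have hf : f ∈ Submodule.span F
      (Set.range fun a : Fin n → Fin p ↦ mon p F (fun i ↦ (a i : ℕ))) := by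
    rw [span_mon]; trivial
  induction hf using Submodule.span_induction with
  | mem x hx =>
    obtain ⟨a, rfl⟩ := hx
    exact Submodule.subset_span ⟨(a, j), rfl⟩
  | zero => rw [zero_smul]; exact zero_mem _
  | add x y _ _ hx hy => rw [add_smul]; exact add_mem hx hy
  | smul c x _ hx => rw [smul_assoc]; exact Submodule.smul_mem _ _ hx

variable (p n F) in
/-- The monomial basis of `W(n)`. -/
def basisE : Module.Basis ((Fin n → Fin p) × Fin n) F (W p n F) :=
  Module.Basis.mk (v := fun s ↦ E (fun i ↦ (s.1 i : ℕ)) s.2)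
    (by
      rw [linearIndependent_iff']
      intro s g hg t ht
      have := congrArg (coefW (fun i ↦ (t.1 i : ℕ)) t.2) hg
      rw [map_sum, map_zero, Finset.sum_eq_single_of_mem t ht] at this
      · rw [map_smul, coefW_E fun i ↦ (t.1 i).2] at this
        simpa using this
      · intro u _ hu
        rw [map_smul, coefW_E fun i ↦ (t.1 i).2, if_neg, smul_zero]
        rintro ⟨h1, h2⟩
        apply hu
        refine Prod.ext ?_ h2
        funext i
        exact Fin.ext (congrFun h1 i))
    (by
      rintro d -
      rw [eq_sum_smul_D d]
      exact Submodule.sum_mem _ fun i _ ↦ smul_D_mem_span _ i)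

theorem basisE_apply (s : (Fin n → Fin p) × Fin n) :
    basisE p n F s = E (fun i ↦ (s.1 i : ℕ)) s.2 := by
  simp [basisE]

/-- Two linear maps on `W(n)` that agree on all `x^a ∂_j` are equal. -/
theorem hom_ext_E {M : Type*} [AddCommGroup M] [Module F M] {f g : W p n F →ₗ[F] M}
    (h : ∀ a j, (∀ i, a i < p) → f (E a j) = g (E a j)) : f = g := by
  apply (basisE p n F).ext
  intro s
  rw [basisE_apply]
  exact h _ _ fun i ↦ (s.1 i).2

variable [Fact p.Prime]

/-- The value of a vector field at the origin. -/
def ev : W p n F →ₗ[F] (Fin n → F) where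
  toFun d k := aug p F (d (coord p F k))
  map_add' _ _ := by ext; simp
  map_smul' _ _ := by ext; simp

theorem ev_apply (d : W p n F) (k : Fin n) : ev d k = aug p F (d (coord p F k)) := rfl

theorem ev_E (a : Fin n → ℕ) (j k : Fin n) :
    ev (E a j : W p n F) k = if a = 0 ∧ k = j then 1 else 0 := by
  rw [ev_apply, E_coord]
  by_cases h : k = j
  · simp [h, aug_mon]
  · simp [h]

theorem ev_E_of_ne {a : Fin n → ℕ} (ha : a ≠ 0) (j : Fin n) : ev (E a j : W p n F) = 0 := by
  ext k
  rw [ev_E, if_neg (fun h ↦ ha h.1)]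
  rfl

theorem ev_D (j : Fin n) : ev (D p F j) = Pi.single j 1 := by
  ext k
  rw [← E_zero, ev_E, Pi.single_apply]
  simp

variable (p F) in
/-- The constant vector field with value `v`. -/
def const : (Fin n → F) →ₗ[F] W p n F where
  toFun v := ∑ i, v i • D p F i
  map_add' _ _ := by simp [add_smul, Finset.sum_add_distrib]
  map_smul' _ _ := by simp [mul_smul, Finset.smul_sum]

theorem const_apply (v : Fin n → F) : const p F v = ∑ i, v i • D p F i := rfl

theorem ev_const (v : Fin n → F) : ev (const p F v) = v := by
  rw [const_apply, map_sum]
  simp only [map_smul, ev_D]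
  ext k
  simp [Pi.single_apply]

/-- The action of a vector field vanishing at the origin on the tangent space at the origin. -/
def act (x : W p n F) : (Fin n → F) →ₗ[F] (Fin n → F) where
  toFun v := ev ⁅x, const p F v⁆
  map_add' _ _ := by simp
  map_smul' _ _ := by simp

theorem act_apply (x : W p n F) (v : Fin n → F) : act x v = ev ⁅x, const p F v⁆ := rfl

theorem act_add (x y : W p n F) (v : Fin n → F) : act (x + y) v = act x v + act y v := by
  simp [act_apply]

theorem act_smul (c : F) (x : W p n F) (v : Fin n → F) : act (c • x) v = c • act x v := by
  simp [act_apply]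

theorem act_zero (v : Fin n → F) : act (0 : W p n F) v = 0 := by
  simp [act_apply]

theorem aug_apply_of_ev {x : W p n F} (hx : ev x = 0) (f : A p n F) : aug p F (x f) = 0 := by
  rw [apply_eq_sum, map_sum]
  refine Finset.sum_eq_zero fun i _ ↦ ?_
  rw [map_mul, ← ev_apply, hx]
  simp

theorem ev_lie_of_ev {x y : W p n F} (hx : ev x = 0) (hy : ev y = 0) : ev ⁅x, y⁆ = 0 := by
  ext k
  rw [ev_apply, Derivation.commutator_apply, map_sub, aug_apply_of_ev hx, aug_apply_of_ev hy]
  simp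

/-- The field `d` and the constant field with the same value differ by an element of the isotropy
subalgebra, which is closed under brackets. Hence the tangent space is a module over that
subalgebra, with action `act`. -/
theorem ev_lie {x : W p n F} (hx : ev x = 0) (d : W p n F) : ev ⁅x, d⁆ = act x (ev d) := by
  rw [act_apply, ← sub_eq_zero, ← map_sub, ← lie_sub]
  exact ev_lie_of_ev hx (by rw [map_sub, ev_const, sub_self])

theorem act_E (a : Fin n → ℕ) (j : Fin n) (v : Fin n → F) (k : Fin n) :
    act (E a j : W p n F) v k =
      - ∑ i, if a = Pi.single i 1 ∧ k = j then v i else 0 := by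
  rw [act_apply, const_apply, lie_sum, map_sum, Finset.sum_apply, ← Finset.sum_neg_distrib]
  refine Finset.sum_congr rfl fun i _ ↦ ?_
  rw [lie_smul, ← E_zero, lie_E]
  simp only [map_smul, map_neg, Pi.smul_apply, Pi.neg_apply, ev_E, Pi.zero_apply,
    Nat.cast_zero, zero_smul, zero_sub, add_zero, smul_eq_mul]
  by_cases hi : a i = 0
  · have : ¬ (a = Pi.single i 1 ∧ k = j) := by
      rintro ⟨rfl, -⟩
      simp at hi
    simp [hi, this]
  · have : a - Pi.single i 1 = 0 ↔ a = Pi.single i 1 := by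
      constructor
      · intro h
        funext t
        have := congrFun h t
        simp only [Pi.sub_apply, Pi.single_apply, Pi.zero_apply] at this ⊢
        split_ifs at this ⊢ with ht
        · subst ht; omega
        · omega
      · rintro rfl
        simp
    simp only [this]
    by_cases h : a = Pi.single i 1 ∧ k = j
    · rw [if_pos h, if_pos h, h.1]
      simp
    · rw [if_neg h, if_neg h]
      simp

/-- Vector fields vanishing to second order act trivially on the tangent space. -/
theorem act_E_of_two_le {a : Fin n → ℕ} (ha : 2 ≤ ∑ i, a i) (j : Fin n) (v : Fin n → F) :
    act (E a j : W p n F) v = 0 := by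
  ext k
  rw [act_E, Finset.sum_eq_zero, neg_zero, Pi.zero_apply]
  intro i _
  rw [if_neg]
  rintro ⟨rfl, -⟩
  rw [Finset.sum_pi_single' i 1 Finset.univ] at ha
  simp at ha

theorem act_E_single (i j : Fin n) (v : Fin n → F) :
    act (E (Pi.single i 1) j : W p n F) v = -(v i) • Pi.single j 1 := by
  ext k
  rw [act_E, Finset.sum_eq_single i]
  · by_cases h : k = j <;> simp [h]
  · intro t _ ht
    rw [if_neg]
    rintro ⟨h, -⟩
    have := congrFun h t
    simp [ht] at this
  · simp

/-- A subspace of `W(n)` stable under all `ad ∂_i` whose members vanish at the origin is zero. -/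
theorem eq_zero_of_stable (U : Submodule F (W p n F))
    (hU : ∀ i : Fin n, ∀ d ∈ U, ⁅(D p F i : W p n F), d⁆ ∈ U) (h0 : ∀ d ∈ U, ev d = 0)
    {d : W p n F} (hd : d ∈ U) : d = 0 := by
  -- Induction on the total degree: the coefficient of $x^a$ in `d`, times $a_i$, is the coefficient
  -- of $x^{a-\varepsilon_i}$ in $[\partial_i,d]$, and $a_i$ is invertible since $0<a_i<p$.
  have key : ∀ (m : ℕ) (a : Fin n → ℕ), ∑ i, a i = m → (∀ i, a i < p) → ∀ d ∈ U, ∀ k,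
      coefA p F a (d (coord p F k)) = 0 := by
    intro m
    induction m with
    | zero =>
      intro a ha _ d hd k
      have : a = 0 := by
        funext i
        exact (Finset.sum_eq_zero_iff.1 ha) i (Finset.mem_univ i)
      rw [this, ← aug_eq_coefA, ← ev_apply, h0 d hd]
      rfl
    | succ m ih =>
      intro a ha hap d hd k
      obtain ⟨i, hi⟩ : ∃ i, a i ≠ 0 := by
        by_contra! hc
        simp [hc] at ha
      have e : a = (a - Pi.single i 1) + Pi.single i 1 := by
        funext t
        simp only [Pi.add_apply, Pi.sub_apply, Pi.single_apply]
        split_ifs with ht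
        · subst ht; omega
        · omega
      have h1 := ih (a - Pi.single i 1) (by
        rw [e] at ha
        simp only [Pi.add_apply, Finset.sum_add_distrib] at ha
        rw [Finset.sum_pi_single' i 1 Finset.univ] at ha
        simpa using ha) (fun t ↦ lt_of_le_of_lt (Nat.sub_le _ _) (hap t)) _ (hU i d hd) k
      have h2 : ⁅D p F i, d⁆ (coord p F k) = D p F i (d (coord p F k)) := by
        rw [Derivation.commutator_apply, D_coord]
        split_ifs <;> simp
      rw [h2, coefA_D (by rw [← e]; exact hap), ← e] at h1
      refine (mul_eq_zero.1 h1).resolve_left ?_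
      have : (((a - Pi.single i 1 : Fin n → ℕ) i : ℕ) : F) + 1 = ((a i : ℕ) : F) := by
        have : (a - Pi.single i 1 : Fin n → ℕ) i + 1 = a i := by simp; omega
        rw [← this]
        push_cast
        rfl
      rw [this, CharP.cast_eq_zero_iff F p]
      exact Nat.not_dvd_of_pos_of_lt (Nat.pos_of_ne_zero hi) (hap i)
  apply W_ext
  intro k
  exact coefA_ext fun a ha ↦ key _ a rfl ha d hd k

end VectorFields

/-! ### Integration from the Weyl relation in characteristic `p`. -/

section Weyl

variable (p : ℕ) [Fact p.Prime] {F M : Type*} [Field F] [CharP F p] [AddCommGroup M] [Module F M]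

theorem factorial_ne_zero {k : ℕ} (hk : k < p) : (k.factorial : F) ≠ 0 := fun h ↦ by
  rw [CharP.cast_eq_zero_iff F p, (Fact.out : p.Prime).dvd_factorial] at h
  omega

/-- For operators with `∂ X - X ∂ = 1`, a right inverse of `∂` on the kernel of `∂^(p-1)`. -/
def integ (X d : Module.End F M) : Module.End F M :=
  ∑ k ∈ Finset.range (p - 1), ((-1) ^ k * ((k + 1).factorial : F)⁻¹) • (X ^ (k + 1) * d ^ k)

variable {p}

theorem weyl_pow {X d : Module.End F M} (h : d * X = X * d + 1) (k : ℕ) :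
    d * X ^ (k + 1) = X ^ (k + 1) * d + ((k + 1 : ℕ) : F) • X ^ k := by
  induction k with
  | zero => simp [h]
  | succ k ih =>
    rw [pow_succ, ← mul_assoc, ih, add_mul, mul_assoc, h, smul_mul_assoc, ← pow_succ, mul_add,
      mul_one, ← mul_assoc, ← pow_succ]
    rw [add_assoc]
    congr 1
    push_cast
    module

/-- Composing with `d` makes the sum telescope: its terms become differences of consecutive
$(-1)^kX^kd^k/k!$. Only $k=0$, the identity, and $k=p-1$, which kills `y`, remain. All factorials
involved are below $p!$, hence invertible. -/
theorem weyl_integ {X d : Module.End F M} (h : d * X = X * d + 1) {y : M}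
    (hy : (d ^ (p - 1)) y = 0) : d (integ p X d y) = y := by
  have hp : 1 < p := (Fact.out : p.Prime).one_lt
  let t : ℕ → Module.End F M := fun k ↦ ((-1) ^ k * (k.factorial : F)⁻¹) • (X ^ k * d ^ k)
  have key : d * integ p X d = t 0 - t (p - 1) := by
    rw [integ, Finset.mul_sum, ← Finset.sum_range_sub' t]
    refine Finset.sum_congr rfl fun k hk ↦ ?_
    rw [Finset.mem_range] at hk
    rw [mul_smul_comm, ← mul_assoc, weyl_pow h, add_mul, mul_assoc, ← pow_succ', smul_mul_assoc]
    have h1 : ((k + 1).factorial : F) ≠ 0 := factorial_ne_zero p (by omega)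
    have h2 : (k.factorial : F) ≠ 0 := factorial_ne_zero p (by omega)
    have h3 : ((k + 1 : ℕ) : F) * (k.factorial : F) = ((k + 1).factorial : F) := by
      rw [Nat.factorial_succ]; push_cast; ring
    have h4 : ((k + 1).factorial : F)⁻¹ * ((k + 1 : ℕ) : F) = (k.factorial : F)⁻¹ := by
      field_simp
      rw [h3]
    simp only [t]
    rw [smul_add, smul_smul, mul_assoc, h4, pow_succ (-1 : F)]
    module
  have := congrArg (fun f : Module.End F M ↦ f y) key
  simpa [t, hy] using this

theorem weyl_integ_comm {X d c : Module.End F M} (hX : Commute c X) (hd : Commute c d) :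
    Commute c (integ p X d) :=
  Commute.sum_right _ _ _ fun _ _ ↦
    ((hX.pow_right _).mul_right (hd.pow_right _)).smul_right _

/-- For `k = p - 1` this writes every element of $\ker d$ as a value of $d^{p-1}$. -/
theorem weyl_pow_apply {X d : Module.End F M} (h : d * X = X * d + 1) {y : M} (hy : d y = 0)
    (k : ℕ) : (d ^ k) ((X ^ k) y) = (k.factorial : F) • y := by
  induction k with
  | zero => simp
  | succ k ih =>
    have := congrArg (fun f : Module.End F M ↦ f y) (weyl_pow h k)
    simp only [Module.End.mul_apply, LinearMap.add_apply, hy, map_zero, zero_add,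
      LinearMap.smul_apply] at this
    rw [pow_succ, Module.End.mul_apply, this, map_smul, ih, smul_smul, ← Nat.cast_mul,
      ← Nat.factorial_succ]

end Weyl

/-! ### Nilpotency of the action on spaces of linear maps. -/

section PowZero

variable {p : ℕ} [Fact p.Prime] {F L M N : Type*} [Field F] [CharP F p] [LieRing L]
  [LieAlgebra F L] [AddCommGroup M] [Module F M] [LieRingModule L M] [LieModule F L M]
  [AddCommGroup N] [Module F N] [LieRingModule L N] [LieModule F L N]

/-- The action on linear maps is the difference of two commuting operators, post- and
pre-composition, so its `p`-th power is computed by Frobenius. -/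
theorem toEnd_hom_pow_eq_zero {x : L} (hM : LieModule.toEnd F L M x ^ p = 0)
    (hN : LieModule.toEnd F L N x ^ p = 0) : LieModule.toEnd F L (M →ₗ[F] N) x ^ p = 0 := by
  let a : Module.End F (M →ₗ[F] N) := LinearMap.llcomp F M N N (LieModule.toEnd F L N x)
  let b : Module.End F (M →ₗ[F] N) := -LinearMap.lcomp F N (LieModule.toEnd F L M x)
  have ha : ∀ k f m, (a ^ k) f m = (LieModule.toEnd F L N x ^ k) (f m) := by
    intro k
    induction k with
    | zero => intro f m; rfl
    | succ k ih => intro f m; rw [pow_succ, pow_succ, Module.End.mul_apply, ih]; rfl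
  have hb : ∀ k f m, (b ^ k) f m = (-1 : F) ^ k • f ((LieModule.toEnd F L M x ^ k) m) := by
    intro k
    induction k with
    | zero => intro f m; simp
    | succ k ih =>
      intro f m
      rw [pow_succ, Module.End.mul_apply, ih, pow_succ' (LieModule.toEnd F L M x),
        Module.End.mul_apply]
      simp [b, pow_succ]
  have e : LieModule.toEnd F L (M →ₗ[F] N) x = a + b := by
    ext f m
    simp [a, b, sub_eq_add_neg]
  have hc : Commute a b := by
    ext f m
    simp [a, b]
  obtain ⟨r, hr⟩ := hc.exists_add_pow_prime_eq (Fact.out : p.Prime)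
  have hp : ((p : ℕ) : Module.End F (M →ₗ[F] N)) = 0 := by
    ext f m
    rw [← Nat.smul_one_eq_cast, ← Nat.cast_smul_eq_nsmul F, CharP.cast_eq_zero]
    simp
  rw [e, hr, hp]
  ext f m
  simp [ha, hb, hM, hN]

end PowZero

/-! ### The operators $\partial_i$ and $x_m$ on `W(n)` and on its endomorphisms. -/

section Operators

variable {p n : ℕ} {F : Type*} [Field F] [CharP F p]

theorem lie_E_single (i : Fin n) (a : Fin n → ℕ) (j : Fin n) :
    ⁅(D p F i : W p n F), (E a j : W p n F)⁆ = (a i : F) • E (a - Pi.single i 1) j := by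
  rw [← E_zero, lie_E]
  simp

theorem ad_D_pow_E (i : Fin n) (k : ℕ) (a : Fin n → ℕ) (j : Fin n) :
    (LieModule.toEnd F (W p n F) (W p n F) (D p F i) ^ k) (E a j) =
      ((a i).descFactorial k : F) • E (a - Pi.single i k) j := by
  induction k with
  | zero => simp
  | succ k ih =>
    rw [pow_succ', Module.End.mul_apply, ih, map_smul, LieModule.toEnd_apply_apply, lie_E_single,
      smul_smul, Nat.descFactorial_succ]
    have h1 : (a - Pi.single i k : Fin n → ℕ) i = a i - k := by simp
    have h2 : a - Pi.single i k - Pi.single i 1 = a - Pi.single i (k + 1) := by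
      funext t
      simp only [Pi.sub_apply, Pi.single_apply]
      split_ifs <;> omega
    rw [h1, h2]
    push_cast
    rw [mul_comm]

theorem ad_D_pow (i : Fin n) : LieModule.toEnd F (W p n F) (W p n F) (D p F i) ^ p = 0 := by
  apply hom_ext_E
  intro a j ha
  rw [ad_D_pow_E, Nat.descFactorial_eq_zero_iff_lt.2 (ha i)]
  simp

theorem lie_A_smul (d e : W p n F) (f : A p n F) : ⁅d, f • e⁆ = d f • e + f • ⁅d, e⁆ := by
  ext g
  simp only [Derivation.commutator_apply, Derivation.smul_apply, Derivation.add_apply,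
    Derivation.leibniz, smul_eq_mul]
  ring

variable (p F) in
/-- Multiplication by `x_m` on `W(n)`. -/
def mulX (m : Fin n) : Module.End F (W p n F) where
  toFun d := coord p F m • d
  map_add' := smul_add _
  map_smul' _ _ := smul_comm _ _ _

theorem mulX_apply (m : Fin n) (d : W p n F) : mulX p F m d = coord p F m • d := rfl

variable (p F) in
/-- Multiplication by `x_m` on `Hom(W(n), W(n))`. -/
def mulXHom (m : Fin n) : Module.End F (W p n F →ₗ[F] W p n F) :=
  LinearMap.llcomp F _ _ _ (mulX p F m)

theorem mulXHom_apply (m : Fin n) (f : W p n F →ₗ[F] W p n F) (y : W p n F) :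
    mulXHom p F m f y = coord p F m • f y := rfl

variable (p F) in
/-- `∂_i` acting on `W(n)`. -/
abbrev adD (i : Fin n) : Module.End F (W p n F) := LieModule.toEnd F (W p n F) (W p n F) (D p F i)

variable (p F) in
/-- `∂_i` acting on `Hom(W(n), W(n))`. -/
abbrev adDHom (i : Fin n) : Module.End F (W p n F →ₗ[F] W p n F) :=
  LieModule.toEnd F (W p n F) (W p n F →ₗ[F] W p n F) (D p F i)

theorem adD_mulX (m : Fin n) : adD p F m * mulX p F m = mulX p F m * adD p F m + 1 := by
  refine LinearMap.ext fun d ↦ ?_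
  simp only [Module.End.mul_apply, LinearMap.add_apply, LieModule.toEnd_apply_apply, mulX_apply,
    lie_A_smul, D_coord, if_true, one_smul, Module.End.one_apply]
  abel

theorem adD_mulX_comm {i m : Fin n} (h : i ≠ m) : Commute (adD p F i) (mulX p F m) := by
  refine LinearMap.ext fun d ↦ ?_
  simp [LieModule.toEnd_apply_apply, mulX_apply, D_coord, Ne.symm h]

theorem adDHom_mulXHom (m : Fin n) :
    adDHom p F m * mulXHom p F m = mulXHom p F m * adDHom p F m + 1 := by
  refine LinearMap.ext fun f ↦ LinearMap.ext fun d ↦ ?_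
  simp only [Module.End.mul_apply, LinearMap.add_apply, LieModule.toEnd_apply_apply,
    mulXHom_apply, LieHom.lie_apply, lie_A_smul, D_coord, if_true, one_smul, Module.End.one_apply,
    smul_sub]
  abel

theorem adDHom_mulXHom_comm {i m : Fin n} (h : i ≠ m) :
    Commute (adDHom p F i) (mulXHom p F m) := by
  refine LinearMap.ext fun f ↦ LinearMap.ext fun d ↦ ?_
  simp [LieModule.toEnd_apply_apply, mulXHom_apply, D_coord, Ne.symm h, smul_sub]

theorem lie_D_D (i j : Fin n) : ⁅(D p F i : W p n F), D p F j⁆ = 0 := by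
  rw [← E_zero j, lie_E_single]
  simp

theorem toEnd_D_comm {M : Type*} [AddCommGroup M] [Module F M] [LieRingModule (W p n F) M]
    [LieModule F (W p n F) M] (i j : Fin n) :
    Commute (LieModule.toEnd F (W p n F) M (D p F i)) (LieModule.toEnd F (W p n F) M (D p F j)) := by
  refine LinearMap.ext fun d ↦ ?_
  simp only [Module.End.mul_apply, LieModule.toEnd_apply_apply]
  rw [leibniz_lie, lie_D_D, zero_lie, zero_add]

variable [Fact p.Prime]

theorem adDHom_pow (i : Fin n) : (adDHom p F i : Module.End F (W p n F →ₗ[F] W p n F)) ^ p = 0 :=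
  toEnd_hom_pow_eq_zero (ad_D_pow i) (ad_D_pow i)

theorem eq_zero_of_lie_D {d : W p n F} (h : ∀ i, ⁅(D p F i : W p n F), d⁆ = 0) (h0 : ev d = 0) :
    d = 0 := by
  refine eq_zero_of_stable (Submodule.span F {d}) ?_ ?_ (Submodule.mem_span_singleton_self d)
  · intro i e he
    obtain ⟨c, rfl⟩ := Submodule.mem_span_singleton.1 he
    rw [lie_smul, h, smul_zero]
    exact zero_mem _
  · intro e he
    obtain ⟨c, rfl⟩ := Submodule.mem_span_singleton.1 he
    rw [map_smul, h0, smul_zero]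

theorem ev_A_smul (f : A p n F) (d : W p n F) : ev (f • d) = aug p F f • ev d := by
  ext k
  simp [ev_apply]

variable (p F) in
/-- Integration with respect to `x_m` on `W(n)`. -/
def int (m : Fin n) : Module.End F (W p n F) := integ p (mulX p F m) (adD p F m)

variable (p F) in
/-- Integration with respect to `x_m` on `Hom(W(n), W(n))`. -/
def intHom (m : Fin n) : Module.End F (W p n F →ₗ[F] W p n F) :=
  integ p (mulXHom p F m) (adDHom p F m)

theorem adD_int {m : Fin n} {d : W p n F} (h : (adD p F m ^ (p - 1)) d = 0) :
    adD p F m (int p F m d) = d := by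
  rw [int]
  exact weyl_integ (X := mulX p F m) (d := adD p F m) (adD_mulX m) h

theorem adD_int_of_ne {i m : Fin n} (h : i ≠ m) (d : W p n F) :
    adD p F i (int p F m d) = int p F m (adD p F i d) := by
  have := weyl_integ_comm (p := p) (c := adD p F i) (X := mulX p F m) (d := adD p F m)
    (adD_mulX_comm h) (toEnd_D_comm i m)
  rw [int, ← Module.End.mul_apply, this.eq, Module.End.mul_apply]

theorem adDHom_intHom {m : Fin n} {f : W p n F →ₗ[F] W p n F}
    (h : (adDHom p F m ^ (p - 1)) f = 0) : adDHom p F m (intHom p F m f) = f := by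
  rw [intHom]
  exact weyl_integ (X := mulXHom p F m) (d := adDHom p F m) (adDHom_mulXHom m) h

theorem adDHom_intHom_of_ne {i m : Fin n} (h : i ≠ m) (f : W p n F →ₗ[F] W p n F) :
    adDHom p F i (intHom p F m f) = intHom p F m (adDHom p F i f) := by
  have := weyl_integ_comm (p := p) (c := adDHom p F i) (X := mulXHom p F m) (d := adDHom p F m)
    (adDHom_mulXHom_comm h) (toEnd_D_comm i m)
  rw [intHom, ← Module.End.mul_apply, this.eq, Module.End.mul_apply]

theorem adDHom_comm (i j : Fin n) (f : W p n F →ₗ[F] W p n F) :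
    adDHom p F i (adDHom p F j f) = adDHom p F j (adDHom p F i f) := by
  have : Commute (adDHom p F i) (adDHom p F j) := toEnd_D_comm i j
  rw [← Module.End.mul_apply, this.eq, Module.End.mul_apply]

theorem adDHom_pow_sub_one (i : Fin n) (f : W p n F →ₗ[F] W p n F) :
    (adDHom p F i ^ (p - 1)) (adDHom p F i f) = 0 := by
  have : (adDHom p F i ^ (p - 1) * adDHom p F i : Module.End F (W p n F →ₗ[F] W p n F)) = 0 := by
    rw [← pow_succ, Nat.sub_add_cancel (Fact.out : p.Prime).one_le, adDHom_pow]
  exact LinearMap.congr_fun this f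

theorem ev_intHom (m : Fin n) (f : W p n F →ₗ[F] W p n F) (y : W p n F) :
    ev (intHom p F m f y) = 0 := by
  rw [intHom, integ]
  simp only [LinearMap.sum_apply, map_sum]
  refine Finset.sum_eq_zero fun k _ ↦ ?_
  rw [LinearMap.smul_apply, LinearMap.smul_apply, map_smul, pow_succ', mul_assoc,
    Module.End.mul_apply, mulXHom_apply, ev_A_smul, aug_coord, zero_smul, smul_zero]

theorem adDHom_apply (i : Fin n) (f : W p n F →ₗ[F] W p n F) (y : W p n F) :
    adDHom p F i f y = ⁅(D p F i : W p n F), f y⁆ - f ⁅(D p F i : W p n F), y⁆ := rfl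

/-- A linear map `W(n) → F^n` killing the `∂_i` is the value at the origin of a
`∂`-equivariant map. -/
theorem exists_equivariant_lift (η : W p n F →ₗ[F] (Fin n → F)) (hη : ∀ i, η (D p F i) = 0) :
    ∃ ψ : W p n F →ₗ[F] W p n F, (∀ i y, ⁅(D p F i : W p n F), ψ y⁆ = ψ ⁅D p F i, y⁆) ∧
      (∀ y, ev (ψ y) = η y) ∧ ∀ i, ψ (D p F i) = 0 := by
  have step : ∀ m ≤ n, ∃ ψ : W p n F →ₗ[F] W p n F,
      (∀ i : Fin n, (i : ℕ) < m → adDHom p F i ψ = 0) ∧ ∀ y, ev (ψ y) = η y := by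
    intro m
    induction m with
    | zero =>
      intro _
      exact ⟨const p F ∘ₗ η, fun i hi ↦ absurd hi (by omega), fun y ↦ ev_const _⟩
    | succ m ih =>
      intro hm
      obtain ⟨ψ, h1, h2⟩ := ih (by omega)
      obtain ⟨k, hk⟩ : ∃ k : Fin n, (k : ℕ) = m := ⟨⟨m, hm⟩, rfl⟩
      -- Integrals in $x_k$ vanish at the origin, so the prescribed value is kept. Integration in
      -- $x_k$ commutes with $\partial_i$ for $i\ne k$, so the earlier equivariances survive. The
      -- integral exists because $\partial_k^p=0$ puts $\partial_k\cdot\psi$ in the kernel of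
      -- $\partial_k^{p-1}$.
      refine ⟨ψ - intHom p F k (adDHom p F k ψ), ?_, ?_⟩
      · intro i hi
        rw [map_sub]
        by_cases hik : i = k
        · rw [hik, adDHom_intHom (adDHom_pow_sub_one k ψ), sub_self]
        · have hlt : (i : ℕ) < m := by
            have : (i : ℕ) ≠ k := fun h ↦ hik (Fin.ext h)
            omega
          rw [adDHom_intHom_of_ne hik, adDHom_comm, h1 i hlt, map_zero, map_zero, sub_zero]
      · intro y
        rw [LinearMap.sub_apply, map_sub, ev_intHom, sub_zero, h2]
  obtain ⟨ψ, h1, h2⟩ := step n le_rfl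
  have h3 : ∀ i y, ⁅(D p F i : W p n F), ψ y⁆ = ψ ⁅D p F i, y⁆ := by
    intro i y
    have := LinearMap.congr_fun (h1 i i.2) y
    rwa [adDHom_apply, LinearMap.zero_apply, sub_eq_zero] at this
  refine ⟨ψ, h3, h2, fun i ↦ eq_zero_of_lie_D (fun t ↦ ?_) (by rw [h2, hη])⟩
  rw [h3, lie_D_D, map_zero]

end Operators

/-! ### The fields $x_i\partial_i$ and $x_i^2\partial_i$. -/

section Special

variable {p n : ℕ} {F : Type*} [Field F] [CharP F p]

variable (p F) in
/-- The semisimple vector field `x_i ∂_i`. -/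
def euler (i : Fin n) : W p n F := E (Pi.single i 1) i

variable (p F) in
/-- The vector field `x_i² ∂_i`. -/
def quad (i : Fin n) : W p n F := E (Pi.single i 2) i

theorem lie_euler (i : Fin n) (a : Fin n → ℕ) (j : Fin n) :
    ⁅euler p F i, (E a j : W p n F)⁆ = ((a i : F) - if i = j then 1 else 0) • E a j := by
  rw [euler, lie_E, sub_smul]
  congr 1
  · by_cases h : a i = 0
    · simp [h]
    · congr 2
      funext t
      simp only [Pi.add_apply, Pi.sub_apply, Pi.single_apply]
      split_ifs <;> omega
  · by_cases h : i = j
    · subst h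
      simp
    · simp [h, Ne.symm h]

theorem lie_quad (i : Fin n) (a : Fin n → ℕ) (j : Fin n) :
    ⁅quad p F i, (E a j : W p n F)⁆ =
      ((a i : F) - if i = j then 2 else 0) • E (a + Pi.single i 1) j := by
  rw [quad, lie_E, sub_smul]
  congr 1
  · by_cases h : a i = 0
    · simp [h]
    · congr 2
      funext t
      simp only [Pi.add_apply, Pi.sub_apply, Pi.single_apply]
      split_ifs <;> omega
  · by_cases h : i = j
    · subst h
      simp only [Pi.single_eq_same, if_true, Nat.cast_ofNat]
      congr 2
      funext t
      simp only [Pi.add_apply, Pi.sub_apply, Pi.single_apply]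
      split_ifs <;> omega
    · simp [h, Ne.symm h]

variable [Fact p.Prime]

theorem ev_euler (i : Fin n) : ev (euler p F i) = 0 :=
  ev_E_of_ne (fun h ↦ by simpa using congrFun h i) i

theorem ev_quad (i : Fin n) : ev (quad p F i) = 0 :=
  ev_E_of_ne (fun h ↦ by simpa using congrFun h i) i

theorem act_euler (i : Fin n) (v : Fin n → F) (k : Fin n) :
    act (euler p F i) v k = if k = i then -v i else 0 := by
  rw [euler, act_E_single]
  simp [Pi.single_apply]

theorem act_quad (i : Fin n) (v : Fin n → F) : act (quad p F i) v = 0 := by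
  refine act_E_of_two_le ?_ i v
  rw [Finset.sum_pi_single' i 2 Finset.univ]
  simp

theorem natCast_ne_zero {k : ℕ} (h0 : k ≠ 0) (h : k < p) : (k : F) ≠ 0 := by
  rw [Ne, CharP.cast_eq_zero_iff F p]
  exact Nat.not_dvd_of_pos_of_lt (Nat.pos_of_ne_zero h0) h

theorem two_ne_zero' (hp : p ≠ 2) : (2 : F) ≠ 0 := by
  have := (Fact.out : p.Prime).two_le
  simpa using natCast_ne_zero (p := p) (F := F) (k := 2) (by norm_num) (by omega)

theorem three_le (hp : p ≠ 2) : 3 ≤ p := by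
  have := (Fact.out : p.Prime).two_le
  omega

end Special

/-! ### Derivations of `W(n)` are inner. -/

section Inner

variable {p n : ℕ} {F : Type*} [Field F] [CharP F p] [Fact p.Prime]

/-- The centre of `W(n)` is trivial. -/
theorem eq_zero_of_central {z : W p n F} (hz : ∀ y : W p n F, ⁅z, y⁆ = 0) : z = 0 := by
  refine eq_zero_of_lie_D (fun i ↦ by rw [← lie_skew, hz, neg_zero]) ?_
  ext k
  have : ev ⁅euler p F k, z⁆ k = 0 := by
    rw [← lie_skew, hz]
    simp
  rw [ev_lie (ev_euler k), act_euler, if_pos rfl, neg_eq_zero] at this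
  exact this

theorem adDHom_pow_toEnd (i : Fin n) (k : ℕ) (v : W p n F) :
    (adDHom p F i ^ k) (LieModule.toEnd F (W p n F) (W p n F) v) =
      LieModule.toEnd F (W p n F) (W p n F) ((adD p F i ^ k) v) := by
  induction k with
  | zero => rfl
  | succ k ih =>
    rw [pow_succ', Module.End.mul_apply, ih, pow_succ', Module.End.mul_apply]
    refine LinearMap.ext fun y ↦ ?_
    rw [adDHom_apply]
    simp only [LieModule.toEnd_apply_apply]
    rw [lie_lie]

/-- One coordinate at a time, the correction is an integral in $x_k$ of the error
$v=\delta'(\partial_k)$. It exists because $\mathrm{ad}\,v=-\partial_k\cdot\delta'$ and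
$\partial_k^p=0$, so $\partial_k^{p-1}v$ is central, hence zero. As `v` is killed by the earlier
$\partial_i$, so is its integral. -/
theorem exists_lie_eq_on_D {δ : W p n F →ₗ[F] W p n F}
    (hδ : ∀ x y, δ ⁅x, y⁆ = ⁅δ x, y⁆ + ⁅x, δ y⁆) :
    ∃ z : W p n F, ∀ i : Fin n, δ (D p F i) = ⁅z, D p F i⁆ := by
  have step : ∀ m ≤ n, ∃ z : W p n F, ∀ i : Fin n, (i : ℕ) < m → δ (D p F i) = ⁅z, D p F i⁆ := by
    intro m
    induction m with
    | zero => exact fun _ ↦ ⟨0, fun i hi ↦ absurd hi (by omega)⟩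
    | succ m ih =>
      intro hm
      obtain ⟨z, hz⟩ := ih (by omega)
      obtain ⟨k, hk⟩ : ∃ k : Fin n, (k : ℕ) = m := ⟨⟨m, hm⟩, rfl⟩
      let δ' : W p n F →ₗ[F] W p n F := δ - LieModule.toEnd F (W p n F) (W p n F) z
      have hδa : ∀ x, δ' x = δ x - ⁅z, x⁆ := fun x ↦ rfl
      have hδ' : ∀ x y, δ' ⁅x, y⁆ = ⁅δ' x, y⁆ + ⁅x, δ' y⁆ := by
        intro x y
        rw [hδa, hδa, hδa, hδ, leibniz_lie z x y]
        simp only [lie_sub, sub_lie]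
        abel
      have h0 : ∀ i : Fin n, (i : ℕ) < m → δ' (D p F i) = 0 := by
        intro i hi
        rw [hδa, hz i hi, sub_self]
      set v := δ' (D p F k) with hv
      have hv1 : adDHom p F k δ' = - LieModule.toEnd F (W p n F) (W p n F) v := by
        refine LinearMap.ext fun y ↦ ?_
        rw [adDHom_apply, hδ', LinearMap.neg_apply, LieModule.toEnd_apply_apply]
        abel
      have hv2 : (adD p F k ^ (p - 1)) v = 0 := by
        apply eq_zero_of_central
        intro y
        have h1 := adDHom_pow_sub_one k δ'
        rw [hv1, map_neg, adDHom_pow_toEnd, neg_eq_zero] at h1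
        exact LinearMap.congr_fun h1 y
      have hv3 : ∀ i : Fin n, (i : ℕ) < m → adD p F i v = 0 := by
        intro i hi
        have := hδ' (D p F i) (D p F k)
        rw [lie_D_D, map_zero, h0 i hi, zero_lie, zero_add] at this
        exact this.symm
      refine ⟨z - int p F k v, fun i hi ↦ ?_⟩
      rw [sub_lie, ← lie_skew (int p F k v), sub_neg_eq_add]
      by_cases hik : i = k
      · have := adD_int hv2
        rw [LieModule.toEnd_apply_apply] at this
        rw [hik, this, hv, hδa]
        abel
      · have hlt : (i : ℕ) < m := by
          have : (i : ℕ) ≠ k := fun h ↦ hik (Fin.ext h)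
          omega
        have := adD_int_of_ne hik v
        rw [hv3 i hlt, map_zero, LieModule.toEnd_apply_apply] at this
        rw [this, add_zero, hz i hlt]
  obtain ⟨z, hz⟩ := step n le_rfl
  exact ⟨z, fun i ↦ hz i i.2⟩

/-- Exponents `a < p` congruent to `ε_j - ε_k` modulo `p`, with `a ≠ 0`. -/
theorem exponent_eq {a : Fin n → ℕ} {j k : Fin n} (hap : ∀ i, a i < p) (ha : a ≠ 0)
    (h : ∀ i, (a i : F) - (if i = j then 1 else 0) + (if i = k then 1 else 0) = 0) :
    j ≠ k ∧ a = Pi.single k (p - 1) + Pi.single j 1 := by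
  have hp := (Fact.out : p.Prime).two_le
  have key : ∀ m : ℕ, (m : F) = 0 → m < p → m = 0 := by
    intro m hm hlt
    by_contra h0
    exact natCast_ne_zero h0 hlt hm
  have key1 : ∀ m : ℕ, (m : F) = 1 → m < p → m = 1 := by
    intro m hm hlt
    have : (m : F) = (1 : ℕ) := by simpa using hm
    rw [CharP.natCast_eq_natCast F p] at this
    exact Nat.ModEq.eq_of_lt_of_lt this hlt (by omega)
  have hjk : j ≠ k := by
    rintro rfl
    apply ha
    funext i
    have := h i
    rw [sub_add_cancel] at this
    exact key _ this (hap i)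
  refine ⟨hjk, ?_⟩
  funext i
  have hi := h i
  simp only [Pi.add_apply, Pi.single_apply]
  by_cases h1 : i = j
  · have h2 : i ≠ k := fun h ↦ hjk (h1.symm.trans h)
    rw [if_pos h1, if_neg h2, add_zero, sub_eq_zero] at hi
    rw [if_neg h2, if_pos h1, zero_add]
    exact key1 _ hi (hap i)
  · by_cases h2 : i = k
    · rw [if_neg h1, if_pos h2, sub_zero] at hi
      rw [if_pos h2, if_neg h1, add_zero]
      have : ((a i + 1 : ℕ) : F) = 0 := by push_cast; exact hi
      rw [CharP.cast_eq_zero_iff F p] at this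
      have := Nat.le_of_dvd (by omega) this
      have := hap i
      omega
    · rw [if_neg h1, if_neg h2, sub_zero, add_zero] at hi
      rw [if_neg h2, if_neg h1]
      exact key _ hi (hap i)

/-- The field `x_k^(p-1) x_j ∂_j` is a multiple of a bracket with `x_k² ∂_k`. -/
theorem quad_lie_top {j k : Fin n} (hjk : j ≠ k) :
    ⁅quad p F k, (E (Pi.single k (p - 2) + Pi.single j 1) j : W p n F)⁆ =
      (-2 : F) • E (Pi.single k (p - 1) + Pi.single j 1) j := by
  have hp := (Fact.out : p.Prime).two_le
  rw [lie_quad]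
  congr 1
  · simp [Ne.symm hjk, Nat.cast_sub hp]
  · congr 1
    funext t
    simp only [Pi.add_apply, Pi.single_apply]
    split_ifs <;> omega

/-- A 1-cocycle of the isotropy subalgebra with values in the tangent space that vanishes on the
diagonal torus is zero. -/
theorem oneCocycle_eq_zero (hp2 : p ≠ 2) {θ : W p n F →ₗ[F] (Fin n → F)}
    (hD : ∀ i, θ (D p F i) = 0) (heuler : ∀ i, θ (euler p F i) = 0)
    (hcoc : ∀ x y, ev x = 0 → ev y = 0 → θ ⁅x, y⁆ = act x (θ y) - act y (θ x)) : θ = 0 := by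
  have hp3 := three_le hp2
  apply hom_ext_E
  intro a j hap
  rw [LinearMap.zero_apply]
  by_cases ha : a = 0
  · rw [ha, E_zero, hD]
  ext k
  by_contra hne
  -- The cocycle identity against the torus, where $\theta$ vanishes, makes $\theta$
  -- torus-invariant, so nonzero coefficients have weight zero modulo `p`.
  have hwt : ∀ i, (a i : F) - (if i = j then 1 else 0) + (if i = k then 1 else 0) = 0 := by
    intro i
    have h1 := hcoc (euler p F i) (E a j) (ev_euler i) (ev_E_of_ne ha j)
    rw [heuler, map_zero, sub_zero, lie_euler, map_smul] at h1
    have h2 := congrFun h1 k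
    rw [act_euler, Pi.smul_apply, smul_eq_mul] at h2
    by_cases hik : i = k
    · rw [if_pos hik.symm, hik] at h2
      rw [if_pos hik, hik]
      refine (mul_eq_zero.1 (?_ : _ * θ (E a j) k = 0)).resolve_right hne
      linear_combination h2
    · rw [if_neg (Ne.symm hik)] at h2
      rw [if_neg hik, add_zero]
      exact (mul_eq_zero.1 h2).resolve_right hne
  -- Only $x_k^{p-1}x_j\partial_j$ is left. Up to $-2$ it is a bracket of two fields vanishing to
  -- second order, both of which act trivially on the tangent space.
  obtain ⟨hjk, rfl⟩ := exponent_eq hap ha hwt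
  apply hne
  have h1 := hcoc (quad p F k) (E (Pi.single k (p - 2) + Pi.single j 1) j) (ev_quad k)
    (ev_E_of_ne (fun h ↦ by simpa [hjk] using congrFun h j) j)
  rw [act_quad, act_E_of_two_le, sub_zero, quad_lie_top hjk, map_smul] at h1
  · rw [(smul_eq_zero.1 h1).resolve_left (neg_ne_zero.2 (two_ne_zero' hp2))]
  · simp only [Pi.add_apply, Finset.sum_add_distrib]
    rw [Finset.sum_pi_single' k _ Finset.univ, Finset.sum_pi_single' j _ Finset.univ]
    simp
    omega

set_option maxHeartbeats 1000000 in
/-- Every derivation of `W(n)` is inner. -/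
theorem exists_eq_lie (hp2 : p ≠ 2) {δ : W p n F →ₗ[F] W p n F}
    (hδ : ∀ x y, δ ⁅x, y⁆ = ⁅δ x, y⁆ + ⁅x, δ y⁆) : ∃ z : W p n F, ∀ y, δ y = ⁅z, y⁆ := by
  have hp3 := three_le hp2
  obtain ⟨z, hz⟩ := exists_lie_eq_on_D hδ
  have hcoc : ∀ u : W p n F, ∀ x y, ev x = 0 → ev y = 0 → ev (δ ⁅x, y⁆ - ⁅u, ⁅x, y⁆⁆) =
      act x (ev (δ y - ⁅u, y⁆)) - act y (ev (δ x - ⁅u, x⁆)) := by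
    intro u x y hx hy
    rw [← ev_lie hx, ← ev_lie hy, ← map_sub, hδ, leibniz_lie u x y]
    congr 1
    rw [← lie_skew (δ x) y, ← lie_skew ⁅u, x⁆ y]
    simp only [lie_sub]
    abel
  -- On the torus the error has only diagonal entries, since commuting Euler fields force the
  -- off-diagonal ones to vanish. The diagonal ones are exactly what bracketing with a constant
  -- field produces.
  let v : Fin n → F := fun i ↦ ev (δ (euler p F i) - ⁅z, euler p F i⁆) i
  have hoff : ∀ i k, k ≠ i → ev (δ (euler p F i) - ⁅z, euler p F i⁆) k = 0 := by
    intro i k hki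
    have h1 := hcoc z (euler p F k) (euler p F i) (ev_euler k) (ev_euler i)
    have h2 : ⁅euler p F k, euler p F i⁆ = 0 := by
      conv_lhs => rw [euler.eq_1 p F i, lie_euler]
      simp [hki]
    rw [h2, map_zero, lie_zero, sub_zero, map_zero] at h1
    have h3 := congrFun h1 k
    rw [Pi.sub_apply, act_euler, act_euler, if_pos rfl, if_neg hki, sub_zero, Pi.zero_apply,
      eq_comm, neg_eq_zero] at h3
    exact h3
  set w : W p n F := z + const p F v with hw
  have hconst : ∀ y, ev y = 0 → ev ⁅const p F v, y⁆ = - act y v := by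
    intro y hy
    rw [← lie_skew, map_neg, ev_lie hy, ev_const]
  have hwD : ∀ i, δ (D p F i) - ⁅w, D p F i⁆ = 0 := by
    intro i
    rw [hw, add_lie, hz, const_apply, sum_lie, Finset.sum_eq_zero, add_zero, sub_self]
    intro t _
    rw [smul_lie, lie_D_D, smul_zero]
  have hweuler : ∀ i, ev (δ (euler p F i) - ⁅w, euler p F i⁆) = 0 := by
    intro i
    ext k
    rw [hw, add_lie, ← sub_sub, map_sub, hconst _ (ev_euler i), sub_neg_eq_add, Pi.add_apply,
      act_euler, Pi.zero_apply]
    split_ifs with h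
    · rw [h]
      exact add_neg_cancel _
    · rw [hoff i k h, add_zero]
  have hzero : ∀ y, ev (δ y - ⁅w, y⁆) = 0 := by
    have := oneCocycle_eq_zero hp2
      (θ := ev ∘ₗ (δ - LieModule.toEnd F (W p n F) (W p n F) w))
      (fun i ↦ by
        simp only [LinearMap.comp_apply, LinearMap.sub_apply, LieModule.toEnd_apply_apply]
        rw [hwD, map_zero])
      hweuler (hcoc w)
    intro y
    exact LinearMap.congr_fun this y
  refine ⟨w, fun y ↦ sub_eq_zero.1 ?_⟩
  refine eq_zero_of_stable
    (LinearMap.range (δ - LieModule.toEnd F (W p n F) (W p n F) w)) ?_ ?_ ⟨y, rfl⟩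
  · rintro i _ ⟨y, rfl⟩
    refine ⟨⁅D p F i, y⁆, ?_⟩
    simp only [LinearMap.sub_apply, LieModule.toEnd_apply_apply]
    rw [hδ, leibniz_lie w, sub_eq_zero.1 (hwD i), lie_sub]
    abel
  · rintro _ ⟨y, rfl⟩
    exact hzero y

end Inner

/-! ### Two-cocycles of an abstract Lie algebra. -/

section Abstract

variable {p : ℕ} [Fact p.Prime] {F L : Type*} [Field F] [CharP F p] [LieRing L] [LieAlgebra F L]

/-- If `Φ` is a 2-cocycle and `(ad d)^p = 0`, then `(ad d)^(p-1) Φ(d, ·)` is a derivation. -/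
theorem toEnd_pow_isDerivation (Φ : L →ₗ[F] L →ₗ[F] L) (halt : ∀ x y, Φ x y = - Φ y x)
    (hcoc : ∀ x y z, ⁅x, Φ y z⁆ - ⁅y, Φ x z⁆ + ⁅z, Φ x y⁆ - Φ ⁅x, y⁆ z + Φ ⁅x, z⁆ y
      - Φ ⁅y, z⁆ x = 0) {d : L} (hd : LieModule.toEnd F L L d ^ p = 0) (x y : L) :
    (LieModule.toEnd F L (L →ₗ[F] L) d ^ (p - 1)) (Φ d) ⁅x, y⁆ =
      ⁅(LieModule.toEnd F L (L →ₗ[F] L) d ^ (p - 1)) (Φ d) x, y⁆ +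
        ⁅x, (LieModule.toEnd F L (L →ₗ[F] L) d ^ (p - 1)) (Φ d) y⁆ := by
  set S := LieModule.toEnd F L (L →ₗ[F] L) d with hS
  set T := LieModule.toEnd F L (L →ₗ[F] L →ₗ[F] L) d with hTdef
  have hT : T ^ p = 0 := toEnd_hom_pow_eq_zero hd (toEnd_hom_pow_eq_zero hd hd)
  have hT2 : ∀ (G : L →ₗ[F] L →ₗ[F] L) (y z : L),
      T G y z = ⁅d, G y z⁆ - G y ⁅d, z⁆ - G ⁅d, y⁆ z := by
    intro G y z
    rw [hTdef, LieModule.toEnd_apply_apply, LieHom.lie_apply, LinearMap.sub_apply,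
      LieHom.lie_apply]
  have hS2 : ∀ (f : L →ₗ[F] L) (y : L), S f y = ⁅d, f y⁆ - f ⁅d, y⁆ := fun f y ↦ rfl
  -- For `k = 0` this is the cocycle identity: the failure of $\Phi(d,\cdot)$ to be a derivation is
  -- $-(d\cdot\Phi)$. Acting by `d` commutes with forming that defect, so after `p - 1` further
  -- steps it becomes $-(d^p\cdot\Phi)=0$.
  have key : ∀ k, ∀ x y, ((S ^ k) (Φ d) ⁅x, y⁆ - ⁅(S ^ k) (Φ d) x, y⁆ - ⁅x, (S ^ k) (Φ d) y⁆) =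
      - (T ^ (k + 1)) Φ x y := by
    intro k
    induction k with
    | zero =>
      intro x y
      have h := hcoc d x y
      rw [zero_add, pow_one, hT2, pow_zero, Module.End.one_apply, ← lie_skew (Φ d x) y]
      rw [halt ⁅d, y⁆ x, halt ⁅x, y⁆] at h
      rw [← sub_eq_zero, ← h]
      abel
    | succ k ih =>
      intro x y
      rw [pow_succ' S k, pow_succ' T (k + 1), Module.End.mul_apply, Module.End.mul_apply]
      generalize (S ^ k) (Φ d) = f at ih ⊢
      generalize (T ^ (k + 1)) Φ = G at ih ⊢
      have ih' : ∀ x y, G x y = - (f ⁅x, y⁆ - ⁅f x, y⁆ - ⁅x, f y⁆) := fun x y ↦ by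
        rw [ih, neg_neg]
      rw [hT2, ih', ih', ih']
      simp only [hS2, lie_neg, lie_sub, sub_lie]
      rw [leibniz_lie d x y, leibniz_lie d (f x) y, leibniz_lie d x (f y), map_add]
      abel
  have h := key (p - 1) x y
  rw [Nat.sub_add_cancel (Fact.out : p.Prime).one_le, hT, LinearMap.zero_apply,
    LinearMap.zero_apply, LinearMap.zero_apply, neg_zero, sub_sub, sub_eq_zero] at h
  exact h

/-- The Chevalley–Eilenberg differential of a linear endomorphism, as a bare expression. -/
def dOne (ψ : L →ₗ[F] L) (x y : L) : L := ⁅x, ψ y⁆ - ⁅y, ψ x⁆ - ψ ⁅x, y⁆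

theorem dOne_add (ψ χ : L →ₗ[F] L) (x y : L) : dOne (ψ + χ) x y = dOne ψ x y + dOne χ x y := by
  simp only [dOne, LinearMap.add_apply, lie_add]
  abel

theorem cocycle_identity (φ : twoCocycle F L L) (x y z : L) :
    ⁅x, φ.1 y z⁆ - ⁅y, φ.1 x z⁆ + ⁅z, φ.1 x y⁆ - φ.1 ⁅x, y⁆ z + φ.1 ⁅x, z⁆ y - φ.1 ⁅y, z⁆ x = 0 :=
  LinearMap.congr_fun (LinearMap.congr_fun (LinearMap.congr_fun
    ((mem_twoCocycle_iff F _ _ _).1 φ.2) x) y) z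

variable (F L) in
/-- The coboundary of a 1-cochain, as a 2-cocycle. -/
def coboundary : (L →ₗ[F] L) →ₗ[F] twoCocycle F L L :=
  (d₁₂ F L L).codRestrict _ fun ψ ↦ (mem_twoCocycle_iff F _ _ _).2
    (LinearMap.congr_fun (d₂₃_comp_d₁₂ F L L) ψ)

theorem coboundary_apply (ψ : L →ₗ[F] L) (x y : L) : (coboundary F L ψ).1 x y = dOne ψ x y := rfl

theorem coboundary_mem (ψ : L →ₗ[F] L) : coboundary F L ψ ∈ twoCoboundary F L L := ⟨ψ, rfl⟩

end Abstract

/-! ### Making a cocycle vanish on the constant fields. -/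

section Normalise

variable {p n : ℕ} {F : Type*} [Field F] [CharP F p] [Fact p.Prime]

/-- Normalising along $\partial_i$ thus means solving a first-order equation for `ψ`, with an inner
term that accounts for its value on $\partial_i$. -/
theorem dOne_D (ψ : W p n F →ₗ[F] W p n F) (i : Fin n) (y : W p n F) :
    dOne ψ (D p F i) y = adDHom p F i ψ y + ⁅ψ (D p F i), y⁆ := by
  rw [dOne, adDHom_apply, ← lie_skew y]
  abel

theorem adDHom_pow_apply_D (m i : Fin n) (f : W p n F →ₗ[F] W p n F) (k : ℕ) :
    (adDHom p F m ^ k) f (D p F i) = (adD p F m ^ k) (f (D p F i)) := by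
  induction k generalizing f with
  | zero => rfl
  | succ k ih =>
    rw [pow_succ, Module.End.mul_apply, ih, pow_succ, Module.End.mul_apply, adDHom_apply,
      lie_D_D, map_zero, sub_zero]
    rfl

theorem intHom_apply_D {m i : Fin n} {f : W p n F →ₗ[F] W p n F} (h : f (D p F i) = 0) :
    intHom p F m f (D p F i) = 0 := by
  have hX : ∀ k (g : W p n F →ₗ[F] W p n F), g (D p F i) = 0 →
      (mulXHom p F m ^ k) g (D p F i) = 0 := by
    intro k
    induction k with
    | zero => exact fun g hg ↦ hg
    | succ k ih =>
      intro g hg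
      rw [pow_succ, Module.End.mul_apply]
      exact ih _ (by rw [mulXHom_apply, hg, smul_zero])
  rw [intHom, integ, LinearMap.sum_apply, LinearMap.sum_apply]
  refine Finset.sum_eq_zero fun k _ ↦ ?_
  rw [LinearMap.smul_apply, LinearMap.smul_apply, Module.End.mul_apply, hX, smul_zero]
  rw [adDHom_pow_apply_D, h, map_zero]

/-- The map `y ↦ y(x_m) u`. -/
def coordMul (m : Fin n) (u : W p n F) : W p n F →ₗ[F] W p n F where
  toFun y := y (coord p F m) • u
  map_add' _ _ := by rw [Derivation.add_apply, add_smul]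
  map_smul' _ _ := by rw [Derivation.smul_apply, smul_assoc]; rfl

theorem coordMul_apply (m : Fin n) (u y : W p n F) :
    coordMul m u y = y (coord p F m) • u := rfl

theorem adDHom_coordMul (m i : Fin n) (u : W p n F) :
    adDHom p F i (coordMul m u) = coordMul m (adD p F i u) := by
  refine LinearMap.ext fun y ↦ ?_
  rw [adDHom_apply, coordMul_apply, coordMul_apply, coordMul_apply, lie_A_smul,
    Derivation.commutator_apply, D_coord]
  have : y (if m = i then 1 else 0) = 0 := by split_ifs <;> simp
  rw [this, sub_zero, LieModule.toEnd_apply_apply]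
  abel

set_option maxHeartbeats 1000000 in
/-- One step of the normalisation of a cocycle along the constant vector fields. -/
theorem exists_normalise_step (hp2 : p ≠ 2) (Φ : W p n F →ₗ[F] W p n F →ₗ[F] W p n F)
    (halt : ∀ x y, Φ x y = - Φ y x) (hself : ∀ x, Φ x x = 0)
    (hcoc : ∀ x y z, ⁅x, Φ y z⁆ - ⁅y, Φ x z⁆ + ⁅z, Φ x y⁆ - Φ ⁅x, y⁆ z + Φ ⁅x, z⁆ y
      - Φ ⁅y, z⁆ x = 0) (m : Fin n) (hm : ∀ i < m, Φ (D p F i) = 0) :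
    ∃ ψ : W p n F →ₗ[F] W p n F, (∀ i < m, ∀ y, dOne ψ (D p F i) y = 0) ∧
      ∀ y, dOne ψ (D p F m) y = Φ (D p F m) y := by
  -- The inner derivation $\mathrm{ad}\,z$ is the obstruction to integrating
  -- $\Phi(\partial_m,\cdot)$ in $x_m$.
  obtain ⟨z, hz⟩ := exists_eq_lie hp2 (toEnd_pow_isDerivation Φ halt hcoc (ad_D_pow m))
  set f := Φ (D p F m) with hf
  have hfD : ∀ i, i ≤ m → f (D p F i) = 0 := by
    intro i hi
    rcases hi.lt_or_eq with h | rfl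
    · rw [hf, halt, hm i h, LinearMap.zero_apply, neg_zero]
    · exact hself _
  have hcomm : ∀ i < m, adDHom p F i f = 0 := by
    intro i hi
    refine LinearMap.ext fun y ↦ ?_
    have h := hcoc (D p F i) (D p F m) y
    rw [lie_D_D, map_zero, hm i hi, LinearMap.zero_apply, LinearMap.zero_apply, lie_zero, lie_zero,
      halt ⁅D p F i, y⁆, halt _ (D p F i), hm i hi, LinearMap.zero_apply] at h
    rw [adDHom_apply, LinearMap.zero_apply, ← h, ← hf]
    abel
  have hzD : ∀ i ≤ m, adD p F i z = 0 := by
    intro i hi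
    rw [LieModule.toEnd_apply_apply, ← lie_skew, ← hz, adDHom_pow_apply_D, hfD i hi, map_zero,
      neg_zero]
  -- Since $\partial_mz=0$, this is a solution of $\partial_m^{p-1}u=z$.
  let u : W p n F := ((p - 1).factorial : F)⁻¹ • (mulX p F m ^ (p - 1)) z
  have hu1 : (adD p F m ^ (p - 1)) u = z := by
    have := weyl_pow_apply (adD_mulX (p := p) (F := F) m) (hzD m le_rfl) (p - 1)
    rw [map_smul, this, smul_smul, inv_mul_cancel₀, one_smul]
    have := (Fact.out : p.Prime).pos
    exact factorial_ne_zero p (by omega)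
  have hu2 : ∀ i < m, adD p F i u = 0 := by
    intro i hi
    have hc := ((adD_mulX_comm (p := p) (F := F) (ne_of_lt hi)).pow_right (p - 1)).eq
    have := LinearMap.congr_fun hc z
    rw [Module.End.mul_apply, Module.End.mul_apply, hzD i hi.le, map_zero] at this
    rw [map_smul, this, smul_zero]
  let ψ₀ := coordMul m u
  have hψ₀ : ∀ i, ψ₀ (D p F i) = if m = i then u else 0 := by
    intro i
    rw [coordMul_apply, D_coord]
    split_ifs <;> simp
  -- After the coboundary of $\psi_0$ is removed the obstruction is gone: $\partial_m^{p-1}$ kills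
  -- $\partial_m\cdot\psi_0$ and sends $\mathrm{ad}\,u$ to $\mathrm{ad}\,z$. The remainder also
  -- kills $\partial_i$ for $i\le m$, so integrating it contributes no inner term.
  let g : W p n F →ₗ[F] W p n F :=
    f - adDHom p F m ψ₀ - LieModule.toEnd F (W p n F) (W p n F) u
  have hg : (adDHom p F m ^ (p - 1)) g = 0 := by
    rw [map_sub, map_sub, adDHom_pow_sub_one, adDHom_pow_toEnd, hu1, sub_zero, sub_eq_zero]
    exact LinearMap.ext hz
  have hgi : ∀ i < m, adDHom p F i g = 0 := by
    intro i hi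
    have h1 := adDHom_pow_toEnd i 1 u
    rw [pow_one, pow_one] at h1
    rw [map_sub, map_sub, hcomm i hi, adDHom_comm, adDHom_coordMul, h1, hu2 i hi]
    have : (coordMul m (0 : W p n F)) = 0 := by
      refine LinearMap.ext fun y ↦ ?_
      rw [coordMul_apply, smul_zero, LinearMap.zero_apply]
    rw [this, map_zero, map_zero, sub_zero, sub_zero]
  have hgD : ∀ i ≤ m, g (D p F i) = 0 := by
    intro i hi
    show f (D p F i) - adDHom p F m ψ₀ (D p F i) - ⁅u, D p F i⁆ = 0
    rw [hfD i hi, adDHom_apply, lie_D_D, map_zero, hψ₀]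
    rcases hi.lt_or_eq with h | rfl
    · have := hu2 i h
      rw [LieModule.toEnd_apply_apply] at this
      rw [if_neg (ne_of_gt h), ← lie_skew u, this]
      simp
    · rw [if_pos rfl, ← lie_skew u]
      abel
  refine ⟨ψ₀ + intHom p F m g, ?_, ?_⟩
  · intro i hi y
    rw [dOne_D, map_add, adDHom_coordMul, hu2 i hi, adDHom_intHom_of_ne (ne_of_lt hi), hgi i hi,
      LinearMap.add_apply, LinearMap.add_apply, hψ₀, if_neg (ne_of_gt hi),
      intHom_apply_D (hgD i hi.le)]
    simp [coordMul_apply]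
  · intro y
    rw [dOne_D, map_add, adDHom_intHom hg, LinearMap.add_apply, LinearMap.add_apply, hψ₀,
      if_pos rfl, intHom_apply_D (hgD m le_rfl), add_zero]
    show _ + (f y - adDHom p F m ψ₀ y - ⁅u, y⁆) + _ = _
    abel

set_option maxHeartbeats 1000000 in
/-- Every 2-cocycle is cohomologous to one that vanishes on the constant vector fields. -/
theorem exists_normalise (hp2 : p ≠ 2) (φ : twoCocycle F (W p n F) (W p n F)) :
    ∃ ψ : W p n F →ₗ[F] W p n F, ∀ i y, φ.1 (D p F i) y = dOne ψ (D p F i) y := by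
  have step : ∀ m ≤ n, ∃ ψ : W p n F →ₗ[F] W p n F, ∀ i : Fin n, (i : ℕ) < m → ∀ y,
      φ.1 (D p F i) y = dOne ψ (D p F i) y := by
    intro m
    induction m with
    | zero => exact fun _ ↦ ⟨0, fun i hi ↦ absurd hi (by omega)⟩
    | succ m ih =>
      intro hm
      obtain ⟨ψ, hψ⟩ := ih (by omega)
      obtain ⟨k, hk⟩ : ∃ k : Fin n, (k : ℕ) = m := ⟨⟨m, hm⟩, rfl⟩
      set φ' := φ - coboundary F (W p n F) ψ with hφdef
      have hφ' : ∀ x y, φ'.1 x y = φ.1 x y - dOne ψ x y := fun x y ↦ rfl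
      obtain ⟨χ, h1, h2⟩ := exists_normalise_step hp2 φ'.1.1
        (fun x y ↦ (twoCochain_skew φ'.1 y x).symm) φ'.1.2 (cocycle_identity φ') k
        (fun i hi ↦ LinearMap.ext fun y ↦ (hφ' (D p F i) y).trans (by
          rw [hψ i (by rw [← hk]; exact hi), sub_self]; rfl))
      refine ⟨ψ + χ, fun i hi y ↦ ?_⟩
      rw [dOne_add]
      rcases (show (i : ℕ) ≤ k by omega).lt_or_eq with h | h
      · rw [h1 i h, add_zero, hψ i (by omega)]
      · obtain rfl : i = k := Fin.ext h
        rw [h2]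
        show _ = _ + φ'.1 (D p F i) y
        rw [hφ']
        abel
  obtain ⟨ψ, hψ⟩ := step n le_rfl
  exact ⟨ψ, fun i ↦ hψ i i.2⟩

end Normalise

/-! ### Two-cocycles of the isotropy subalgebra, their radical and their weight components. -/

section Isotropy

variable {p n : ℕ} {F : Type*} [Field F] [CharP F p]

theorem W_induction {P : W p n F → Prop} (hE : ∀ a j, (∀ i, a i < p) → P (E a j))
    (hadd : ∀ x y, P x → P y → P (x + y)) (hsmul : ∀ (c : F) x, P x → P (c • x)) (h0 : P 0)
    (x : W p n F) : P x := by
  have hx : x ∈ Submodule.span F (Set.range (basisE p n F)) := by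
    rw [(basisE p n F).span_eq]; trivial
  induction hx using Submodule.span_induction with
  | mem x hx =>
    obtain ⟨s, rfl⟩ := hx
    rw [basisE_apply]
    exact hE _ _ fun i ↦ (s.1 i).2
  | zero => exact h0
  | add x y _ _ hx hy => exact hadd x y hx hy
  | smul c x _ hx => exact hsmul c x hx

variable [Fact p.Prime]

/-- Subtracting the constant field with the same value projects onto the isotropy subalgebra. The
projection kills the $\partial_j$ and fixes the other monomial fields. -/
theorem isotropy_induction {P : W p n F → Prop} (hE : ∀ a j, (∀ i, a i < p) → a ≠ 0 → P (E a j))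
    (hadd : ∀ x y, P x → P y → P (x + y)) (hsmul : ∀ (c : F) x, P x → P (c • x)) (h0 : P 0)
    {x : W p n F} (hx : ev x = 0) : P x := by
  have key : ∀ x : W p n F, P (x - const p F (ev x)) := by
    intro x
    induction x using W_induction with
    | hE a j ha =>
      by_cases h : a = 0
      · have : const p F (ev (E a j)) = E a j := by
          rw [h, E_zero, ev_D, const_apply]
          simp [Pi.single_apply]
        rw [this, sub_self]
        exact h0
      · rw [ev_E_of_ne h, map_zero, sub_zero]
        exact hE a j ha h
    | hadd x y hx hy =>
      have := hadd _ _ hx hy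
      rwa [sub_add_sub_comm, ← map_add, ← map_add] at this
    | hsmul c x hx =>
      have := hsmul c _ hx
      rwa [smul_sub, ← map_smul, ← map_smul] at this
    | h0 => simpa using h0
  have := key x
  rwa [hx, map_zero, sub_zero] at this

variable (p n F) in
/-- Bilinear maps on `W(n)` with values in the tangent space at the origin. -/
abbrev TangentForm : Type _ := W p n F →ₗ[F] W p n F →ₗ[F] (Fin n → F)

/-- The Chevalley–Eilenberg differential of a form on the isotropy subalgebra. -/
def dTwo (ω : TangentForm p n F) (x y z : W p n F) : Fin n → F :=
  act x (ω y z) - act y (ω x z) + act z (ω x y) - ω ⁅x, y⁆ z + ω ⁅x, z⁆ y - ω ⁅y, z⁆ x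

theorem dTwo_add_left (ω : TangentForm p n F) (x x' y z : W p n F) :
    dTwo ω (x + x') y z = dTwo ω x y z + dTwo ω x' y z := by
  simp only [dTwo, map_add, act_add, add_lie, LinearMap.add_apply]
  abel

theorem dTwo_smul_left (ω : TangentForm p n F) (c : F) (x y z : W p n F) :
    dTwo ω (c • x) y z = c • dTwo ω x y z := by
  simp only [dTwo, map_smul, act_smul, smul_lie, LinearMap.smul_apply, smul_add, smul_sub]

theorem dTwo_zero_left (ω : TangentForm p n F) (y z : W p n F) : dTwo ω 0 y z = 0 := by
  simp [dTwo, act_zero]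

theorem dTwo_swap_left {ω : TangentForm p n F} (h : ∀ x y, ω x y = - ω y x) (x y z : W p n F) :
    dTwo ω x y z = - dTwo ω y x z := by
  rw [dTwo, dTwo, h x y, ← lie_skew x y]
  simp only [map_neg, LinearMap.neg_apply]
  abel

theorem dTwo_swap_right {ω : TangentForm p n F} (h : ∀ x y, ω x y = - ω y x) (x y z : W p n F) :
    dTwo ω x y z = - dTwo ω x z y := by
  rw [dTwo, dTwo, h y z, ← lie_skew y z]
  simp only [map_neg, LinearMap.neg_apply]
  abel

/-- Alternating forms that vanish on the constant fields and restrict to a 2-cocycle of the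
isotropy subalgebra with values in the tangent space. -/
structure IsCoc (ω : TangentForm p n F) : Prop where
  self : ∀ x, ω x x = 0
  constant : ∀ i, ω (D p F i) = 0
  coc : ∀ x y z, ev x = 0 → ev y = 0 → ev z = 0 →
    act x (ω y z) - act y (ω x z) + act z (ω x y) - ω ⁅x, y⁆ z + ω ⁅x, z⁆ y - ω ⁅y, z⁆ x = 0

theorem IsCoc.skew {ω : TangentForm p n F} (h : IsCoc ω) (x y : W p n F) : ω x y = - ω y x := by
  have := h.self (x + y)
  rw [map_add ω, LinearMap.add_apply, map_add, map_add, h.self, h.self, zero_add,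
    add_zero] at this
  exact eq_neg_of_add_eq_zero_left this

theorem IsCoc.constant_right {ω : TangentForm p n F} (h : IsCoc ω) (x : W p n F) (i : Fin n) :
    ω x (D p F i) = 0 := by
  rw [h.skew, h.constant]
  simp

/-- The form is the differential of a 1-cochain of the isotropy subalgebra. -/
def IsExact (ω : TangentForm p n F) : Prop :=
  ∃ η : W p n F →ₗ[F] (Fin n → F), (∀ i, η (D p F i) = 0) ∧
    ∀ x y, ev x = 0 → ev y = 0 → ω x y = act x (η y) - act y (η x) - η ⁅x, y⁆

theorem IsExact.add {ω ω' : TangentForm p n F} (h : IsExact ω) (h' : IsExact ω') :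
    IsExact (ω + ω') := by
  obtain ⟨η, h1, h2⟩ := h
  obtain ⟨η', h1', h2'⟩ := h'
  refine ⟨η + η', fun i ↦ by rw [LinearMap.add_apply, h1, h1', add_zero], fun x y hx hy ↦ ?_⟩
  simp only [LinearMap.add_apply, h2 x y hx hy, h2' x y hx hy, map_add]
  abel

theorem isExact_zero : IsExact (0 : TangentForm p n F) :=
  ⟨0, fun _ ↦ rfl, fun x y _ _ ↦ by simp⟩

theorem isExact_sum {ι : Type*} (s : Finset ι) {ω : ι → TangentForm p n F}
    (h : ∀ i ∈ s, IsExact (ω i)) : IsExact (∑ i ∈ s, ω i) := by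
  classical
  induction s using Finset.induction_on with
  | empty => exact isExact_zero
  | insert i s hi ih =>
    rw [Finset.sum_insert hi]
    exact (h i (Finset.mem_insert_self i s)).add (ih fun j hj ↦ h j (Finset.mem_insert_of_mem hj))

/-- The elements of the isotropy subalgebra on which the form vanishes. -/
def radical (ω : TangentForm p n F) : Submodule F (W p n F) :=
  LinearMap.ker ev ⊓ LinearMap.ker ω

theorem mem_radical {ω : TangentForm p n F} {x : W p n F} :
    x ∈ radical ω ↔ ev x = 0 ∧ ω x = 0 := by
  simp [radical]

theorem mem_radical_E {ω : TangentForm p n F} (h : IsCoc ω) {a : Fin n → ℕ} (ha : a ≠ 0)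
    (j : Fin n) (h0 : ∀ b l k, (∀ i, b i < p) → b ≠ 0 → ω (E a j) (E b l) k = 0) :
    E a j ∈ radical ω := by
  refine mem_radical.2 ⟨ev_E_of_ne ha j, hom_ext_E fun b l hb ↦ ?_⟩
  by_cases hb0 : b = 0
  · rw [hb0, E_zero, h.constant_right]
    rfl
  · ext k
    exact h0 b l k hb hb0

/-- When $\omega(x,\cdot)=0$, all terms of the cocycle identity containing it drop out, and the rest
says that `x` preserves the form. -/
theorem IsCoc.invariant {ω : TangentForm p n F} (h : IsCoc ω) {x y z : W p n F}
    (hx : x ∈ radical ω) (hy : ev y = 0) (hz : ev z = 0) :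
    ω ⁅x, y⁆ z + ω y ⁅x, z⁆ = act x (ω y z) := by
  obtain ⟨h1, h2⟩ := mem_radical.1 hx
  have := h.coc x y z h1 hy hz
  rw [h2, h.skew ⁅y, z⁆, h2, h.skew ⁅x, z⁆] at this
  simp only [LinearMap.zero_apply, map_zero, neg_zero, sub_zero, add_zero] at this
  rw [eq_comm, ← sub_eq_zero, ← this]
  abel

/-- By invariance under `x`. Being a subalgebra, the radical is everything as soon as it contains
generators of the isotropy subalgebra. -/
theorem lie_mem_radical {ω : TangentForm p n F} (h : IsCoc ω) {x y : W p n F}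
    (hx : x ∈ radical ω) (hy : y ∈ radical ω) : ⁅x, y⁆ ∈ radical ω := by
  obtain ⟨h1, h2⟩ := mem_radical.1 hx
  obtain ⟨h3, h4⟩ := mem_radical.1 hy
  refine mem_radical.2 ⟨ev_lie_of_ev h1 h3, hom_ext_E fun b l hb ↦ ?_⟩
  by_cases hb0 : b = 0
  · rw [hb0, E_zero, h.constant_right]
    rfl
  · have := h.invariant hx h3 (ev_E_of_ne hb0 l)
    rw [h4] at this
    simpa using this

/-- A form with full radical vanishes. -/
theorem eq_zero_of_radical {ω : TangentForm p n F} (h : IsCoc ω)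
    (hR : ∀ a j, (∀ i, a i < p) → a ≠ 0 → E a j ∈ radical ω) : ω = 0 := by
  refine hom_ext_E fun a j ha ↦ ?_
  by_cases h0 : a = 0
  · rw [h0, E_zero, h.constant]
    rfl
  · exact (mem_radical.1 (hR a j ha h0)).2

/-- The weight of the coefficient of `∂_k` in the value of a form at `(x^a ∂_j, x^b ∂_l)`. -/
def wt (a : Fin n → ℕ) (j : Fin n) (b : Fin n → ℕ) (l k : Fin n) : Fin n → ℤ := fun t ↦
  a t + b t + (if t = k then 1 else 0) - (if t = j then 1 else 0) - (if t = l then 1 else 0)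

/-- Forms that are homogeneous of weight `lam`. -/
def Homog (ω : TangentForm p n F) (lam : Fin n → ℤ) : Prop :=
  ∀ a j b l k, ω (E a j) (E b l) k ≠ 0 → wt a j b l k = lam

/-- The homogeneous component of weight `lam` of a form. -/
def comp (lam : Fin n → ℤ) (ω : TangentForm p n F) : TangentForm p n F :=
  (basisE p n F).constr F fun s ↦ (basisE p n F).constr F fun t k ↦
    if wt (fun i ↦ (s.1 i : ℕ)) s.2 (fun i ↦ (t.1 i : ℕ)) t.2 k = lam then
      ω (basisE p n F s) (basisE p n F t) k else 0

theorem comp_E (lam : Fin n → ℤ) (ω : TangentForm p n F) (a : Fin n → ℕ) (j : Fin n)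
    (b : Fin n → ℕ) (l k : Fin n) :
    comp lam ω (E a j) (E b l) k = if wt a j b l k = lam then ω (E a j) (E b l) k else 0 := by
  by_cases ha : ∀ i, a i < p
  · by_cases hb : ∀ i, b i < p
    · have e1 : (E a j : W p n F) = basisE p n F (fun i ↦ ⟨a i, ha i⟩, j) := by rw [basisE_apply]
      have e2 : (E b l : W p n F) = basisE p n F (fun i ↦ ⟨b i, hb i⟩, l) := by rw [basisE_apply]
      rw [e1, e2, comp, Module.Basis.constr_basis, Module.Basis.constr_basis]
    · push Not at hb
      obtain ⟨i, hi⟩ := hb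
      rw [E_eq_zero hi]
      simp
  · push Not at ha
    obtain ⟨i, hi⟩ := ha
    rw [E_eq_zero hi]
    simp

theorem homog_comp (lam : Fin n → ℤ) (ω : TangentForm p n F) : Homog (comp lam ω) lam := by
  intro a j b l k h
  rw [comp_E] at h
  by_contra hne
  rw [if_neg hne] at h
  exact h rfl

theorem exists_sum_comp (ω : TangentForm p n F) :
    ∃ S : Finset (Fin n → ℤ), ω = ∑ lam ∈ S, comp lam ω := by
  classical
  refine ⟨(Finset.univ : Finset (((Fin n → Fin p) × Fin n) × ((Fin n → Fin p) × Fin n) × Fin n)).image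
    (fun u ↦ wt (fun i ↦ (u.1.1 i : ℕ)) u.1.2 (fun i ↦ (u.2.1.1 i : ℕ)) u.2.1.2 u.2.2), ?_⟩
  refine hom_ext_E fun a j ha ↦ hom_ext_E fun b l hb ↦ ?_
  ext k
  rw [LinearMap.sum_apply, LinearMap.sum_apply, Finset.sum_apply]
  simp only [comp_E]
  rw [Finset.sum_ite_eq, if_pos]
  rw [Finset.mem_image]
  exact ⟨((fun i ↦ ⟨a i, ha i⟩, j), (fun i ↦ ⟨b i, hb i⟩, l), k), Finset.mem_univ _, rfl⟩

/-- The common weight of the terms of the cocycle identity. -/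
def wt₃ (a : Fin n → ℕ) (j : Fin n) (b : Fin n → ℕ) (l : Fin n) (c : Fin n → ℕ) (m k : Fin n) :
    Fin n → ℤ := fun t ↦ a t + b t + c t + (if t = k then 1 else 0) - (if t = j then 1 else 0)
      - (if t = l then 1 else 0) - (if t = m then 1 else 0)

/-- Together with `comp_lie` this shows that all terms of the cocycle identity on monomial fields
carry the same weight `wt₃`, so taking components commutes with the differential. Weights live in
$\mathbb Z^n$, not modulo `p`; the distinction between $0$ and $p$ is essential later. -/
theorem act_comp (lam : Fin n → ℤ) (ω : TangentForm p n F) (a : Fin n → ℕ) (j : Fin n)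
    (b : Fin n → ℕ) (l : Fin n) (c : Fin n → ℕ) (m k : Fin n) :
    act (E a j) (comp lam ω (E b l) (E c m)) k =
      if wt₃ a j b l c m k = lam then act (E a j) (ω (E b l) (E c m)) k else 0 := by
  rw [act_E, act_E]
  have : ∀ i, (if a = Pi.single i 1 ∧ k = j then comp lam ω (E b l) (E c m) i else 0) =
      if wt₃ a j b l c m k = lam then
        (if a = Pi.single i 1 ∧ k = j then ω (E b l) (E c m) i else 0) else 0 := by
    intro i
    by_cases h : a = Pi.single i 1 ∧ k = j
    · have e : wt₃ a j b l c m k = wt b l c m i := by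
        funext t
        rw [h.1, h.2]
        simp only [wt₃, wt, Pi.single_apply]
        split_ifs <;> push_cast <;> ring
      rw [if_pos h, if_pos h, comp_E, e]
    · simp [h]
  rw [Finset.sum_congr rfl fun i _ ↦ this i]
  split_ifs <;> simp

theorem comp_lie (lam : Fin n → ℤ) (ω : TangentForm p n F) (a : Fin n → ℕ) (j : Fin n)
    (b : Fin n → ℕ) (l : Fin n) (c : Fin n → ℕ) (m k : Fin n) :
    comp lam ω ⁅(E a j : W p n F), (E b l : W p n F)⁆ (E c m) k =
      if wt₃ a j b l c m k = lam then ω ⁅(E a j : W p n F), (E b l : W p n F)⁆ (E c m) k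
        else 0 := by
  have e1 : b j ≠ 0 → wt (a + b - Pi.single j 1) l c m k = wt₃ a j b l c m k := by
    intro h
    funext t
    simp only [wt₃, wt, Pi.sub_apply, Pi.add_apply, Pi.single_apply]
    by_cases ht : t = j
    · subst ht
      simp only [if_true]
      have : ((a t + b t - 1 : ℕ) : ℤ) = a t + b t - 1 := by omega
      rw [this]; ring
    · simp only [ht, if_false, Nat.sub_zero]
      push_cast; ring
  have e2 : a l ≠ 0 → wt (a + b - Pi.single l 1) j c m k = wt₃ a j b l c m k := by
    intro h
    funext t
    simp only [wt₃, wt, Pi.sub_apply, Pi.add_apply, Pi.single_apply]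
    by_cases ht : t = l
    · subst ht
      simp only [if_true]
      have : ((a t + b t - 1 : ℕ) : ℤ) = a t + b t - 1 := by omega
      rw [this]; ring
    · simp only [ht, if_false, Nat.sub_zero]
      push_cast; ring
  rw [lie_E]
  simp only [map_sub, map_smul, LinearMap.sub_apply, LinearMap.smul_apply, Pi.sub_apply,
    Pi.smul_apply, comp_E]
  by_cases h1 : b j = 0
  · by_cases h2 : a l = 0
    · simp [h1, h2]
    · rw [e2 h2]
      simp only [h1, Nat.cast_zero, zero_smul]
      split_ifs <;> simp
  · rw [e1 h1]
    by_cases h2 : a l = 0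
    · simp only [h2, Nat.cast_zero, zero_smul]
      split_ifs <;> simp
    · rw [e2 h2]
      split_ifs <;> simp

/-- On monomial fields the identity for the component is either the whole identity for the form or
$0=0$. Alternation follows from skew-symmetry because `2` is invertible. -/
theorem IsCoc.comp (hp2 : p ≠ 2) {ω : TangentForm p n F} (h : IsCoc ω) (lam : Fin n → ℤ) :
    IsCoc (comp lam ω) := by
  have hskew : ∀ x y, WittJacobson.comp lam ω x y = - WittJacobson.comp lam ω y x := by
    have : WittJacobson.comp lam ω = - (WittJacobson.comp lam ω).flip := by
      refine hom_ext_E fun a j _ ↦ hom_ext_E fun b l _ ↦ ?_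
      ext k
      rw [LinearMap.neg_apply, LinearMap.neg_apply, LinearMap.flip_apply, Pi.neg_apply, comp_E,
        comp_E, h.skew, Pi.neg_apply]
      have : wt a j b l k = wt b l a j k := by
        funext t
        simp only [wt]
        ring
      rw [this]
      split_ifs <;> simp
    intro x y
    conv_lhs => rw [this]
    rfl
  constructor
  · intro x
    have := hskew x x
    rw [eq_neg_iff_add_eq_zero, ← two_smul F] at this
    exact (smul_eq_zero.1 this).resolve_left (two_ne_zero' hp2)
  · intro i
    refine hom_ext_E fun b l _ ↦ ?_
    ext k
    rw [← E_zero, comp_E, E_zero, h.constant]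
    simp
  · intro x y z hx hy hz
    refine isotropy_induction (P := fun x ↦ dTwo (WittJacobson.comp lam ω) x y z = 0)
      (fun a j _ ha ↦ ?_) (fun x₁ x₂ h₁ h₂ ↦ by rw [dTwo_add_left, h₁, h₂, add_zero])
      (fun c x h₁ ↦ by rw [dTwo_smul_left, h₁, smul_zero]) (by rw [dTwo_zero_left]) hx
    have sw := dTwo_swap_left (ω := WittJacobson.comp lam ω) hskew
    have sw' := dTwo_swap_right (ω := WittJacobson.comp lam ω) hskew
    rw [sw, neg_eq_zero]
    refine isotropy_induction
      (P := fun y ↦ dTwo (WittJacobson.comp lam ω) y (E a j) z = 0)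
      (fun b l _ hb ↦ ?_) (fun x₁ x₂ h₁ h₂ ↦ by rw [dTwo_add_left, h₁, h₂, add_zero])
      (fun c x h₁ ↦ by rw [dTwo_smul_left, h₁, smul_zero]) (by rw [dTwo_zero_left]) hy
    rw [sw', sw, neg_neg]
    refine isotropy_induction
      (P := fun z ↦ dTwo (WittJacobson.comp lam ω) z (E b l) (E a j) = 0)
      (fun c m _ hc ↦ ?_) (fun x₁ x₂ h₁ h₂ ↦ by rw [dTwo_add_left, h₁, h₂, add_zero])
      (fun c x h₁ ↦ by rw [dTwo_smul_left, h₁, smul_zero]) (by rw [dTwo_zero_left]) hz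
    have hω := h.coc _ _ _ (ev_E_of_ne hc m) (ev_E_of_ne hb l) (ev_E_of_ne ha j)
    ext k
    have hk := congrFun hω k
    have w1 : wt₃ b l c m a j k = wt₃ c m b l a j k := by funext t; simp only [wt₃]; ring
    have w2 : wt₃ a j c m b l k = wt₃ c m b l a j k := by funext t; simp only [wt₃]; ring
    have w3 : wt₃ c m a j b l k = wt₃ c m b l a j k := by funext t; simp only [wt₃]; ring
    have w4 : wt₃ b l a j c m k = wt₃ c m b l a j k := by funext t; simp only [wt₃]; ring
    rw [dTwo]
    simp only [Pi.sub_apply, Pi.add_apply, act_comp, comp_lie, w1, w2, w3, w4, Pi.zero_apply]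
      at hk ⊢
    split_ifs
    · exact hk
    · simp

end Isotropy

/-! ### Weights nonzero modulo `p`, generation of the isotropy subalgebra, and weights with two
coordinates `p`. -/

section Weights

variable {p n : ℕ} {F : Type*} [Field F] [CharP F p]

/-- The bracket of monomial fields, with the exponents given implicitly. -/
theorem lie_E_eq {a b c d : Fin n → ℕ} {j l : Fin n} (hc : b j ≠ 0 → c + Pi.single j 1 = a + b)
    (hd : a l ≠ 0 → d + Pi.single l 1 = a + b) :
    ⁅(E a j : W p n F), (E b l : W p n F)⁆ = (b j : F) • E c l - (a l : F) • E d j := by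
  rw [lie_E]
  congr 1
  · by_cases h : b j = 0
    · simp [h]
    · rw [← hc h, add_tsub_cancel_right]
  · by_cases h : a l = 0
    · simp [h]
    · rw [← hd h, add_tsub_cancel_right]

theorem sub_single_add {a : Fin n → ℕ} {s : Fin n} (h : a s ≠ 0) :
    a - Pi.single s 1 + Pi.single s 1 = a := by
  funext t
  simp only [Pi.add_apply, Pi.sub_apply, Pi.single_apply]
  split_ifs with ht
  · subst ht; omega
  · omega

theorem exists_eq_add_single {a : Fin n → ℕ} {s : Fin n} (h : a s ≠ 0) :
    ∃ a' : Fin n → ℕ, a = a' + Pi.single s 1 := ⟨_, (sub_single_add h).symm⟩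

theorem exists_ne_zero {a : Fin n → ℕ} (h : ∑ i, a i ≠ 0) : ∃ s, a s ≠ 0 := by
  by_contra! hc
  simp [hc] at h

theorem sum_add_single (a : Fin n → ℕ) (s : Fin n) (m : ℕ) :
    ∑ i, (a + Pi.single s m : Fin n → ℕ) i = ∑ i, a i + m := by
  simp only [Pi.add_apply, Finset.sum_add_distrib]
  rw [Finset.sum_pi_single' s m Finset.univ]
  simp

theorem sum_single (s : Fin n) (m : ℕ) : ∑ i, (Pi.single s m : Fin n → ℕ) i = m := by
  rw [Finset.sum_pi_single' s m Finset.univ]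
  simp

variable [Fact p.Prime]

theorem ev_E_add_single (a : Fin n → ℕ) (s j : Fin n) :
    ev (E (a + Pi.single s 1) j : W p n F) = 0 :=
  ev_E_of_ne (fun h ↦ by simpa using congrFun h s) j

theorem ev_E_single (s j : Fin n) {m : ℕ} (hm : m ≠ 0) :
    ev (E (Pi.single s m) j : W p n F) = 0 :=
  ev_E_of_ne (fun h ↦ hm (by simpa using congrFun h s)) j

theorem Homog.lie_euler_eq {ω : TangentForm p n F} {lam : Fin n → ℤ} (hH : Homog ω lam)
    (i : Fin n) (x y : W p n F) :
    act (euler p F i) (ω x y) - ω ⁅euler p F i, x⁆ y - ω x ⁅euler p F i, y⁆ =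
      -(lam i : F) • ω x y := by
  induction x using W_induction with
  | hadd x x' hx hx' =>
    simp only [map_add, lie_add, LinearMap.add_apply, smul_add, ← hx, ← hx']
    abel
  | hsmul c x hx =>
    simp only [map_smul, lie_smul, LinearMap.smul_apply, smul_comm _ c, ← hx, smul_sub]
  | h0 => simp
  | hE a j _ =>
  induction y using W_induction with
  | hadd x x' hx hx' =>
    simp only [map_add, lie_add, smul_add, ← hx, ← hx']
    abel
  | hsmul c x hx =>
    simp only [map_smul, lie_smul, smul_comm _ c, ← hx, smul_sub]
  | h0 => simp
  | hE b l _ =>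
  ext k
  rw [lie_euler, lie_euler]
  simp only [map_smul, LinearMap.smul_apply, Pi.sub_apply, Pi.smul_apply, act_euler, smul_eq_mul]
  by_cases h0 : ω (E a j) (E b l) k = 0
  · by_cases hk : k = i
    · subst hk
      simp [h0]
    · simp [h0, hk]
  · have hw := congrFun (hH a j b l k h0) i
    have hw' : (lam i : F) = a i + b i + (if i = k then 1 else 0) - (if i = j then 1 else 0)
        - (if i = l then 1 else 0) := by
      rw [← hw, wt]
      push_cast
      rfl
    rw [hw']
    by_cases hk : i = k
    · subst hk
      simp only [if_true]
      ring
    · simp only [hk, if_false, Ne.symm hk]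
      ring

/-- A homogeneous cocycle whose weight is nonzero modulo `p` is exact. -/
theorem Homog.isExact {ω : TangentForm p n F} {lam : Fin n → ℤ} (hH : Homog ω lam)
    (h : IsCoc ω) {i : Fin n} (hi : (lam i : F) ≠ 0) : IsExact ω := by
  -- Cartan's homotopy: on a cocycle, the differential of the contraction with $x_i\partial_i$ is
  -- the Lie derivative along it, which is the scalar $-\lambda_i$.
  refine ⟨-(lam i : F)⁻¹ • ω (euler p F i), fun t ↦ ?_, fun x y hx hy ↦ ?_⟩
  · rw [LinearMap.smul_apply, h.constant_right, smul_zero]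
  · have h1 := h.coc (euler p F i) x y (ev_euler i) hx hy
    have h2 := hH.lie_euler_eq i x y
    rw [h.skew ⁅euler p F i, y⁆ x, h.skew ⁅x, y⁆ (euler p F i)] at h1
    have h3 : act x (ω (euler p F i) y) - act y (ω (euler p F i) x) - ω (euler p F i) ⁅x, y⁆ =
        -(lam i : F) • ω x y := by
      rw [← h2, ← sub_eq_zero, ← neg_eq_zero, ← h1]
      abel
    simp only [LinearMap.smul_apply, map_smul]
    rw [← smul_sub, ← smul_sub, h3, smul_smul, neg_mul_neg, inv_mul_cancel₀ hi, one_smul]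

/-- The cocycle identity solved for one term. It is the means of lowering a high power of $x_k$ in
the second argument; no term with the action of $x_k^2\partial_k$ appears, since that field vanishes
to second order. -/
theorem IsCoc.lie_quad_right {ω : TangentForm p n F} (h : IsCoc ω) {u y : W p n F}
    (hu : ev u = 0) (hy : ev y = 0) (k : Fin n) :
    ω u ⁅quad p F k, y⁆ = ω ⁅u, quad p F k⁆ y + ω (quad p F k) ⁅u, y⁆
      - act u (ω (quad p F k) y) - act y (ω u (quad p F k)) := by
  have := h.coc u (quad p F k) y hu (ev_quad k) hy
  rw [act_quad, h.skew ⁅u, y⁆, h.skew ⁅quad p F k, y⁆] at this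
  rw [← sub_eq_zero, ← this]
  abel

/-- Brackets with $x_r\partial_g$ and $x_s\partial_g$ turn $x_g^2\partial_g$ into
$x_rx_s\partial_g$, up to the invertible factor `2`. A bracket with $x_g\partial_m$ then changes
$\partial_g$ into $\partial_m$. -/
theorem euler_quad_generate_quadratic {ω : TangentForm p n F} (h : IsCoc ω) (hp2 : p ≠ 2)
    {g : Fin n} (hL : ∀ i j, E (Pi.single i 1) j ∈ radical ω) (hq : quad p F g ∈ radical ω)
    (r s m : Fin n) : E (Pi.single r 1 + Pi.single s 1) m ∈ radical ω := by
  have h2 : (2 : F) ≠ 0 := two_ne_zero' hp2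
  have A1 : ∀ r, E (Pi.single r 1 + Pi.single g 1) g ∈ radical ω := by
    intro r
    by_cases hr : r = g
    · rw [hr, ← Pi.single_add]
      exact hq
    · have := lie_mem_radical h (hL r g) hq
      rw [quad, lie_E_eq (c := Pi.single r 1 + Pi.single g 1) (d := 0)
        (fun _ ↦ by rw [add_assoc, ← Pi.single_add]) (fun h ↦ by simp [Ne.symm hr] at h)] at this
      simp only [Pi.single_eq_same, Pi.single_eq_of_ne (Ne.symm hr), Nat.cast_zero, zero_smul,
        sub_zero, Nat.cast_ofNat] at this
      exact (Submodule.smul_mem_iff _ h2).1 this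
  have A2 : ∀ r s, E (Pi.single r 1 + Pi.single s 1) g ∈ radical ω := by
    intro r s
    by_cases hs : s = g
    · rw [hs]; exact A1 r
    by_cases hr : r = g
    · rw [hr, add_comm]; exact A1 s
    have := lie_mem_radical h (hL s g) (A1 r)
    rw [lie_E_eq (c := Pi.single r 1 + Pi.single s 1) (d := 0)
      (fun _ ↦ by abel) (fun h ↦ by simp [Ne.symm hs] at h)] at this
    simpa [Ne.symm hs, Ne.symm hr] using this
  by_cases hm : m = g
  · rw [hm]; exact A2 r s
  -- The bracket $[x_rx_s\partial_g,x_g\partial_m]$ has a second term when $m\in\{r,s\}$; it is a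
  -- multiple of $x_ux_g\partial_g$, already known to lie in the radical.
  have key : ∀ d : Fin n → ℕ, (∃ u : Fin n, (Pi.single r 1 + Pi.single s 1 : Fin n → ℕ) m ≠ 0 →
      d = Pi.single u 1 + Pi.single g 1 ∧
        d + Pi.single m 1 = Pi.single r 1 + Pi.single s 1 + Pi.single g 1) →
      E (Pi.single r 1 + Pi.single s 1) m ∈ radical ω := by
    rintro d ⟨u, hd⟩
    have := lie_mem_radical h (A2 r s) (hL g m)
    rw [lie_E_eq (c := Pi.single r 1 + Pi.single s 1) (d := d) (fun _ ↦ rfl)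
      (fun h ↦ (hd h).2), Pi.single_eq_same, Nat.cast_one, one_smul] at this
    by_cases h0 : (Pi.single r 1 + Pi.single s 1 : Fin n → ℕ) m = 0
    · rwa [h0, Nat.cast_zero, zero_smul, sub_zero] at this
    · rw [(hd h0).1] at this
      have h3 := Submodule.add_mem _ this (Submodule.smul_mem _
        (((Pi.single r 1 + Pi.single s 1 : Fin n → ℕ) m : ℕ) : F) (A2 u g))
      rwa [sub_add_cancel] at h3
  by_cases hr : m = r
  · exact key _ ⟨s, fun _ ↦ ⟨rfl, by rw [hr]; abel⟩⟩
  · by_cases hs : m = s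
    · exact key _ ⟨r, fun _ ↦ ⟨rfl, by rw [hs]; abel⟩⟩
    · exact key 0 ⟨r, fun h ↦ absurd (by simp [hr, hs]) h⟩

/-- For `n ≥ 2` the isotropy subalgebra is generated by the linear fields and one `x_g² ∂_g`. -/
theorem radical_eq_of_generators {ω : TangentForm p n F} (h : IsCoc ω) (hp2 : p ≠ 2)
    {g g' : Fin n} (hg : g ≠ g') (hL : ∀ i j, E (Pi.single i 1) j ∈ radical ω)
    (hq : quad p F g ∈ radical ω) : ω = 0 := by
  have h2 : (2 : F) ≠ 0 := two_ne_zero' hp2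
  have hQ := euler_quad_generate_quadratic h hp2 hL hq
  have hq' : ∀ s, quad p F s ∈ radical ω := by
    intro s
    have := hQ s s s
    rwa [← Pi.single_add] at this
  have main : ∀ (m : ℕ) (a : Fin n → ℕ), ∑ i, a i = m → a ≠ 0 → ∀ j, E a j ∈ radical ω := by
    intro m
    induction m using Nat.strong_induction_on with
    | _ m ih =>
    intro a ha ha0 j
    have hsum : ∑ i, a i ≠ 0 := fun h0 ↦ ha0 (by
      funext i
      exact (Finset.sum_eq_zero_iff.1 h0) i (Finset.mem_univ i))
    by_cases hap : ∀ i, a i < p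
    swap
    · push Not at hap
      obtain ⟨i, hi⟩ := hap
      rw [E_eq_zero hi]
      exact zero_mem _
    obtain ⟨r, hr⟩ := exists_ne_zero hsum
    by_cases hm1 : m = 1
    · obtain ⟨b, rfl⟩ := exists_eq_add_single hr
      rw [sum_add_single, hm1] at ha
      have : b = 0 := by
        funext i
        exact (Finset.sum_eq_zero_iff.1 (by omega : ∑ i, b i = 0)) i (Finset.mem_univ i)
      rw [this, zero_add]
      exact hL r j
    by_cases hm2 : m = 2
    · obtain ⟨b, rfl⟩ := exists_eq_add_single hr
      rw [sum_add_single, hm2] at ha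
      obtain ⟨s, hs⟩ := exists_ne_zero (a := b) (by omega)
      obtain ⟨c, rfl⟩ := exists_eq_add_single hs
      rw [sum_add_single] at ha
      have : c = 0 := by
        funext i
        exact (Finset.sum_eq_zero_iff.1 (by omega : ∑ i, c i = 0)) i (Finset.mem_univ i)
      rw [this, zero_add]
      exact hQ s r j
    have hlow : ∀ s b, a = b + Pi.single s 1 → ∀ j, E b j ∈ radical ω := by
      intro s b hb j
      rw [hb, sum_add_single] at ha
      refine ih (m - 1) (by omega) b (by omega) ?_ j
      rintro rfl
      simp at ha
      omega
    -- Some $x_s$ with $s\ne j$ has exponent at least 2: the bracket with $x_s^2\partial_s$ raises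
    -- that exponent with coefficient $a_s-1$, invertible.
    by_cases hC1 : ∃ s, s ≠ j ∧ 2 ≤ a s
    · obtain ⟨s, hsj, hs⟩ := hC1
      obtain ⟨b, rfl⟩ := exists_eq_add_single (a := a) (s := s) (by omega)
      have := lie_mem_radical h (hq' s) (hlow s b rfl j)
      rw [lie_quad, if_neg hsj, sub_zero] at this
      refine (Submodule.smul_mem_iff _ ?_).1 this
      have hsp := hap s
      simp only [Pi.add_apply, Pi.single_eq_same] at hs hsp
      exact natCast_ne_zero (p := p) (by omega) (by omega)
    -- The same with $x_j^2\partial_j$ gives the coefficient $a_j-3$, which is why exponent `3` is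
    -- set apart.
    by_cases hC2 : a j ≠ 0 ∧ a j ≠ 3
    · obtain ⟨b, rfl⟩ := exists_eq_add_single hC2.1
      have := lie_mem_radical h (hq' j) (hlow j b rfl j)
      rw [lie_quad, if_pos rfl] at this
      refine (Submodule.smul_mem_iff _ ?_).1 this
      have hsp := hap j
      have hC := hC2.2
      simp only [Pi.add_apply, Pi.single_eq_same] at hC hsp
      rcases Nat.lt_or_ge (b j) 2 with hlt | hge
      · interval_cases hbj : b j
        · simpa using h2
        · norm_num
      · have : ((b j : ℕ) : F) - 2 = ((b j - 2 : ℕ) : F) := by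
          rw [Nat.cast_sub hge]; norm_num
        rw [this]
        exact natCast_ne_zero (p := p) (by omega) (by omega)
    push Not at hC1 hC2
    -- Here the monomial is squarefree in variables other than $x_j$, and $[x_rx_s\partial_s,\cdot]$
    -- restores a removed factor $x_r$.
    by_cases haj : a j = 0
    · have hrj : r ≠ j := by rintro rfl; exact hr haj
      obtain ⟨b, rfl⟩ := exists_eq_add_single hr
      rw [sum_add_single] at ha
      obtain ⟨s, hs⟩ := exists_ne_zero (a := b) (by omega)
      have hsr : s ≠ r := by
        rintro rfl
        have := hC1 s hrj
        simp only [Pi.add_apply, Pi.single_eq_same] at this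
        omega
      have hsj : s ≠ j := by
        rintro rfl
        simp only [Pi.add_apply] at haj
        omega
      have hbs : b s = 1 := by
        have := hC1 s hsj
        simp only [Pi.add_apply] at this
        omega
      have := lie_mem_radical h (hQ r s s) (hlow r b rfl j)
      rw [lie_E_eq (c := b + Pi.single r 1) (d := 0) (fun _ ↦ by abel)
        (fun h ↦ by simp [Ne.symm hrj, Ne.symm hsj] at h)] at this
      simpa [Ne.symm hrj, Ne.symm hsj, hbs] using this
    have haj3 := hC2 haj
    -- With $a_j=3$ and another variable $x_s$ present, $x_sx_j\partial_j$ restores $x_s$ with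
    -- coefficient $3-1=2$.
    by_cases hs : ∃ s, s ≠ j ∧ a s ≠ 0
    · obtain ⟨s, hsj, hs⟩ := hs
      obtain ⟨b, rfl⟩ := exists_eq_add_single hs
      have hbj : b j = 3 := by simpa [Ne.symm hsj] using haj3
      have := lie_mem_radical h (hQ s j j) (hlow s b rfl j)
      rw [lie_E_eq (c := b + Pi.single s 1) (d := b + Pi.single s 1) (fun _ ↦ by abel)
        (fun _ ↦ by abel), ← sub_smul] at this
      refine (Submodule.smul_mem_iff _ ?_).1 this
      simp only [hbj, Pi.add_apply, Pi.single_eq_of_ne (Ne.symm hsj), Pi.single_eq_same]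
      norm_num
      exact h2
    · push Not at hs
      have haeq : a = Pi.single j 2 + Pi.single j 1 := by
        rw [← Pi.single_add]
        funext t
        by_cases ht : t = j
        · rw [ht, haj3]; simp
        · rw [hs t ht]; simp [ht]
      -- For $x_j^3\partial_j$ a second variable is needed:
      -- $[x_j^2\partial_s,x_jx_s\partial_j]=x_j^3\partial_j-2x_j^2x_s\partial_s$, and the last
      -- field is $[x_j^2\partial_j,x_jx_s\partial_s]$.
      obtain ⟨s, hsj⟩ : ∃ s, s ≠ j := by
        by_cases hgj : g = j
        · exact ⟨g', fun h ↦ hg (hgj.trans h.symm)⟩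
        · exact ⟨g, hgj⟩
      have h1 := lie_mem_radical h (hq' j) (hQ j s s)
      rw [lie_quad, if_neg (Ne.symm hsj), sub_zero, Pi.add_apply, Pi.single_eq_same,
        Pi.single_eq_of_ne (Ne.symm hsj), add_zero, Nat.cast_one, one_smul] at h1
      have h3 := hQ j j s
      rw [← Pi.single_add] at h3
      have := lie_mem_radical h h3 (hQ j s j)
      rw [lie_E_eq (c := a) (d := Pi.single j 1 + Pi.single s 1 + Pi.single j 1)
        (fun _ ↦ by rw [haeq]; abel) (fun _ ↦ by rw [Pi.single_add]; abel)] at this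
      have h4 := Submodule.add_mem _ this (Submodule.smul_mem _
        (((Pi.single j (1 + 1) : Fin n → ℕ) j : ℕ) : F) h1)
      rw [sub_add_cancel] at h4
      simpa [hsj] using h4
  exact eq_zero_of_radical h fun a j _ ha ↦ main _ a rfl ha j

/-- As $a_u\le p-1$, a coordinate `u` of weight `p` needs a contribution from $x_i^c$ or from the
value index `k`. Two such coordinates must therefore be `i` and `k`, and both exponents are pushed
to their maximum. -/
theorem weight_two_aux {lam : Fin n → ℤ} {s t i m j k : Fin n} {c : ℕ} {a : Fin n → ℕ}
    (hp3 : 3 ≤ p) (hst : s ≠ t) (hs : lam s = p) (ht : lam t = p) (hc : c = 2 ∧ i = m ∨ c = 1)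
    (hap : ∀ u, a u < p) (hw : wt (Pi.single i c) m a j k = lam) :
    k ≠ i ∧ k ≠ m ∧ k ≠ j ∧ i ≠ j ∧ a i = p - 1 ∧ a k = p - 1 := by
  have hw' : ∀ u, lam u = p → (if u = i then (c : ℤ) else 0) + a u + (if u = k then 1 else 0)
      - (if u = m then 1 else 0) - (if u = j then 1 else 0) = p := by
    intro u hu
    rw [← hu, ← hw]
    simp only [wt, Pi.single_apply]
    split_ifs <;> push_cast <;> ring
  have hor : ∀ u, lam u = p → u = i ∨ u = k := by
    intro u hu
    have h := hw' u hu
    have := hap u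
    by_contra hc
    push Not at hc
    rw [if_neg hc.1, if_neg hc.2] at h
    split_ifs at h <;> omega
  have hik : i ≠ k ∧ lam i = p ∧ lam k = p := by
    rcases hor s hs with rfl | rfl <;> rcases hor t ht with rfl | rfl
    · exact absurd rfl hst
    · exact ⟨hst, hs, ht⟩
    · exact ⟨hst.symm, ht, hs⟩
    · exact absurd rfl hst
  obtain ⟨hik, hi, hk⟩ := hik
  have h1 := hw' i hi
  have h2 := hw' k hk
  have h3 := hap i
  have h4 := hap k
  rw [if_pos rfl, if_neg hik] at h1
  rw [if_pos rfl, if_neg (Ne.symm hik)] at h2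
  have hkm : k ≠ m ∧ k ≠ j ∧ a k = p - 1 := by
    split_ifs at h2 with e1 e2 e2
    · omega
    · omega
    · omega
    · exact ⟨e1, e2, by omega⟩
  have hij : i ≠ j ∧ a i = p - 1 := by
    rcases hc with ⟨rfl, rfl⟩ | rfl
    · rw [if_pos rfl] at h1
      split_ifs at h1 with e1
      · omega
      · exact ⟨e1, by omega⟩
    · split_ifs at h1 with e1 e2 e2
      · omega
      · omega
      · omega
      · exact ⟨e2, by omega⟩
  exact ⟨hik.symm, hkm.1, hkm.2.1, hij.1, hij.2, hkm.2.2⟩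

/-- A homogeneous cocycle whose weight has two coordinates equal to `p` vanishes. -/
theorem Homog.eq_zero_of_two {ω : TangentForm p n F} {lam : Fin n → ℤ} (hH : Homog ω lam)
    (h : IsCoc ω) (hp2 : p ≠ 2) {s t : Fin n} (hst : s ≠ t) (hs : lam s = p) (ht : lam t = p) :
    ω = 0 := by
  have hp3 := three_le hp2
  have h2 : (2 : F) ≠ 0 := two_ne_zero' hp2
  -- A field containing $x_k^{p-1}$ is a bracket with $x_k^2\partial_k$; the coefficient is
  -- $p-2=-2$, which is invertible.
  have lower : ∀ (a : Fin n → ℕ) (j k : Fin n), k ≠ j → a k = p - 1 →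
      ∃ b : Fin n → ℕ, a = b + Pi.single k 1 ∧
        ⁅quad p F k, (E b j : W p n F)⁆ = (-2 : F) • E a j := by
    intro a j k hkj hak
    obtain ⟨b, rfl⟩ := exists_eq_add_single (a := a) (s := k) (by omega)
    refine ⟨b, rfl, ?_⟩
    rw [lie_quad, if_neg hkj, sub_zero]
    congr 1
    simp only [Pi.add_apply, Pi.single_eq_same] at hak
    have : b k = p - 2 := by omega
    rw [this, Nat.cast_sub (by omega), CharP.cast_eq_zero]
    simp
  have hquad : ∀ i, quad p F i ∈ radical ω := by
    intro i
    refine mem_radical_E h (fun h ↦ by simpa using congrFun h i) i fun a j k ha ha0 ↦ ?_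
    by_contra hne
    obtain ⟨hki, -, hkj, hij, hai, hak⟩ :=
      weight_two_aux hp3 hst hs ht (Or.inl ⟨rfl, rfl⟩) ha (hH _ _ _ _ _ hne)
    obtain ⟨b, rfl, hb⟩ := lower a j k hkj hak
    have hbi : b i = p - 1 := by simpa [Ne.symm hki] using hai
    have hb0 : b ≠ 0 := by rintro rfl; simp at hbi; omega
    have := h.lie_quad_right (ev_quad i) (ev_E_of_ne hb0 j) k
    have e1 : ⁅quad p F i, quad p F k⁆ = 0 := by
      conv_lhs => rw [quad.eq_1 p F k, lie_quad]
      simp [Ne.symm hki]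
    have e2 : ⁅quad p F i, (E b j : W p n F)⁆ = 0 := by
      rw [lie_quad, E_eq_zero (i := i), smul_zero]
      simp only [Pi.add_apply, Pi.single_eq_same]
      omega
    have hb2 : 2 ≤ ∑ u, b u := by
      have := Finset.single_le_sum (f := b) (fun _ _ ↦ Nat.zero_le _) (Finset.mem_univ i)
      omega
    rw [hb, e1, e2, act_quad, act_E_of_two_le hb2, map_smul] at this
    simp only [map_zero, LinearMap.zero_apply, add_zero, sub_zero] at this
    apply hne
    show ω (quad p F i) _ k = 0
    rw [(smul_eq_zero.1 this).resolve_left (neg_ne_zero.2 h2)]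
    rfl
  refine radical_eq_of_generators h hp2 hst (fun i m ↦ ?_) (hquad s)
  refine mem_radical_E h (fun h ↦ by simpa using congrFun h i) m fun a j k ha ha0 ↦ ?_
  by_contra hne
  obtain ⟨hki, hkm, hkj, hij, hai, hak⟩ :=
    weight_two_aux hp3 hst hs ht (Or.inr rfl) ha (hH _ _ _ _ _ hne)
  obtain ⟨b, rfl, hb⟩ := lower a j k hkj hak
  have hbi : b i = p - 1 := by simpa [Ne.symm hki] using hai
  have hb0 : b ≠ 0 := by rintro rfl; simp at hbi; omega
  have hu : ev (E (Pi.single i 1) m : W p n F) = 0 := ev_E_single i m one_ne_zero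
  have := h.lie_quad_right hu (ev_E_of_ne hb0 j) k
  have e1 : ⁅(E (Pi.single i 1) m : W p n F), quad p F k⁆ = 0 := by
    rw [← lie_skew, lie_quad, if_neg hkm, Pi.single_eq_of_ne hki]
    simp
  have e2 := (mem_radical.1 (hquad k)).2
  rw [hb, e1, e2, h.skew _ (quad p F k), e2, map_smul] at this
  simp only [map_zero, LinearMap.zero_apply, add_zero, sub_zero, neg_zero] at this
  apply hne
  rw [(smul_eq_zero.1 this).resolve_left (neg_ne_zero.2 h2)]
  rfl

end Weights

/-! ### Weight `p` in a single coordinate: linear and quadratic fields in the radical. -/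

section WeightOne

variable {p n : ℕ} {F : Type*} [Field F] [CharP F p]

/-- The bracket of `x_s ∂_o` with a monomial field divisible by `x_o`. -/
theorem lie_linear (s o : Fin n) (b : Fin n → ℕ) (j : Fin n) :
    ⁅(E (Pi.single s 1) o : W p n F), (E (b + Pi.single o 1) j : W p n F)⁆ =
      ((b o : F) + 1) • E (b + Pi.single s 1) j -
        (if j = s then 1 else 0 : F) • E (b + Pi.single o 1) o := by
  rw [lie_E_eq (c := b + Pi.single s 1) (d := b + Pi.single o 1) (fun _ ↦ by abel)]
  · congr 2
    · simp
    · rw [Pi.single_apply]; split_ifs <;> simp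
  · intro h
    have : j = s := by by_contra hc; simp [hc] at h
    rw [this]; abel

theorem lie_of_eq_zero {a b : Fin n → ℕ} {m j : Fin n} (haj : a j = 0) :
    ⁅(E a m : W p n F), (E (b + Pi.single m 1) j : W p n F)⁆ = ((b m : F) + 1) • E (a + b) j := by
  rw [lie_E_eq (c := a + b) (d := 0) (fun _ ↦ by abel) (fun h ↦ absurd haj h), haj]
  simp

theorem lie_eq_zero {a b : Fin n → ℕ} {m j : Fin n} (haj : a j = 0) (hbm : b m = 0) :
    ⁅(E a m : W p n F), (E b j : W p n F)⁆ = 0 := by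
  rw [lie_E_eq (c := 0) (d := 0) (fun h ↦ absurd hbm h) (fun h ↦ absurd haj h), haj, hbm]
  simp

variable [Fact p.Prime]

theorem cast_sub_of_le {m : ℕ} (hm : m ≤ p) : ((p - m : ℕ) : F) = -(m : F) := by
  rw [Nat.cast_sub hm, CharP.cast_eq_zero, zero_sub]

theorem single_split (o : Fin n) {m : ℕ} (hm : m < p) :
    (Pi.single o (p - (m + 1)) + Pi.single o 1 : Fin n → ℕ) = Pi.single o (p - m) := by
  rw [← Pi.single_add]
  congr 1
  omega

theorem lie_quad_top (o j : Fin n) :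
    ⁅quad p F o, (E (Pi.single o (p - 1)) j : W p n F)⁆ = 0 := by
  have := (Fact.out : p.Prime).one_lt
  rw [lie_quad, E_eq_zero (i := o), smul_zero]
  simp
  omega

variable {ω : TangentForm p n F} {o : Fin n}

theorem Homog.wt_eq (hH : Homog ω (Pi.single o (p : ℤ))) {a : Fin n → ℕ} {j : Fin n}
    {b : Fin n → ℕ} {l k : Fin n} (hne : ω (E a j) (E b l) k ≠ 0) (t : Fin n) :
    (a t : ℤ) + b t + (if t = k then 1 else 0) =
      (if t = j then 1 else 0) + (if t = l then 1 else 0) + (if t = o then (p : ℤ) else 0) := by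
  have := congrFun (hH a j b l k hne) t
  rw [Pi.single_apply] at this
  simp only [wt] at this
  linarith

/-- The weight is zero modulo `p`, so the form is torus-invariant and its contraction with an Euler
field is closed. By weight only $x_o^{p-1}x_j\partial_j$ could matter, and it is a multiple of
$[x_o^2\partial_o,x_o^{p-2}x_j\partial_j]$, on which a closed cochain vanishes. -/
theorem Homog.euler_mem (hH : Homog ω (Pi.single o (p : ℤ))) (h : IsCoc ω) (hp2 : p ≠ 2)
    (i : Fin n) : euler p F i ∈ radical ω := by
  have hp3 := three_le hp2
  refine mem_radical_E h (fun h ↦ by simpa using congrFun h i) i fun a j k ha ha0 ↦ ?_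
  by_contra hne
  have hw : ∀ t, (a t : ℤ) + (if t = k then 1 else 0) =
      (if t = j then 1 else 0) + (if t = o then (p : ℤ) else 0) := by
    intro t
    have := hH.wt_eq hne t
    rw [Pi.single_apply] at this
    split_ifs at this ⊢ <;> push_cast at this <;> linarith
  have h1 := hw o
  have h2 := ha o
  rw [if_pos rfl] at h1
  have hko : k = o ∧ j ≠ o ∧ a o = p - 1 := by
    split_ifs at h1 with e1 e2 e2
    · omega
    · exact ⟨e1.symm, Ne.symm e2, by omega⟩
    · omega
    · omega
  obtain ⟨rfl, hjk, hak⟩ := hko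
  have hae : a = Pi.single k (p - 1) + Pi.single j 1 := by
    funext t
    simp only [Pi.add_apply, Pi.single_apply]
    by_cases htk : t = k
    · subst htk
      rw [if_pos rfl, if_neg (Ne.symm hjk), hak, add_zero]
    · have := hw t
      rw [if_neg htk, if_neg htk] at this
      rw [if_neg htk]
      split_ifs at this ⊢ <;> omega
  have hy : ev (E (Pi.single k (p - 2) + Pi.single j 1) j : W p n F) = 0 := ev_E_add_single _ _ _
  have h3 := h.lie_quad_right (ev_euler i) hy k
  have h4 := hH.lie_euler_eq i (quad p F k) (E (Pi.single k (p - 2) + Pi.single j 1) j)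
  have h5 : (((Pi.single k (p : ℤ) : Fin n → ℤ) i : ℤ) : F) = 0 := by
    rw [Pi.single_apply]; split_ifs <;> simp
  rw [h5, neg_zero, zero_smul] at h4
  rw [quad_lie_top hjk, act_E_of_two_le (by rw [sum_add_single, sum_single]; omega), sub_zero] at h3
  have h6 : (-2 : F) • ω (euler p F i) (E a j) = 0 := by
    rw [hae, ← map_smul, h3, ← neg_eq_zero, ← h4]
    abel
  apply hne
  show ω (euler p F i) _ k = 0
  rw [(smul_eq_zero.1 h6).resolve_left (neg_ne_zero.2 (two_ne_zero' hp2))]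
  rfl

/-- The linear fields `x_i ∂_o` always lie in the radical. -/
theorem Homog.linear_mem (hH : Homog ω (Pi.single o (p : ℤ))) (h : IsCoc ω) (hp2 : p ≠ 2)
    (i : Fin n) : E (Pi.single i 1) o ∈ radical ω := by
  by_cases hi : i = o
  · subst hi
    exact hH.euler_mem h hp2 i
  refine mem_radical_E h (fun h ↦ by simpa using congrFun h i) o fun a j k ha ha0 ↦ ?_
  by_contra hne
  -- At `o` the left side is at most $a_o+1\le p$, the right side at least $p+1$.
  have h1 := hH.wt_eq hne o
  have h2 := ha o
  rw [Pi.single_eq_of_ne (Ne.symm hi), if_pos rfl, if_pos rfl] at h1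
  split_ifs at h1 <;> omega

/-- Off-diagonal coefficients of `ω(x_o² ∂_o, x_o^(p-1) ∂_j)` vanish. -/
theorem Homog.quad_top_eq (hH : Homog ω (Pi.single o (p : ℤ))) (j : Fin n) :
    ω (quad p F o) (E (Pi.single o (p - 1)) j) =
      ω (quad p F o) (E (Pi.single o (p - 1)) j) j • Pi.single j 1 := by
  ext k
  by_cases hk : k = j
  · subst hk
    simp
  · rw [Pi.smul_apply, Pi.single_eq_of_ne hk, smul_zero]
    by_contra hne
    have h1 := hH.wt_eq (a := Pi.single o 2) (j := o) hne k
    have := (Fact.out : p.Prime).one_lt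
    simp only [Pi.single_apply, hk, if_false, if_true] at h1
    split_ifs at h1 <;> push_cast at h1 <;> omega

/-- By weight only three families of coefficients survive. One is assumed to vanish. Those at
$x_o^{p-1}\partial_j$, $j\ne o$, are all equal, by the identity against $x_{j_0}\partial_j$. The one
at $x_o^{p-1}\partial_o$ is eliminated between three cocycle identities, or vanishes by alternation
when $p=3$. -/
theorem Homog.quad_mem (hH : Homog ω (Pi.single o (p : ℤ))) (h : IsCoc ω) (hp2 : p ≠ 2)
    (hη : ∀ j, j ≠ o → ω (quad p F o) (E (Pi.single o (p - 2) + Pi.single j 1) j) o = 0)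
    (hc : ∃ j, (j ≠ o ∨ ∀ k, k = o) ∧ ω (quad p F o) (E (Pi.single o (p - 1)) j) j = 0) :
    quad p F o ∈ radical ω := by
  have hp3 := three_le hp2
  obtain ⟨j₀, hj₀, hc₀⟩ := hc
  have hcj : ∀ j, j ≠ o → ω (quad p F o) (E (Pi.single o (p - 1)) j) j = 0 := by
    intro j hj
    by_cases hjj : j = j₀
    · rw [hjj, hc₀]
    have hj₀o : j₀ ≠ o := hj₀.resolve_right fun hall ↦ hj (hall j)
    have h1 := h.lie_quad_right (ev_E_single (F := F) (p := p) j₀ j one_ne_zero)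
      (ev_E_single (F := F) (p := p) o j₀ (m := p - 1) (by omega)) o
    have e1 : ⁅(E (Pi.single j₀ 1) j : W p n F), quad p F o⁆ = 0 := by
      rw [← lie_skew, lie_quad, if_neg (Ne.symm hj), Pi.single_eq_of_ne (Ne.symm hj₀o)]
      simp
    have e2 : ⁅(E (Pi.single j₀ 1) j : W p n F), (E (Pi.single o (p - 1)) j₀ : W p n F)⁆ =
        - E (Pi.single o (p - 1)) j := by
      rw [lie_E_eq (c := 0) (d := Pi.single o (p - 1)) (fun h ↦ by simp [hj] at h)
        (fun _ ↦ by rw [add_comm])]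
      simp [hj]
    have e3 : act (E (Pi.single o (p - 1)) j₀ : W p n F)
        (ω (E (Pi.single j₀ 1) j) (quad p F o)) = 0 :=
      act_E_of_two_le (by rw [sum_single]; omega) _ _
    rw [lie_quad_top, e1, e2, e3, hH.quad_top_eq j₀, hc₀, zero_smul] at h1
    simp only [map_zero, LinearMap.zero_apply, zero_add, sub_zero, map_neg] at h1
    have := congrFun h1 j
    simpa using this.symm
  have hco : ω (quad p F o) (E (Pi.single o (p - 1)) o) o = 0 := by
    by_cases hj : j₀ = o
    · rw [← hj, hj]
      rwa [hj] at hc₀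
    by_cases hp : p = 3
    · have e : (E (Pi.single o (p - 1)) o : W p n F) = quad p F o := by
        rw [show p - 1 = 2 by omega, quad]
      rw [e, h.self]
      rfl
    have hp5 : 5 ≤ p := by
      have h4 : p ≠ 4 := by
        rintro rfl
        exact absurd (Fact.out : Nat.Prime 4) (by norm_num)
      omega
    have hηj := hη j₀ hj
    -- the three brackets `[y, z]` with `ω(x_o² ∂_o, [y, z]) = - ω(x_o² ∂_o, x_o^(p-1) ∂_o)`
    have br : ∀ (m : ℕ), m + 1 ≤ p - 1 →
        ⁅(E (Pi.single o m + Pi.single j₀ 1) o : W p n F),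
          (E (Pi.single o (p - (m + 1))) j₀ : W p n F)⁆ =
        ((p - (m + 1) : ℕ) : F) • E (Pi.single o (p - 2) + Pi.single j₀ 1) j₀ -
          E (Pi.single o (p - 1)) o := by
      intro m hm
      rw [lie_E_eq (c := Pi.single o (p - 2) + Pi.single j₀ 1) (d := Pi.single o (p - 1))]
      · simp [hj]
      · intro _
        funext t
        simp only [Pi.add_apply, Pi.single_apply]
        split_ifs <;> omega
      · intro _
        funext t
        simp only [Pi.add_apply, Pi.single_apply]
        split_ifs <;> omega
    have hbr : ∀ (m : ℕ), m + 1 ≤ p - 1 → ω (quad p F o)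
        ⁅(E (Pi.single o m + Pi.single j₀ 1) o : W p n F),
          (E (Pi.single o (p - (m + 1))) j₀ : W p n F)⁆ o =
        - ω (quad p F o) (E (Pi.single o (p - 1)) o) o := by
      intro m hm
      rw [br m hm, map_sub, map_smul, Pi.sub_apply, Pi.smul_apply, hηj]
      simp
    have hql : ∀ (m : ℕ), ⁅(E (Pi.single o m + Pi.single j₀ 1) o : W p n F), quad p F o⁆ =
        (2 - (m : F)) • E (Pi.single o (m + 1) + Pi.single j₀ 1) o := by
      intro m
      rw [← lie_skew, lie_quad, if_pos rfl, ← neg_smul]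
      congr 1
      · simp [Ne.symm hj]
      · congr 1
        funext t
        simp only [Pi.add_apply, Pi.single_apply]
        split_ifs <;> omega
    have hqr : ∀ (m : ℕ), m + 2 ≤ p → ⁅quad p F o, (E (Pi.single o (p - (m + 2))) j₀ : W p n F)⁆ =
        (-((m : F) + 2)) • E (Pi.single o (p - (m + 1))) j₀ := by
      intro m hm
      rw [lie_quad, if_neg (Ne.symm hj)]
      congr 1
      · simp [cast_sub_of_le (F := F) hm]
      · congr 1
        rw [← Pi.single_add]
        congr 1
        omega
    have ha := h.lie_quad_right (ev_E_add_single (F := F) (p := p) (Pi.single o 0) j₀ o)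
      (ev_E_single (F := F) (p := p) o j₀ (m := p - (0 + 1)) (by omega)) o
    have hb := h.lie_quad_right (ev_E_add_single (F := F) (p := p) (Pi.single o 1) j₀ o)
      (ev_E_single (F := F) (p := p) o j₀ (m := p - (1 + 1)) (by omega)) o
    have hc := h.lie_quad_right (ev_E_add_single (F := F) (p := p) (Pi.single o 2) j₀ o)
      (ev_E_single (F := F) (p := p) o j₀ (m := p - (2 + 1)) (by omega)) o
    have ha' := congrFun ha o
    have hb' := congrFun hb o
    have hc' := congrFun hc o
    have hda : act (E (Pi.single o (p - (0 + 1))) j₀ : W p n F)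
        (ω (E (Pi.single o 0 + Pi.single j₀ 1) o) (quad p F o)) = 0 :=
      act_E_of_two_le (by rw [sum_single]; omega) _ _
    have hdb : act (E (Pi.single o (p - (1 + 1))) j₀ : W p n F)
        (ω (E (Pi.single o 1 + Pi.single j₀ 1) o) (quad p F o)) = 0 :=
      act_E_of_two_le (by rw [sum_single]; omega) _ _
    have hdc : act (E (Pi.single o (p - (2 + 1))) j₀ : W p n F)
        (ω (E (Pi.single o 2 + Pi.single j₀ 1) o) (quad p F o)) = 0 :=
      act_E_of_two_le (by rw [sum_single]; omega) _ _
    have hub : ∀ v, act (E (Pi.single o 1 + Pi.single j₀ 1) o : W p n F) v = 0 := fun v ↦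
      act_E_of_two_le (by rw [sum_add_single, sum_single]) _ _
    have huc : ∀ v, act (E (Pi.single o 2 + Pi.single j₀ 1) o : W p n F) v = 0 := fun v ↦
      act_E_of_two_le (by rw [sum_add_single, sum_single]; omega) _ _
    have hz : ω (quad p F o) (E (Pi.single o (p - (0 + 1))) j₀) = 0 := by
      rw [zero_add, hH.quad_top_eq j₀, hc₀, zero_smul]
    rw [hda, hz, hql, show (0 + 1 : ℕ) = 1 from rfl, lie_quad_top] at ha'
    simp only [Pi.sub_apply, Pi.add_apply, hbr 0 (by omega)] at ha'
    rw [hdb, hub, hql, hqr 0 (by omega)] at hb'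
    simp only [Pi.sub_apply, Pi.add_apply, hbr 1 (by omega)] at hb'
    rw [hdc, huc, hql, hqr 1 (by omega)] at hc'
    simp only [Pi.sub_apply, Pi.add_apply, hbr 2 (by omega)] at hc'
    simp only [map_smul, LinearMap.smul_apply, Pi.smul_apply, smul_eq_mul, map_zero,
      Pi.zero_apply] at ha' hb' hc'
    simp only [Nat.cast_zero, Nat.cast_one, Nat.cast_ofNat, zero_add] at ha' hb' hc'
    -- Let $Z$ be the wanted coefficient and $f_m$ that at
    -- $(x_o^mx_{j_0}\partial_o,\,x_o^{p-m}\partial_{j_0})$. The identities read $0=2f_1-Z$,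
    -- $-2f_1=f_2-Z$ and $-3f_2=-Z$, whence $Z=0$. The third one uses $x_o^{p-3}\partial_{j_0}$,
    -- which lies in the isotropy subalgebra only for $p>3$.
    linear_combination 3 * ha' - 3 * hb' + hc'
  refine mem_radical_E h (fun h ↦ by simpa using congrFun h o) o fun a j k ha ha0 ↦ ?_
  by_contra hne
  have hw := hH.wt_eq hne
  have hwo := hw o
  have hao := ha o
  rw [Pi.single_eq_same, if_pos rfl, if_pos rfl] at hwo
  by_cases hjo : j = o
  · subst hjo
    have hkj : k = j := by
      by_contra hkj
      rw [if_neg (Ne.symm hkj), if_pos rfl] at hwo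
      have := hw k
      rw [if_pos rfl, if_neg hkj, if_neg hkj] at this
      omega
    subst hkj
    have hae : a = Pi.single k (p - 1) := by
      funext t
      have := hw t
      simp only [Pi.single_apply] at this ⊢
      split_ifs at this ⊢ <;> push_cast at this <;> omega
    apply hne
    rw [hae]
    exact hco
  · rw [if_neg (Ne.symm hjo)] at hwo
    by_cases hko : k = o
    · subst hko
      have hae : a = Pi.single k (p - 2) + Pi.single j 1 := by
        funext t
        have := hw t
        simp only [Pi.single_apply, Pi.add_apply] at this ⊢
        split_ifs at this ⊢ <;> push_cast at this <;> omega
      apply hne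
      rw [hae]
      exact hη j hjo
    · have hkj : k = j := by
        by_contra hkj
        have := hw k
        rw [if_pos rfl, if_neg hkj, if_neg hko, Pi.single_eq_of_ne hko] at this
        omega
      subst hkj
      have hae : a = Pi.single o (p - 1) := by
        funext t
        have := hw t
        simp only [Pi.single_apply] at this ⊢
        split_ifs at this ⊢ <;> push_cast at this <;> omega
      apply hne
      rw [hae]
      exact hcj k hjo

end WeightOne

/-! ### Weight `p` in a single coordinate: vanishing once $x_o^2\partial_o$ is in the radical. -/

section WeightOneVanishing

variable {p n : ℕ} {F : Type*} [Field F] [CharP F p] [Fact p.Prime]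
variable {ω : TangentForm p n F} {o : Fin n}

theorem IsCoc.quad_invariant (h : IsCoc ω) (hq : quad p F o ∈ radical ω) {y z : W p n F}
    (hy : ev y = 0) (hz : ev z = 0) : ω ⁅quad p F o, y⁆ z + ω y ⁅quad p F o, z⁆ = 0 := by
  rw [h.invariant hq hy hz, act_quad]

/-- A field with $x_o$-exponent $p-1$ is, up to $-2$, a bracket with $x_o^2\partial_o$; invariance
moves that bracket onto `u`, where it vanishes. -/
theorem IsCoc.eq_zero_of_top (h : IsCoc ω) (hp2 : p ≠ 2) (hq : quad p F o ∈ radical ω)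
    {u : W p n F} (hu : ev u = 0) (hqu : ⁅quad p F o, u⁆ = 0) {a : Fin n → ℕ} {l : Fin n}
    (hl : l ≠ o) (ha : a o = p - 1) : ω u (E a l) = 0 := by
  have hp3 := three_le hp2
  obtain ⟨b, rfl⟩ := exists_eq_add_single (a := a) (s := o) (by omega)
  have hb : b o = p - 2 := by
    simp only [Pi.add_apply, Pi.single_eq_same] at ha
    omega
  have hb0 : b ≠ 0 := by rintro rfl; simp at hb; omega
  have := h.quad_invariant hq hu (ev_E_of_ne hb0 l)
  rw [hqu, lie_quad, if_neg (Ne.symm hl), hb, cast_sub_of_le (by omega), map_smul] at this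
  simp only [map_zero, LinearMap.zero_apply, zero_add, sub_zero, Nat.cast_ofNat] at this
  exact (smul_eq_zero.1 this).resolve_left (neg_ne_zero.2 (two_ne_zero' hp2))

theorem Homog.linear_mem_of_ne (hH : Homog ω (Pi.single o (p : ℤ))) (h : IsCoc ω) (hp2 : p ≠ 2)
    (hq : quad p F o ∈ radical ω) {i m : Fin n} (hi : i ≠ o) (hm : m ≠ o) :
    E (Pi.single i 1) m ∈ radical ω := by
  refine mem_radical_E h (fun h ↦ by simpa using congrFun h i) m fun a j k ha ha0 ↦ ?_
  by_contra hne
  have h1 := hH.wt_eq hne o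
  have h2 := ha o
  rw [Pi.single_eq_of_ne (Ne.symm hi), if_pos rfl, if_neg (Ne.symm hm)] at h1
  have hj : j ≠ o := by
    rintro rfl
    rw [if_pos rfl] at h1
    split_ifs at h1 <;> omega
  rw [if_neg (Ne.symm hj)] at h1
  have hao : a o = p - 1 := by split_ifs at h1 <;> omega
  refine hne ?_
  rw [h.eq_zero_of_top hp2 hq (ev_E_single i m one_ne_zero) _ hj hao]
  · rfl
  · rw [lie_quad, if_neg (Ne.symm hm), Pi.single_eq_of_ne (Ne.symm hi)]
    simp

/-- Values on pairs `(x_o ∂_m, x_o^(p-1) x_l ∂_j)` in terms of simpler ones. -/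
theorem Homog.linear_top_eq (hH : Homog ω (Pi.single o (p : ℤ))) (h : IsCoc ω) (hp2 : p ≠ 2)
    (hq : quad p F o ∈ radical ω) {m l j : Fin n} (hm : m ≠ o) (hl : l ≠ o) (hj : j ≠ o) :
    ω (E (Pi.single o 1 + Pi.single l 1) m) (E (Pi.single o (p - 1)) j) =
      ω (E (Pi.single o 1) m) (E (Pi.single o (p - 1) + Pi.single l 1) j) := by
  have hp3 := three_le hp2
  have hqm : ⁅quad p F o, (E (Pi.single o 1) m : W p n F)⁆ = E (Pi.single o 2) m := by
    rw [lie_quad, if_neg (Ne.symm hm), ← Pi.single_add]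
    simp
  have ha : ∀ j, ω (E (Pi.single o 2) m) (E (Pi.single o (p - 1)) j) = 0 := by
    intro j
    have := h.quad_invariant hq (ev_E_single o m one_ne_zero)
      (ev_E_single (p := p) (F := F) o j (m := p - 1) (by omega))
    rw [hqm, lie_quad_top] at this
    simpa using this
  -- Invariance under $x_l\partial_o$ and under $x_o^2\partial_o$ express the two sides through the
  -- same value at $(x_o^2\partial_m,\,x_o^{p-2}x_l\partial_j)$.
  have hb := h.invariant (hH.linear_mem h hp2 l) (ev_E_single (p := p) (F := F) o m two_ne_zero)
    (ev_E_single (p := p) (F := F) o j (m := p - 1) (by omega))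
  have hc := h.quad_invariant hq (ev_E_single o m one_ne_zero)
    (ev_E_add_single (F := F) (p := p) (Pi.single o (p - 2)) l j)
  have e1 : ⁅(E (Pi.single l 1) o : W p n F), (E (Pi.single o 2) m : W p n F)⁆ =
      (2 : F) • E (Pi.single o 1 + Pi.single l 1) m -
        (if m = l then 1 else 0 : F) • quad p F o := by
    have := lie_linear (p := p) (F := F) l o (Pi.single o 1) m
    rw [← Pi.single_add, Pi.single_eq_same] at this
    rw [this, quad]
    norm_num
  have e2 : ⁅(E (Pi.single l 1) o : W p n F), (E (Pi.single o (p - 1)) j : W p n F)⁆ =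
      (-1 : F) • E (Pi.single o (p - 2) + Pi.single l 1) j -
        (if j = l then 1 else 0 : F) • E (Pi.single o (p - 1)) o := by
    have := lie_linear (p := p) (F := F) l o (Pi.single o (p - 2)) j
    rw [single_split o (m := 1) (by omega), Pi.single_eq_same, cast_sub_of_le (by omega)] at this
    rw [this]
    norm_num
  have e3 : ⁅quad p F o, (E (Pi.single o (p - 2) + Pi.single l 1) j : W p n F)⁆ =
      (-2 : F) • E (Pi.single o (p - 1) + Pi.single l 1) j := by
    rw [lie_quad, if_neg (Ne.symm hj), add_right_comm, single_split o (m := 1) (by omega)]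
    simp [Ne.symm hl, cast_sub_of_le (F := F) (p := p) (m := 2) (by omega)]
  rw [e1, e2, ha] at hb
  rw [hqm, e3] at hc
  simp only [map_sub, map_smul, LinearMap.smul_apply, ha,
    (mem_radical.1 hq).2, smul_zero, sub_zero, map_zero] at hb hc
  have h3 : (2 : F) • (ω (E (Pi.single o 1 + Pi.single l 1) m) (E (Pi.single o (p - 1)) j) -
      ω (E (Pi.single o 1) m) (E (Pi.single o (p - 1) + Pi.single l 1) j)) = 0 := by
    rw [eq_neg_of_add_eq_zero_left hc] at hb
    rw [← hb]
    module
  exact sub_eq_zero.1 ((smul_eq_zero.1 h3).resolve_left (two_ne_zero' hp2))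

/-- The cocycle identity on `x_o ∂_m`, `x_o^(p-1) ∂_r` and `Q ∂_j` with `Q = x_l x_s`. -/
theorem IsCoc.linear_top_coc (h : IsCoc ω) (hp2 : p ≠ 2) (hq : quad p F o ∈ radical ω)
    {m r l s j : Fin n} (hm : m ≠ o) (hr : r ≠ o) (hl : l ≠ o) (hs : s ≠ o) (hj : j ≠ o) :
    ω ⁅(E (Pi.single o 1) m : W p n F), (E (Pi.single l 1 + Pi.single s 1) j : W p n F)⁆
        (E (Pi.single o (p - 1)) r) =
      - ω (E (Pi.single o 1) m) ⁅(E (Pi.single o (p - 1)) r : W p n F),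
        (E (Pi.single l 1 + Pi.single s 1) j : W p n F)⁆ := by
  have hp3 := three_le hp2
  have hz : ⁅quad p F o, (E (Pi.single l 1 + Pi.single s 1) j : W p n F)⁆ = 0 := by
    rw [lie_quad, if_neg (Ne.symm hj)]
    simp [Ne.symm hl, Ne.symm hs]
  have h0 := h.eq_zero_of_top hp2 hq (ev_E_add_single (F := F) (p := p) (Pi.single l 1) s j) hz hr
    (a := Pi.single o (p - 1)) (by simp)
  have h1 := h.coc _ _ _ (ev_E_single (p := p) (F := F) o m one_ne_zero)
    (ev_E_single (p := p) (F := F) o r (m := p - 1) (by omega))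
    (ev_E_add_single (F := F) (p := p) (Pi.single l 1) s j)
  have e1 : ∀ v, act (E (Pi.single o (p - 1)) r : W p n F) v = 0 := fun v ↦
    act_E_of_two_le (by rw [sum_single]; omega) _ _
  have e2 : ∀ v, act (E (Pi.single l 1 + Pi.single s 1) j : W p n F) v = 0 := fun v ↦
    act_E_of_two_le (by rw [sum_add_single, sum_single]) _ _
  rw [h.skew (E (Pi.single o (p - 1)) r) (E (Pi.single l 1 + Pi.single s 1) j), h0, e1, e2,
    lie_eq_zero (by simp [hr]) (by simp [hm]),
    h.skew _ (E (Pi.single o 1) m)] at h1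
  simp only [map_zero, neg_zero, LinearMap.zero_apply, sub_zero, zero_add, sub_neg_eq_add] at h1
  exact eq_neg_of_add_eq_zero_left h1

/-- If $l\ne m$, the identity with $Q=x_l^2$ isolates the value, since $x_o\partial_m$ commutes with
$Q\partial_j$. If $l=m$, combining it with `linear_top_eq` replaces the value by minus the one with
$m$ and $j$ exchanged: minus itself when $j=m$, and the previous case otherwise. -/
theorem Homog.linear_top_eq_zero (hH : Homog ω (Pi.single o (p : ℤ))) (h : IsCoc ω) (hp2 : p ≠ 2)
    (hq : quad p F o ∈ radical ω) {m l j : Fin n} (hm : m ≠ o) (hl : l ≠ o) (hj : j ≠ o) :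
    ω (E (Pi.single o 1) m) (E (Pi.single o (p - 1) + Pi.single l 1) j) = 0 := by
  have h2 := two_ne_zero' (p := p) (F := F) hp2
  -- distinct `l` and `m`
  have c2 : ∀ {m l j : Fin n}, m ≠ o → l ≠ o → j ≠ o → l ≠ m →
      ω (E (Pi.single o 1) m) (E (Pi.single o (p - 1) + Pi.single l 1) j) = 0 := by
    intro m l j hm hl hj hlm
    have := h.linear_top_coc hp2 hq hm hl hl hl hj
    rw [lie_eq_zero (by simp [hj]) (by simp [Ne.symm hlm]),
      lie_of_eq_zero (by simp [hj]), Pi.single_eq_same, map_smul] at this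
    simp only [map_zero, LinearMap.zero_apply, Nat.cast_one, one_add_one_eq_two] at this
    rw [eq_comm, neg_eq_zero] at this
    exact (smul_eq_zero.1 this).resolve_left h2
  by_cases hlm : l = m
  · subst hlm
    have := h.linear_top_coc hp2 hq hl hl hl hl hj
    rw [lie_of_eq_zero (by simp [hj]), lie_of_eq_zero (by simp [hj]), Pi.single_eq_same, map_smul,
      map_smul, LinearMap.smul_apply, Nat.cast_one, one_add_one_eq_two, ← smul_neg] at this
    have := smul_right_injective _ h2 this
    rw [hH.linear_top_eq h hp2 hq hj hl hl] at this
    by_cases hjl : j = l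
    · subst hjl
      rw [eq_neg_iff_add_eq_zero, ← two_smul F] at this
      exact (smul_eq_zero.1 this).resolve_left h2
    · rw [c2 hj hl hl (Ne.symm hjl)] at this
      rw [eq_comm, neg_eq_zero] at this
      exact this
  · exact c2 hm hl hj hlm

/-- Invariance under $x_s\partial_o$, applied to a pair on which the form is already known to
vanish, trades a factor $x_o$ for $x_s$. -/
theorem Homog.linear_double_eq (hH : Homog ω (Pi.single o (p : ℤ))) (h : IsCoc ω) (hp2 : p ≠ 2)
    (hq : quad p F o ∈ radical ω) {m s l j : Fin n} (hm : m ≠ o) (hs : s ≠ o) (hl : l ≠ o)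
    (hj : j ≠ o) :
    ω (E (Pi.single o 1) m) (E (Pi.single o (p - 2) + Pi.single l 1 + Pi.single s 1) j) =
      - (if j = s then 1 else 0 : F) •
        ω (E (Pi.single o 1) m) (E (Pi.single o (p - 1) + Pi.single l 1) o) := by
  have hp3 := three_le hp2
  have h1 := h.invariant (hH.linear_mem h hp2 s) (ev_E_single (p := p) (F := F) o m one_ne_zero)
    (ev_E_add_single (F := F) (p := p) (Pi.single o (p - 1)) l j)
  have e1 : ω ⁅(E (Pi.single s 1) o : W p n F), (E (Pi.single o 1) m : W p n F)⁆ = 0 := by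
    have := lie_linear (p := p) (F := F) s o 0 m
    rw [zero_add, zero_add] at this
    rw [this, map_sub, map_smul, map_smul, (mem_radical.1 (hH.linear_mem h hp2 o)).2,
      (mem_radical.1 (hH.linear_mem_of_ne h hp2 hq hs hm)).2]
    simp
  have e2 : ⁅(E (Pi.single s 1) o : W p n F),
      (E (Pi.single o (p - 1) + Pi.single l 1) j : W p n F)⁆ =
      (-1 : F) • E (Pi.single o (p - 2) + Pi.single l 1 + Pi.single s 1) j -
        (if j = s then 1 else 0 : F) • E (Pi.single o (p - 1) + Pi.single l 1) o := by
    have := lie_linear (p := p) (F := F) s o (Pi.single o (p - 2) + Pi.single l 1) j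
    rw [add_right_comm _ _ (Pi.single o 1), single_split o (m := 1) (by omega), Pi.add_apply,
      Pi.single_eq_same, Pi.single_eq_of_ne (Ne.symm hl), add_zero,
      cast_sub_of_le (by omega)] at this
    rw [this]
    norm_num
  rw [e1, e2, hH.linear_top_eq_zero h hp2 hq hm hl hj, LinearMap.zero_apply, zero_add, map_zero,
    map_sub, map_smul, map_smul, neg_smul, one_smul, sub_eq_zero] at h1
  rw [neg_smul, ← h1, neg_neg]

/-- For $p=3$ invariance under $x_o^2\partial_o$ links the value to one involving $x_m\partial_o$,
which is in the radical. For $p\ge5$ the value is, up to sign, the coefficient $A$ at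
$(x_o\partial_m,x_o^{p-2}x_m^2\partial_m)$. With $B$ the coefficient at
$(x_o^2\partial_m,x_o^{p-3}x_m^2\partial_m)$, invariance gives $B=3A$. -/
theorem Homog.linear_self_eq_zero (hH : Homog ω (Pi.single o (p : ℤ))) (h : IsCoc ω)
    (hp2 : p ≠ 2) (hq : quad p F o ∈ radical ω) {m : Fin n} (hm : m ≠ o) :
    ω (E (Pi.single o 1) m) (E (Pi.single o (p - 1) + Pi.single m 1) o) o = 0 := by
  have hp3 := three_le hp2
  have h2 := two_ne_zero' (p := p) (F := F) hp2
  have hqm : ⁅quad p F o, (E (Pi.single o 1) m : W p n F)⁆ = E (Pi.single o 2) m := by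
    rw [lie_quad, if_neg (Ne.symm hm), ← Pi.single_add]
    simp
  by_cases hp : p = 3
  · have hp' : p - 1 = 2 := by omega
    have h1 := h.quad_invariant hq (ev_E_single (p := p) (F := F) o m one_ne_zero)
      (ev_E_add_single (F := F) (p := p) (Pi.single o 1) m o)
    have h3 := h.quad_invariant hq (ev_E_single (p := p) (F := F) m o one_ne_zero)
      (ev_E_single (F := F) (p := p) o m two_ne_zero)
    have e1 : ⁅quad p F o, (E (Pi.single m 1) o : W p n F)⁆ =
        (-2 : F) • E (Pi.single o 1 + Pi.single m 1) o := by
      rw [lie_quad, if_pos rfl, add_comm (Pi.single m 1)]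
      simp [Ne.symm hm]
    have e2 : ⁅quad p F o, (E (Pi.single o 1 + Pi.single m 1) o : W p n F)⁆ =
        (-1 : F) • E (Pi.single o 2 + Pi.single m 1) o := by
      rw [lie_quad, if_pos rfl, add_right_comm, ← Pi.single_add]
      simp only [Pi.add_apply, Pi.single_eq_same, Pi.single_eq_of_ne (Ne.symm hm)]
      norm_num
    rw [e1, (mem_radical.1 (hH.linear_mem h hp2 m)).2, LinearMap.zero_apply, add_zero, map_smul,
      LinearMap.smul_apply] at h3
    have h4 := (smul_eq_zero.1 h3).resolve_left (neg_ne_zero.2 h2)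
    rw [hqm, e2, h.skew, h4, neg_zero, zero_add, map_smul] at h1
    rw [hp', (smul_eq_zero.1 h1).resolve_left (by simp)]
    rfl
  have hp5 : 5 ≤ p := by
    have h4 : p ≠ 4 := by
      rintro rfl
      exact absurd (Fact.out : Nat.Prime 4) (by norm_num)
    omega
  have h1 := hH.linear_double_eq h hp2 hq hm hm hm hm
  rw [if_pos rfl, add_assoc, ← Pi.single_add, neg_smul, one_smul, one_add_one_eq_two] at h1
  have h3 : (3 : F) ≠ 0 := by
    exact_mod_cast natCast_ne_zero (p := p) (F := F) (k := 3) (by omega) (by omega)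
  -- The field $x_o^{p-4}x_m^3\partial_m$ is chosen so that this identity reads $3A=3B$; against
  -- $B=3A$ it leaves $6A=0$.
  have hc := congrFun (h.coc _ _ _ (ev_E_single (p := p) (F := F) o m one_ne_zero)
    (ev_E_single (p := p) (F := F) o m two_ne_zero)
    (ev_E_add_single (F := F) (p := p) (Pi.single o (p - 4) + Pi.single m 2) m m)) o
  have s1 : (Pi.single o 1 + (Pi.single o (p - 4) + Pi.single m 2) : Fin n → ℕ) =
      Pi.single o (p - 3) + Pi.single m 2 := by
    rw [← add_assoc, ← Pi.single_add, show 1 + (p - 4) = p - 3 by omega]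
  have s2 : (Pi.single o 2 + (Pi.single o (p - 4) + Pi.single m 2) : Fin n → ℕ) =
      Pi.single o (p - 2) + Pi.single m 2 := by
    rw [← add_assoc, ← Pi.single_add, show 2 + (p - 4) = p - 2 by omega]
  have a1 : ∀ v, act (E (Pi.single o 2) m : W p n F) v = 0 := fun v ↦
    act_E_of_two_le (by rw [sum_single]) _ _
  have a2 : ∀ v, act (E (Pi.single o (p - 4) + Pi.single m 2 + Pi.single m 1) m : W p n F) v = 0 :=
    fun v ↦ act_E_of_two_le (by
      rw [sum_add_single]
      have := Finset.single_le_sum (f := (Pi.single o (p - 4) + Pi.single m 2 : Fin n → ℕ))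
        (fun _ _ ↦ Nat.zero_le _) (Finset.mem_univ m)
      rw [Pi.add_apply, Pi.single_eq_same] at this
      omega) _ _
  have a3 : ∀ v, act (E (Pi.single o 1) m : W p n F) v o = 0 := by
    intro v
    rw [act_E_single, Pi.smul_apply, Pi.single_eq_of_ne (Ne.symm hm), smul_zero]
  rw [a1, a2, lie_eq_zero (by simp [hm]) (by simp [hm]), lie_of_eq_zero (by simp [hm]),
    lie_of_eq_zero (by simp [hm]), s1, s2, h.skew _ (E (Pi.single o 1) m),
    h.skew _ (E (Pi.single o 2) m)] at hc
  have hd := congrFun (h.quad_invariant hq (ev_E_single (p := p) (F := F) o m one_ne_zero)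
    (y := E (Pi.single o 1) m) (z := E (Pi.single o (p - 3) + Pi.single m 2) m)
    (ev_E_of_ne (fun h ↦ by simpa [hm] using congrFun h m) m)) o
  have e3 : ⁅quad p F o, (E (Pi.single o (p - 3) + Pi.single m 2) m : W p n F)⁆ =
      (-3 : F) • E (Pi.single o (p - 2) + Pi.single m 2) m := by
    rw [lie_quad, if_neg (Ne.symm hm), add_right_comm, single_split o (m := 2) (by omega)]
    simp [Ne.symm hm, cast_sub_of_le (F := F) (p := p) (m := 3) (by omega)]
  rw [hqm, e3] at hd
  have h1' := congrFun h1 o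
  simp only [Pi.add_apply, Pi.sub_apply, Pi.neg_apply, map_smul, Pi.smul_apply, smul_eq_mul,
    Pi.zero_apply, a3, map_zero, LinearMap.zero_apply, Pi.single_eq_same,
    Pi.single_eq_of_ne hm] at hc hd h1'
  have key : (6 : F) *
      ω (E (Pi.single o 1) m) (E (Pi.single o (p - 1) + Pi.single m 1) o) o = 0 := by
    push_cast at hc
    linear_combination 6 * h1' + hc + 3 * hd
  have h6 : (6 : F) ≠ 0 := by
    have : (6 : F) = 2 * 3 := by norm_num
    rw [this]
    exact mul_ne_zero h2 h3
  exact (mul_eq_zero.1 key).resolve_left h6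

/-- Only $x_o\partial_m$ with $m\ne o$ is left to treat. The weight equation lists the partners on
which the form could be nonzero, and each is covered by one of the preceding vanishing results. -/
theorem Homog.linear_mem_of_quad (hH : Homog ω (Pi.single o (p : ℤ))) (h : IsCoc ω) (hp2 : p ≠ 2)
    (hq : quad p F o ∈ radical ω) (i m : Fin n) : E (Pi.single i 1) m ∈ radical ω := by
  have hp3 := three_le hp2
  by_cases hm : m = o
  · rw [hm]
    exact hH.linear_mem h hp2 i
  by_cases hi : i ≠ o
  · exact hH.linear_mem_of_ne h hp2 hq hi hm
  push Not at hi
  subst hi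
  refine mem_radical_E h (fun h ↦ by simpa using congrFun h i) m fun a l k ha ha0 ↦ ?_
  by_contra hne
  have hw := hH.wt_eq hne
  have hwo := hw i
  have hao := ha i
  rw [Pi.single_eq_same, if_pos rfl, if_neg (Ne.symm hm)] at hwo
  by_cases hl : l = i
  · subst hl
    rw [if_pos rfl] at hwo
    have hk : k = l := by
      by_contra hk
      rw [if_neg (Ne.symm hk)] at hwo
      omega
    subst hk
    have hae : a = Pi.single k (p - 1) + Pi.single m 1 := by
      funext t
      have := hw t
      simp only [Pi.single_apply, Pi.add_apply] at this ⊢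
      split_ifs at this ⊢ <;> push_cast at this <;> omega
    refine hne ?_
    rw [hae]
    exact hH.linear_self_eq_zero h hp2 hq hm
  · rw [if_neg (Ne.symm hl)] at hwo
    by_cases hk : k = i
    · subst hk
      have hae : a = Pi.single k (p - 2) + Pi.single l 1 + Pi.single m 1 := by
        funext t
        have := hw t
        simp only [Pi.single_apply, Pi.add_apply] at this ⊢
        split_ifs at this ⊢ <;> push_cast at this <;> omega
      refine hne ?_
      rw [hae, hH.linear_double_eq h hp2 hq hm hm hl hl]
      by_cases hlm : l = m
      · subst hlm
        rw [Pi.smul_apply, hH.linear_self_eq_zero h hp2 hq hm, smul_zero]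
      · simp [hlm]
    · rw [if_neg (Ne.symm hk)] at hwo
      have hak : k = m ∨ k = l := by
        by_contra hc
        push Not at hc
        have := hw k
        rw [if_pos rfl, if_neg hc.1, if_neg hc.2, if_neg hk, Pi.single_eq_of_ne hk] at this
        omega
      refine hne ?_
      rcases hak with rfl | rfl
      · have hae : a = Pi.single i (p - 1) + Pi.single l 1 := by
          funext t
          have := hw t
          simp only [Pi.single_apply, Pi.add_apply] at this ⊢
          split_ifs at this ⊢ <;> push_cast at this <;> omega
        rw [hae, hH.linear_top_eq_zero h hp2 hq hm hl hl]
        rfl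
      · have hae : a = Pi.single i (p - 1) + Pi.single m 1 := by
          funext t
          have := hw t
          simp only [Pi.single_apply, Pi.add_apply] at this ⊢
          split_ifs at this ⊢ <;> push_cast at this <;> omega
        rw [hae, hH.linear_top_eq_zero h hp2 hq hm hm hl]
        rfl

/-- In one variable, a cocycle of weight `p` with `x² ∂` in its radical vanishes. -/
theorem Homog.eq_zero_of_unique (hH : Homog ω (Pi.single o (p : ℤ))) (h : IsCoc ω) (hp2 : p ≠ 2)
    (hq : quad p F o ∈ radical ω) (ho : ∀ k, k = o) : ω = 0 := by
  have hp3 := three_le hp2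
  have h2 := two_ne_zero' (p := p) (F := F) hp2
  -- The weight forces the exponents to add up to $p+1$, so one sequence describes the form.
  obtain ⟨f, hf⟩ : ∃ f : ℕ → F, ∀ a, f a =
      ω (E (Pi.single o a) o) (E (Pi.single o (p + 1 - a)) o) o := ⟨_, fun _ ↦ rfl⟩
  have hskew : ∀ a, a ≤ p + 1 → f (p + 1 - a) = - f a := by
    intro a ha
    rw [hf, hf, h.skew, show p + 1 - (p + 1 - a) = a by omega]
    rfl
  have hrec : ∀ a, 1 ≤ a → a < p → ((a : F) - 2) * f (a + 1) = ((a : F) + 2) * f a := by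
    intro a ha1 hap
    have h1 := congrFun (h.quad_invariant hq (ev_E_single (p := p) (F := F) o o (m := a) (by omega))
      (ev_E_single (p := p) (F := F) o o (m := p - a) (by omega))) o
    rw [lie_quad, lie_quad, if_pos rfl, ← Pi.single_add, ← Pi.single_add, Pi.single_eq_same,
      Pi.single_eq_same, cast_sub_of_le hap.le, map_smul, map_smul, LinearMap.smul_apply,
      show p - a + 1 = p + 1 - a by omega] at h1
    rw [hf, hf, show p + 1 - (a + 1) = p - a by omega]
    simp only [Pi.add_apply, Pi.smul_apply, smul_eq_mul, Pi.zero_apply] at h1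
    linear_combination h1
  obtain ⟨c, hc⟩ : ∃ c, p = 2 * c + 1 := by
    rcases (Fact.out : p.Prime).eq_two_or_odd' with h | h
    · exact absurd h hp2
    · exact h
  -- The middle exponent is $(p+1)/2$, where alternation applies. The recursion then propagates the
  -- zero downwards to $a=3$, the factor $a+2$ being invertible in that range. The values at 1 and 2
  -- vanish because $x\partial$ and $x^2\partial$ are in the radical.
  have hmid : f (c + 1) = 0 := by
    rw [hf, show p + 1 - (c + 1) = c + 1 by omega, h.self]
    rfl
  have hdown : ∀ d, d + 3 ≤ c + 1 → f (c + 1 - d) = 0 := by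
    intro d
    induction d with
    | zero => exact fun _ ↦ hmid
    | succ d ih =>
      intro hd
      have h1 := hrec (c + 1 - (d + 1)) (by omega) (by omega)
      rw [show c + 1 - (d + 1) + 1 = c + 1 - d by omega, ih (by omega), mul_zero] at h1
      refine (mul_eq_zero.1 h1.symm).resolve_left ?_
      exact_mod_cast natCast_ne_zero (p := p) (F := F) (k := c + 1 - (d + 1) + 2)
        (by omega) (by omega)
  have hlow : ∀ a, a ≤ c + 1 → 1 ≤ a → f a = 0 := by
    intro a hac ha1
    rcases Nat.lt_or_ge a 3 with h3 | h3
    · rw [hf]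
      interval_cases a
      · rw [(mem_radical.1 (hH.linear_mem h hp2 o)).2]
        rfl
      · have := (mem_radical.1 hq).2
        rw [quad] at this
        rw [this]
        rfl
    · have := hdown (c + 1 - a) (by omega)
      rwa [show c + 1 - (c + 1 - a) = a by omega] at this
  have hall : ∀ a, 1 ≤ a → a < p → f a = 0 := by
    intro a ha1 hap
    rcases Nat.lt_or_ge (c + 1) a with h3 | h3
    · have := hskew a (by omega)
      rw [hlow (p + 1 - a) (by omega) (by omega)] at this
      exact neg_eq_zero.1 this.symm
    · exact hlow a h3 ha1
  have hsing : ∀ a : Fin n → ℕ, a = Pi.single o (a o) := by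
    intro a
    funext t
    rw [ho t, Pi.single_eq_same]
  refine eq_zero_of_radical h fun a j ha ha0 ↦ mem_radical_E h ha0 j fun b l k hb hb0 ↦ ?_
  by_contra hne
  obtain rfl := ho j
  obtain rfl := ho l
  obtain rfl := ho k
  have hw := hH.wt_eq hne k
  rw [if_pos rfl, if_pos rfl] at hw
  have ha1 : 1 ≤ a k := by
    rw [Nat.one_le_iff_ne_zero]
    intro h0
    exact ha0 (by rw [hsing a, h0, Pi.single_zero])
  have hbk : b k = p + 1 - a k := by omega
  refine hne ?_
  rw [hsing a, hsing b, hbk, ← hf]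
  exact hall _ ha1 (ha k)

/-- A cocycle of weight `p` in one coordinate vanishes once the coefficients detected by `Sq(∂_o)`
and by the differentials of cochains do. -/
theorem Homog.eq_zero_of_one (hH : Homog ω (Pi.single o (p : ℤ))) (h : IsCoc ω) (hp2 : p ≠ 2)
    (hη : ∀ j, j ≠ o → ω (quad p F o) (E (Pi.single o (p - 2) + Pi.single j 1) j) o = 0)
    (hc : ∃ j, (j ≠ o ∨ ∀ k, k = o) ∧ ω (quad p F o) (E (Pi.single o (p - 1)) j) j = 0) :
    ω = 0 := by
  have hq := hH.quad_mem h hp2 hη hc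
  by_cases ho : ∀ k, k = o
  · exact hH.eq_zero_of_unique h hp2 hq ho
  · push Not at ho
    obtain ⟨g, hg⟩ := ho
    exact radical_eq_of_generators h hp2 (Ne.symm hg) (hH.linear_mem_of_quad h hp2 hq) hq

end WeightOneVanishing

/-! ### Exactness criterion for cocycles of the isotropy subalgebra. -/

section Exactness

variable {p n : ℕ} {F : Type*} [Field F] [CharP F p] [Fact p.Prime]

theorem exists_coefficient_ne_zero {ω : TangentForm p n F} (h : IsCoc ω) (h0 : ω ≠ 0) :
    ∃ a j b l k, (∀ i, a i < p) ∧ a ≠ 0 ∧ (∀ i, b i < p) ∧ b ≠ 0 ∧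
      ω (E a j) (E b l) k ≠ 0 := by
  by_contra hc
  push Not at hc
  exact h0 (eq_zero_of_radical h fun a j ha ha0 ↦ mem_radical_E h ha0 j fun b l k hb hb0 ↦
    hc a j b l k ha ha0 hb hb0)

/-- Each coordinate lies between $-2$ and $2p-1$ and is divisible by $p\ge3$. -/
theorem wt_eq_zero_or_eq (hp2 : p ≠ 2) {a b : Fin n → ℕ} {j l k : Fin n} {lam : Fin n → ℤ}
    (ha : ∀ i, a i < p) (hb : ∀ i, b i < p) (hw : wt a j b l k = lam)
    (hl : ∀ i, (lam i : F) = 0) (t : Fin n) : lam t = 0 ∨ lam t = p := by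
  have hp3 := three_le hp2
  obtain ⟨c, hc⟩ := (CharP.intCast_eq_zero_iff F p _).1 (hl t)
  have h1 := congrFun hw t
  have h2 := ha t
  have h3 := hb t
  have hlo : -2 ≤ lam t := by
    rw [← h1, wt]
    split_ifs <;> omega
  have hhi : lam t < 2 * p := by
    rw [← h1, wt]
    split_ifs <;> omega
  have hc0 : 0 ≤ c := by
    by_contra hneg
    have : (p : ℤ) * c ≤ p * (-1) := mul_le_mul_of_nonneg_left (by omega) (by omega)
    omega
  have hc1 : c ≤ 1 := by
    by_contra hneg
    have : (p : ℤ) * 2 ≤ p * c := mul_le_mul_of_nonneg_left (by omega) (by omega)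
    omega
  interval_cases c
  · exact Or.inl (by simpa using hc)
  · exact Or.inr (by simpa using hc)

/-- The coordinates of the weight add up to $|a|+|b|-1\ge1$. -/
theorem wt_ne_zero {a b : Fin n → ℕ} {j l k : Fin n} (ha : a ≠ 0) (hb : b ≠ 0) :
    wt a j b l k ≠ 0 := by
  intro h
  have hpos : ∀ c : Fin n → ℕ, c ≠ 0 → 1 ≤ ∑ i, (c i : ℤ) := by
    intro c hc
    have : ∑ i, c i ≠ 0 := fun h0 ↦ hc (by
      funext i
      exact (Finset.sum_eq_zero_iff.1 h0) i (Finset.mem_univ i))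
    have h1 : 1 ≤ ∑ i, c i := Nat.one_le_iff_ne_zero.2 this
    exact_mod_cast h1
  have hs : ∑ t, wt a j b l k t = 0 := by rw [h]; simp
  simp only [wt, Finset.sum_sub_distrib, Finset.sum_add_distrib, Finset.sum_ite_eq',
    Finset.mem_univ, if_true] at hs
  have := hpos a ha
  have := hpos b hb
  omega

/-- A form is exact once the coefficients detected by the classes `Sq(∂_i)`, and those that
differentials can remove, vanish. -/
theorem IsCoc.isExact {ω : TangentForm p n F} (h : IsCoc ω) (hp2 : p ≠ 2)
    (hη : ∀ i j, j ≠ i → ω (quad p F i) (E (Pi.single i (p - 2) + Pi.single j 1) j) i = 0)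
    (hc : ∀ i, ∃ j, (j ≠ i ∨ ∀ k, k = i) ∧ ω (quad p F i) (E (Pi.single i (p - 1)) j) j = 0) :
    IsExact ω := by
  obtain ⟨S, hS⟩ := exists_sum_comp ω
  rw [hS]
  refine isExact_sum S fun lam _ ↦ ?_
  have hcomp := h.comp hp2 lam
  have hhom := homog_comp lam ω
  by_cases hl : ∃ i, (lam i : F) ≠ 0
  · obtain ⟨i, hi⟩ := hl
    exact hhom.isExact hcomp hi
  push Not at hl
  have hcoef : ∀ a j b l k, ω (E a j) (E b l) k = 0 →
      WittJacobson.comp lam ω (E a j) (E b l) k = 0 := by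
    intro a j b l k h0
    rw [comp_E, h0, ite_self]
  suffices WittJacobson.comp lam ω = 0 by rw [this]; exact isExact_zero
  by_contra hne
  obtain ⟨a, j, b, l, k, ha, ha0, hb, hb0, hv⟩ := exists_coefficient_ne_zero hcomp hne
  have hw := hhom a j b l k hv
  have hor := wt_eq_zero_or_eq hp2 ha hb hw hl
  obtain ⟨o, ho⟩ : ∃ o, lam o = p := by
    by_contra hno
    push Not at hno
    refine wt_ne_zero (j := j) (l := l) (k := k) ha0 hb0 ?_
    rw [hw]
    funext t
    exact (hor t).resolve_right (hno t)
  by_cases ht : ∃ t, t ≠ o ∧ lam t = p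
  · obtain ⟨t, hto, ht⟩ := ht
    exact hne (hhom.eq_zero_of_two hcomp hp2 hto ht ho)
  · push Not at ht
    have hlam : lam = Pi.single o (p : ℤ) := by
      funext t
      by_cases hto : t = o
      · rw [hto, ho, Pi.single_eq_same]
      · rw [Pi.single_eq_of_ne hto]
        exact (hor t).resolve_right (ht t hto)
    have hhom' : Homog (WittJacobson.comp lam ω) (Pi.single o (p : ℤ)) := by
      rw [← hlam]
      exact hhom
    refine hne (hhom'.eq_zero_of_one hcomp hp2 (fun j hj ↦ ?_) ?_)
    · exact hcoef _ _ _ _ _ (hη o j hj)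
    · obtain ⟨j, hj, hj0⟩ := hc o
      exact ⟨j, hj, hcoef _ _ _ _ _ hj0⟩

end Exactness

/-! ### From cocycles of `W(n)` to cocycles of the isotropy subalgebra and back. -/

section Tangent

/-- The 2-cocycles with values in the adjoint representation. -/
abbrev Coc (F L : Type*) [Field F] [LieRing L] [LieAlgebra F L] : Submodule F (twoCochain F L L) :=
  twoCocycle F L L

/-- The 2-coboundaries with values in the adjoint representation. -/
abbrev Bound (F L : Type*) [Field F] [LieRing L] [LieAlgebra F L] : Submodule F (Coc F L) :=
  twoCoboundary F L L

/-- Evaluation of 2-cocycles at a pair. -/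
def evalPair {F L : Type*} [Field F] [LieRing L] [LieAlgebra F L] (x y : L) :
    twoCocycle F L L →ₗ[F] L where
  toFun φ := φ.1 x y
  map_add' _ _ := rfl
  map_smul' _ _ := rfl

variable {p n : ℕ} {F : Type*} [Field F] [CharP F p] [Fact p.Prime]

/-- The value at the origin of a 2-cocycle. -/
def tangent (φ : Coc F (W p n F)) : TangentForm p n F := φ.1.1.compr₂ ev

theorem tangent_apply (φ : Coc F (W p n F)) (x y : W p n F) :
    tangent φ x y = ev (φ.1 x y) := rfl

theorem tangent_sub (φ χ : Coc F (W p n F)) (x y : W p n F) :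
    tangent (φ - χ) x y = tangent φ x y - tangent χ x y := by
  simp only [tangent_apply]
  exact map_sub ev _ _

/-- Cocycles that vanish on the constant vector fields. -/
def normalised (p n : ℕ) (F : Type*) [Field F] [CharP F p] :
    Submodule F (Coc F (W p n F)) where
  carrier := {φ | ∀ i y, φ.1 (D p F i) y = 0}
  add_mem' {a b} ha hb i y := by
    show a.1 (D p F i) y + b.1 (D p F i) y = 0
    rw [ha, hb, add_zero]
  zero_mem' _ _ := rfl
  smul_mem' c a ha i y := by
    show c • a.1 (D p F i) y = 0
    rw [ha, smul_zero]

theorem isCoc_tangent {φ : Coc F (W p n F)} (hφ : φ ∈ normalised p n F) :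
    IsCoc (tangent φ) where
  self x := by
    rw [tangent_apply, show φ.1 x x = 0 from φ.1.2 x, map_zero]
  constant i := LinearMap.ext fun y ↦ by
    rw [tangent_apply, hφ i y, map_zero]
    rfl
  coc x y z hx hy hz := by
    have := congrArg ev (cocycle_identity φ x y z)
    simp only [map_sub, map_add, map_zero, ev_lie hx, ev_lie hy, ev_lie hz] at this
    exact this

/-- A cocycle that vanishes on the constant fields and has vanishing value at the origin is
zero. -/
theorem bilin_eq_zero_of_ev {Φ : W p n F →ₗ[F] W p n F →ₗ[F] W p n F}
    (hskew : ∀ x y, Φ x y = - Φ y x) (hD : ∀ i, Φ (D p F i) = 0)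
    (hcoc : ∀ x y z, ⁅x, Φ y z⁆ - ⁅y, Φ x z⁆ + ⁅z, Φ x y⁆ - Φ ⁅x, y⁆ z + Φ ⁅x, z⁆ y
      - Φ ⁅y, z⁆ x = 0) (h : ∀ x y, ev (Φ x y) = 0) (x y : W p n F) : Φ x y = 0 := by
  -- Vanishing on the constant fields turns the cocycle identity into equivariance under
  -- $\partial_i$, so the span of all values is stable and `eq_zero_of_stable` applies.
  have hlie : ∀ i u v, ⁅(D p F i : W p n F), Φ u v⁆ =
      Φ ⁅(D p F i : W p n F), u⁆ v - Φ ⁅(D p F i : W p n F), v⁆ u := by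
    intro i u v
    have h1 := hcoc (D p F i) u v
    rw [hskew ⁅u, v⁆, hD] at h1
    simp only [LinearMap.zero_apply, lie_zero, neg_zero, sub_zero, add_zero] at h1
    rw [← sub_eq_zero, ← h1]
    abel
  refine eq_zero_of_stable
    (Submodule.span F {d | ∃ x y, d = Φ x y}) (fun i d hd ↦ ?_) (fun d hd ↦ ?_)
    (Submodule.subset_span ⟨x, y, rfl⟩)
  · induction hd using Submodule.span_induction with
    | mem d hd =>
      obtain ⟨u, v, rfl⟩ := hd
      rw [hlie]
      exact Submodule.sub_mem _ (Submodule.subset_span ⟨_, _, rfl⟩)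
        (Submodule.subset_span ⟨_, _, rfl⟩)
    | zero => rw [lie_zero]; exact zero_mem _
    | add u v _ _ hu hv => rw [lie_add]; exact add_mem hu hv
    | smul c u _ hu => rw [lie_smul]; exact Submodule.smul_mem _ c hu
  · induction hd using Submodule.span_induction with
    | mem d hd =>
      obtain ⟨u, v, rfl⟩ := hd
      exact h u v
    | zero => exact map_zero ev
    | add u v _ _ hu hv => rw [map_add, hu, hv, add_zero]
    | smul c u _ hu => rw [map_smul, hu, smul_zero]

theorem eq_zero_of_tangent {φ : Coc F (W p n F)} (hφ : φ ∈ normalised p n F)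
    (h : tangent φ = 0) : φ = 0 := by
  have key : ∀ x y, φ.1.1 x y = 0 := bilin_eq_zero_of_ev
    (fun x y ↦ (twoCochain_skew φ.1 y x).symm) (fun i ↦ LinearMap.ext (hφ i))
    (cocycle_identity φ) fun x y ↦ LinearMap.congr_fun (LinearMap.congr_fun h x) y
  exact Subtype.ext (Subtype.ext (LinearMap.ext fun x ↦ LinearMap.ext fun y ↦ key x y))

/-- Differentials of cochains of the isotropy subalgebra lift to coboundaries. -/
theorem exists_coboundary_tangent (η : W p n F →ₗ[F] (Fin n → F)) (hη : ∀ i, η (D p F i) = 0) :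
    ∃ ψ, coboundary F (W p n F) ψ ∈ normalised p n F ∧ ∀ x y, ev x = 0 → ev y = 0 →
      tangent (coboundary F (W p n F) ψ) x y = act x (η y) - act y (η x) - η ⁅x, y⁆ := by
  obtain ⟨ψ, h1, h2, h3⟩ := exists_equivariant_lift η hη
  refine ⟨ψ, fun i y ↦ ?_, fun x y hx hy ↦ ?_⟩
  · rw [coboundary_apply, dOne, h1, h3, lie_zero, sub_zero, sub_self]
  · rw [tangent_apply, coboundary_apply, dOne, map_sub, map_sub, ev_lie hx, ev_lie hy, h2, h2, h2]

/-- A normalised cocycle with exact value at the origin is a coboundary. -/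
theorem mem_twoCoboundary_of_isExact {φ : Coc F (W p n F)}
    (hφ : φ ∈ normalised p n F) (h : IsExact (tangent φ)) :
    φ ∈ Bound F (W p n F) := by
  obtain ⟨η, h1, h2⟩ := h
  obtain ⟨ψ, h3, h4⟩ := exists_coboundary_tangent η h1
  have hn := Submodule.sub_mem _ hφ h3
  have hcoc := isCoc_tangent hn
  have : φ - coboundary F (W p n F) ψ = 0 := by
    refine eq_zero_of_tangent hn (eq_zero_of_radical hcoc fun a j _ ha ↦
      mem_radical_E hcoc ha j fun b l k _ hb ↦ ?_)
    rw [tangent_sub, h2 _ _ (ev_E_of_ne ha j) (ev_E_of_ne hb l),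
      h4 _ _ (ev_E_of_ne ha j) (ev_E_of_ne hb l), sub_self]
    rfl
  rw [sub_eq_zero.1 this]
  exact coboundary_mem ψ

theorem act_top_eq_zero (hp2 : p ≠ 2) (i j : Fin n) (v : Fin n → F) :
    act (E (Pi.single i (p - 1)) j : W p n F) v = 0 := by
  have := three_le hp2
  exact act_E_of_two_le (by rw [sum_single]; omega) _ _

/-- Coboundaries vanish to first order on the pairs `(x_i² ∂_i, x_i^(p-1) ∂_j)`. -/
theorem tangent_coboundary_quad_top (hp2 : p ≠ 2) (ψ : W p n F →ₗ[F] W p n F) (i j : Fin n) :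
    tangent (coboundary F (W p n F) ψ) (quad p F i) (E (Pi.single i (p - 1)) j) = 0 := by
  have := three_le hp2
  rw [tangent_apply, coboundary_apply, dOne, lie_quad_top, map_zero, sub_zero, map_sub,
    ev_lie (ev_quad i), ev_lie (ev_E_single i j (m := p - 1) (by omega)), act_quad,
    act_top_eq_zero hp2, sub_zero]

end Tangent

/-! ### The classes of $\mathrm{Sq}(\partial_i)$ and the computation of the second cohomology. -/

section SquareClasses

theorem single_sub_single {ι : Type*} [DecidableEq ι] (i : ι) (s t : ℕ) :
    (Pi.single i s - Pi.single i t : ι → ℕ) = Pi.single i (s - t) := by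
  funext u
  simp only [Pi.sub_apply, Pi.single_apply]
  split_ifs <;> rfl

variable {p n : ℕ} {F : Type*} [Field F] [CharP F p] [Fact p.Prime]

variable (p F) in
/-- The cocycle `Sq(∂_i)`. -/
def sqD (i : Fin n) : Coc F (W p n F) :=
  Sq p (LieDerivation.ad F (W p n F) (D p F i))

theorem sqD_apply (i : Fin n) (a : Fin n → ℕ) (j : Fin n) (b : Fin n → ℕ) (l : Fin n) :
    (sqD p F i).1 (E a j) (E b l) = ∑ k ∈ Finset.Icc 1 (p - 1),
      ((k.factorial : F) * ((p - k).factorial : F))⁻¹ •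
        ⁅((a i).descFactorial k : F) • (E (a - Pi.single i k) j : W p n F),
          ((b i).descFactorial (p - k) : F) • (E (b - Pi.single i (p - k)) l : W p n F)⁆ := by
  have e : ((LieDerivation.ad F (W p n F) (D p F i) : LieDerivation F (W p n F) (W p n F)) :
      W p n F →ₗ[F] W p n F) = LieModule.toEnd F (W p n F) (W p n F) (D p F i) :=
    LinearMap.ext fun y ↦ LieDerivation.coe_ad_apply_eq_ad_apply (R := F) (D p F i) ▸ rfl
  refine (sqCochain_apply p _ _ _).trans (Finset.sum_congr rfl fun k _ ↦ ?_)
  rw [e, ad_D_pow_E, ad_D_pow_E]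

theorem sqD_eq_zero (i : Fin n) {a : Fin n → ℕ} (ha : a i = 0) (j : Fin n) :
    (sqD p F i).1 (E a j) = 0 := by
  refine hom_ext_E fun b l _ ↦ ?_
  rw [sqD_apply]
  refine Finset.sum_eq_zero fun k hk ↦ ?_
  rw [ha, Nat.descFactorial_of_lt (Finset.mem_Icc.1 hk).1]
  simp

theorem sqD_mem_normalised (i : Fin n) : sqD p F i ∈ normalised p n F := by
  intro j y
  rw [← E_zero, sqD_eq_zero i (by simp)]
  rfl

theorem sqD_quad_of_ne {i j : Fin n} (h : i ≠ j) : (sqD p F i).1 (quad p F j) = 0 :=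
  sqD_eq_zero i (by simp [h]) j

/-- Since $\partial_i^3$ kills $x_i^2\partial_i$, only the terms $k=1,2$ contribute. The first gives
$2[x_i\partial_i,\partial_j]$, that is $-2\partial_j$ if $i=j$ and $0$ otherwise; the second gives
$-\partial_j$, because $(p-1)!=-(p-2)!$. -/
theorem sqD_quad_top (hp2 : p ≠ 2) (i j : Fin n) :
    (sqD p F i).1 (quad p F i) (E (Pi.single i (p - 1)) j) =
      (-(if i = j then 3 else 1) : F) • D p F j := by
  have hp3 := three_le hp2
  rw [quad, sqD_apply]
  have hsub : ({1, 2} : Finset ℕ) ⊆ Finset.Icc 1 (p - 1) := by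
    intro k hk
    simp only [Finset.mem_insert, Finset.mem_singleton] at hk
    rw [Finset.mem_Icc]
    omega
  rw [← Finset.sum_subset hsub, Finset.sum_pair (by norm_num)]
  · have f1 : ((p - 1).factorial : F) ≠ 0 := factorial_ne_zero p (by omega)
    have f2 : ((p - 2).factorial : F) ≠ 0 := factorial_ne_zero p (by omega)
    have f3 : ((p - 1).factorial : F) = -((p - 2).factorial : F) := by
      have : (p - 1).factorial = (p - 1) * (p - 2).factorial := by
        rw [← Nat.mul_factorial_pred (by omega : p - 1 ≠ 0), Nat.sub_sub]
      rw [this, Nat.cast_mul, cast_sub_of_le (by omega)]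
      simp
    have d1 : (p - 1).descFactorial (p - 1) = (p - 1).factorial := Nat.descFactorial_self _
    have d2 : (p - 1).descFactorial (p - 2) = (p - 1).factorial := by
      have := Nat.factorial_mul_descFactorial (n := p - 1) (k := p - 2) (by omega)
      rw [show p - 1 - (p - 2) = 1 by omega] at this
      simpa using this
    have e1 : (Pi.single i 2 - Pi.single i 1 : Fin n → ℕ) = Pi.single i 1 := by
      rw [single_sub_single]
    have e2 : (Pi.single i (p - 1) - Pi.single i (p - 2) : Fin n → ℕ) = Pi.single i 1 := by
      rw [single_sub_single, show p - 1 - (p - 2) = 1 by omega]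
    have b1 : ⁅(E (Pi.single i 1) i : W p n F), (D p F j : W p n F)⁆ =
        (-(if i = j then 1 else 0) : F) • D p F j := by
      rw [← lie_skew, lie_E_single, neg_smul]
      by_cases hij : i = j
      · subst hij; simp [E_zero]
      · simp [hij, Ne.symm hij]
    have b2 : ⁅(D p F i : W p n F), (E (Pi.single i 1) j : W p n F)⁆ = D p F j := by
      rw [lie_E_single]; simp [E_zero]
    simp only [Pi.single_eq_same, d1, d2, e1, e2, tsub_self, E_zero, smul_lie, lie_smul, b1, b2,
      smul_smul]
    rw [← add_smul]
    congr 1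
    simp only [Nat.factorial, Nat.descFactorial]
    rw [f3]
    have h2 := two_ne_zero' (p := p) (F := F) hp2
    by_cases hij : i = j
    · simp only [hij, if_true]
      field_simp
      norm_num [div_eq_iff h2]
    · simp only [hij, if_false]
      field_simp
      norm_num [div_eq_iff h2]
  · intro k hk hk'
    simp only [Finset.mem_insert, Finset.mem_singleton] at hk'
    rw [Finset.mem_Icc] at hk
    rw [Pi.single_eq_same, Nat.descFactorial_of_lt (by omega)]
    simp

theorem tangent_sum_sqD (hp2 : p ≠ 2) (c : Fin n → F) (i j : Fin n) :
    tangent (∑ t, c t • sqD p F t) (quad p F i) (E (Pi.single i (p - 1)) j) j =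
      -(c i * if i = j then 3 else 1) := by
  have : (∑ t, c t • sqD p F t).1 (quad p F i) (E (Pi.single i (p - 1)) j) =
      ∑ t, c t • (sqD p F t).1 (quad p F i) (E (Pi.single i (p - 1)) j) := by
    have := map_sum (evalPair (quad p F i) (E (Pi.single i (p - 1)) j : W p n F))
      (fun t ↦ c t • sqD p F t) Finset.univ
    simp only [map_smul] at this
    exact this
  rw [tangent_apply, this, Finset.sum_eq_single_of_mem i (Finset.mem_univ i), sqD_quad_top hp2,
    map_smul, map_smul, ev_D]
  · simp only [Pi.smul_apply, Pi.single_eq_same, smul_eq_mul, mul_one, mul_neg]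
  · intro t _ ht
    rw [sqD_quad_of_ne ht]
    simp

/-- An index $j\ne i$ is preferred because the scalar to invert is then `1`; the scalar `3` is met
only when there is a single variable. -/
theorem exists_test_index (i : Fin n) : ∃ j, j ≠ i ∨ ∀ k, k = i := by
  by_cases h : ∀ k, k = i
  · exact ⟨i, Or.inr h⟩
  · push Not at h
    obtain ⟨j, hj⟩ := h
    exact ⟨j, Or.inl hj⟩

theorem test_scalar_ne_zero (hp2 : p ≠ 2) (hnp : ¬ (n = 1 ∧ p = 3)) {i j : Fin n}
    (hj : j ≠ i ∨ ∀ k, k = i) : (if i = j then 3 else 1 : F) ≠ 0 := by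
  have hp3 := three_le hp2
  by_cases hij : i = j
  · rw [if_pos hij]
    have hall := hj.resolve_left (fun h ↦ h hij.symm)
    have hn : n = 1 := by
      have : Fintype.card (Fin n) = 1 := Fintype.card_eq_one_iff.2 ⟨i, hall⟩
      simpa using this
    have : p ≠ 3 := fun h ↦ hnp ⟨hn, h⟩
    exact_mod_cast natCast_ne_zero (p := p) (F := F) (k := 3) (by omega) (by omega)
  · rw [if_neg hij]
    exact one_ne_zero

/-- A cochain whose differential has prescribed coefficients on the pairs
`(x_i² ∂_i, x_i^(p-2) x_j ∂_j)`. -/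
theorem exists_correction (hp2 : p ≠ 2) (κ : Fin n → Fin n → F) :
    ∃ η : W p n F →ₗ[F] (Fin n → F), (∀ i, η (D p F i) = 0) ∧
      ∀ i j, j ≠ i → η (E (Pi.single i (p - 1) + Pi.single j 1) j) i = κ i j := by
  have hp3 := three_le hp2
  refine ⟨LinearMap.pi fun k ↦ ∑ j, if j = k then 0 else
    κ k j • coefW (Pi.single k (p - 1) + Pi.single j 1) j, fun i ↦ ?_, fun i j hij ↦ ?_⟩
  · ext k
    rw [LinearMap.pi_apply, LinearMap.sum_apply]
    refine Finset.sum_eq_zero fun j _ ↦ ?_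
    by_cases hjk : j = k
    · rw [if_pos hjk]; rfl
    · rw [if_neg hjk, LinearMap.smul_apply, ← E_zero, coefW_E, if_neg, smul_zero]
      · rintro ⟨h, -⟩
        have := congrFun h j
        simp at this
      · intro t
        simp only [Pi.add_apply, Pi.single_apply]
        split_ifs <;> omega
  · rw [LinearMap.pi_apply, LinearMap.sum_apply,
      Finset.sum_eq_single_of_mem j (Finset.mem_univ j), if_neg hij, LinearMap.smul_apply, coefW_E,
      if_pos ⟨rfl, rfl⟩, smul_eq_mul, mul_one]
    · intro t
      simp only [Pi.add_apply, Pi.single_apply]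
      split_ifs <;> omega
    · intro l _ hl
      by_cases hli : l = i
      · rw [if_pos hli]; rfl
      · rw [if_neg hli, LinearMap.smul_apply, coefW_E, if_neg fun h ↦ hl h.2.symm, smul_zero]
        intro t
        simp only [Pi.add_apply, Pi.single_apply]
        split_ifs <;> omega

/-- A normalised cocycle is a coboundary if the coefficients detecting `Sq(∂_i)` vanish. -/
theorem mem_twoCoboundary_of_test (hp2 : p ≠ 2) {φ : Coc F (W p n F)}
    (hφ : φ ∈ normalised p n F) (hc : ∀ i, ∃ j, (j ≠ i ∨ ∀ k, k = i) ∧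
      tangent φ (quad p F i) (E (Pi.single i (p - 1)) j) j = 0) :
    φ ∈ Bound F (W p n F) := by
  have hp3 := three_le hp2
  have h2 := two_ne_zero' (p := p) (F := F) hp2
  -- The factor $2^{-1}$ compensates
  -- $[x_i^2\partial_i,x_i^{p-2}x_j\partial_j]=-2x_i^{p-1}x_j\partial_j$: at this pair the
  -- differential of $\eta$ is $2\eta(x_i^{p-1}x_j\partial_j)$.
  obtain ⟨η, hη, hη'⟩ := exists_correction (p := p) (F := F) hp2 fun i j ↦ 2⁻¹ *
    tangent φ (quad p F i) (E (Pi.single i (p - 2) + Pi.single j 1) j) i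
  obtain ⟨ψ, hψ, hψ'⟩ := exists_coboundary_tangent η hη
  have hn := Submodule.sub_mem _ hφ hψ
  have key : φ - coboundary F (W p n F) ψ ∈ Bound F (W p n F) := by
    refine mem_twoCoboundary_of_isExact hn ((isCoc_tangent hn).isExact hp2 (fun i j hij ↦ ?_)
      fun i ↦ ?_)
    · have hact : ∀ v, act (E (Pi.single i (p - 2) + Pi.single j 1) j : W p n F) v = 0 := fun v ↦
        act_E_of_two_le (by rw [sum_add_single, sum_single]; omega) _ _
      rw [tangent_sub, hψ' _ _ (ev_quad i) (ev_E_add_single _ _ _), act_quad, hact,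
        quad_lie_top hij, map_smul]
      simp only [Pi.sub_apply, Pi.smul_apply, hη' i j hij, Pi.zero_apply, smul_eq_mul]
      field_simp
      ring
    · obtain ⟨j, hj, hj'⟩ := hc i
      refine ⟨j, hj, ?_⟩
      rw [tangent_sub, tangent_coboundary_quad_top hp2, sub_zero, hj']
  exact (Submodule.sub_mem_iff_left _ (coboundary_mem ψ)).1 key

theorem exists_sub_mem_of_normalised (hp2 : p ≠ 2) {φ : Coc F (W p n F)}
    (hφ : φ ∈ normalised p n F) : ∃ c : Fin n → F, (n = 1 ∧ p = 3 → c = 0) ∧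
      φ - ∑ i, c i • sqD p F i ∈ Bound F (W p n F) := by
  have hp3 := three_le hp2
  choose τ hτ using fun i : Fin n ↦ exists_test_index i
  obtain ⟨c, hc0, hc⟩ : ∃ c : Fin n → F, (n = 1 ∧ p = 3 → c = 0) ∧ ∀ i,
      tangent φ (quad p F i) (E (Pi.single i (p - 1)) (τ i)) (τ i) =
        -(c i * if i = τ i then 3 else 1) := by
    -- In the exceptional case $x^{p-1}\partial=x^2\partial$, so the test coefficient vanishes by
    -- alternation and no $\mathrm{Sq}(\partial_i)$ is needed.
    by_cases hnp : n = 1 ∧ p = 3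
    · refine ⟨0, fun _ ↦ rfl, fun i ↦ ?_⟩
      have hi : τ i = i := by
        obtain ⟨rfl, -⟩ := hnp
        exact Subsingleton.elim _ _
      have e : (E (Pi.single i (p - 1)) i : W p n F) = quad p F i := by
        rw [show p - 1 = 2 by omega, quad]
      rw [hi, e, (isCoc_tangent hφ).self]
      simp
    · refine ⟨fun i ↦ -(tangent φ (quad p F i)
        (E (Pi.single i (p - 1)) (τ i)) (τ i) / if i = τ i then 3 else 1),
        fun h ↦ absurd h hnp, fun i ↦ ?_⟩
      rw [neg_mul, neg_neg, div_mul_cancel₀ _ (test_scalar_ne_zero hp2 hnp (hτ i))]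
  refine ⟨c, hc0, mem_twoCoboundary_of_test hp2 (Submodule.sub_mem _ hφ
    (Submodule.sum_mem _ fun i _ ↦ Submodule.smul_mem _ _ (sqD_mem_normalised i)))
    fun i ↦ ⟨τ i, hτ i, ?_⟩⟩
  rw [tangent_sub, Pi.sub_apply, hc, tangent_sum_sqD hp2, sub_self]

/-- Every cocycle is cohomologous to a combination of the `Sq(∂_i)`. -/
theorem exists_sub_mem_twoCoboundary (hp2 : p ≠ 2) (φ : Coc F (W p n F)) :
    ∃ c : Fin n → F, (n = 1 ∧ p = 3 → c = 0) ∧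
      φ - ∑ i, c i • sqD p F i ∈ Bound F (W p n F) := by
  obtain ⟨ψ, hψ⟩ := exists_normalise hp2 φ
  have hn : φ - coboundary F (W p n F) ψ ∈ normalised p n F := fun i y ↦ by
    show φ.1 _ _ - (coboundary F (W p n F) ψ).1 _ _ = 0
    rw [coboundary_apply, hψ, sub_self]
  obtain ⟨c, hc0, hc⟩ := exists_sub_mem_of_normalised hp2 hn
  refine ⟨c, hc0, (Submodule.sub_mem_iff_left _ (coboundary_mem ψ)).1 ?_⟩
  rwa [sub_right_comm]

theorem linearIndependent_mkQ {R M ι : Type*} [Fintype ι] [Ring R] [AddCommGroup M] [Module R M]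
    {N : Submodule R M} {v : ι → M} (h : ∀ c : ι → R, ∑ i, c i • v i ∈ N → c = 0) :
    LinearIndependent R fun i ↦ N.mkQ (v i) := by
  rw [Fintype.linearIndependent_iff]
  intro c hc i
  have h0 : N.mkQ (∑ i, c i • v i) = 0 := by
    rw [map_sum, ← hc]
    exact Finset.sum_congr rfl fun i _ ↦ map_smul _ _ _
  rw [Submodule.mkQ_apply, Submodule.Quotient.mk_eq_zero] at h0
  exact congrFun (h c h0) i

theorem span_mkQ {R M ι : Type*} [Fintype ι] [Ring R] [AddCommGroup M] [Module R M]
    {N : Submodule R M} {v : ι → M} (h : ∀ x, ∃ c : ι → R, x - ∑ i, c i • v i ∈ N) :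
    Submodule.span R (Set.range fun i ↦ N.mkQ (v i)) = ⊤ := by
  rw [eq_top_iff]
  rintro x -
  obtain ⟨x, rfl⟩ := Submodule.mkQ_surjective _ x
  obtain ⟨c, hc⟩ := h x
  have : N.mkQ x = ∑ i, c i • N.mkQ (v i) := by
    simp only [← map_smul, ← map_sum]
    rw [← sub_eq_zero, ← map_sub, Submodule.mkQ_apply, Submodule.Quotient.mk_eq_zero]
    exact hc
  rw [this]
  exact Submodule.sum_mem _ fun i _ ↦ Submodule.smul_mem _ _ (Submodule.subset_span ⟨i, rfl⟩)

/-- The test coefficient at place `i` vanishes on coboundaries and on $\mathrm{Sq}(\partial_t)$ for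
$t\ne i$, but not on $\mathrm{Sq}(\partial_i)$. -/
theorem linearIndependent_sqClass (hp2 : p ≠ 2) (hnp : ¬ (n = 1 ∧ p = 3)) :
    LinearIndependent F (fun i : Fin n ↦ sqClass p F i) := by
  refine linearIndependent_mkQ (v := fun i : Fin n ↦ sqD p F i) fun c hc ↦ ?_
  obtain ⟨ψ, hψ⟩ := hc
  have hψ' : coboundary F (W p n F) ψ = ∑ i, c i • sqD p F i := Subtype.ext hψ
  funext i
  obtain ⟨j, hj⟩ := exists_test_index i
  have h1 := tangent_sum_sqD hp2 c i j
  rw [← hψ', tangent_coboundary_quad_top hp2, Pi.zero_apply, eq_comm, neg_eq_zero] at h1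
  exact (mul_eq_zero.1 h1).resolve_right (test_scalar_ne_zero hp2 hnp hj)

theorem span_sqClass (hp2 : p ≠ 2) :
    Submodule.span F (Set.range fun i : Fin n ↦ sqClass p F i) = ⊤ :=
  span_mkQ (v := fun i : Fin n ↦ sqD p F i) fun φ ↦
    (exists_sub_mem_twoCoboundary hp2 φ).imp fun _ h ↦ h.2

theorem rank_H2 (hp2 : p ≠ 2) (hnp : ¬ (n = 1 ∧ p = 3)) :
    Module.rank F (H2 F (W p n F) (W p n F)) = n := by
  rw [rank_eq_card_basis (Module.Basis.mk (linearIndependent_sqClass (F := F) hp2 hnp)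
    (span_sqClass hp2).ge), Fintype.card_fin]

theorem subsingleton_H2 (hp2 : p ≠ 2) (hnp : n = 1 ∧ p = 3) :
    Subsingleton (H2 F (W p n F) (W p n F)) := by
  rw [Submodule.Quotient.subsingleton_iff, eq_top_iff]
  rintro φ -
  obtain ⟨c, hc0, hc⟩ := exists_sub_mem_twoCoboundary hp2 φ
  simpa [hc0 hnp] using hc

end SquareClasses

/-! ### The exceptional isomorphism with $\mathfrak{sl}_2$. -/

section SpecialLinear

open LieAlgebra.SpecialLinear

variable {p : ℕ} {F : Type*} [Field F] [CharP F p]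

theorem mem_sl_two {M : Matrix (Fin 2) (Fin 2) F} (h : M 0 0 + M 1 1 = 0) :
    M ∈ sl (Fin 2) F := by
  show Matrix.trace M = 0
  rw [Matrix.trace_fin_two, h]

variable (p F) in
/-- The Lie algebra map `sl₂ → W(1)` onto the fields of degree at most two. -/
def slTwoHom : sl (Fin 2) F →ₗ⁅F⁆ W p 1 F where
  -- In the standard basis: $f\mapsto\partial$, $h\mapsto2x\partial$, $e\mapsto-x^2\partial$.
  toFun M := M.1 1 0 • E 0 0 + (2 * M.1 0 0) • E (Pi.single 0 1) 0 - M.1 0 1 • E (Pi.single 0 2) 0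
  map_add' M N := by
    have e : ∀ i j, (M + N).1 i j = M.1 i j + N.1 i j := fun _ _ ↦ rfl
    simp only [e]
    module
  map_smul' c M := by
    have e : ∀ i j, (c • M).1 i j = c * M.1 i j := fun _ _ ↦ rfl
    simp only [e, RingHom.id_apply]
    module
  map_lie' {M N} := by
    have b1 : ⁅(E 0 0 : W p 1 F), (E (Pi.single 0 1) 0 : W p 1 F)⁆ = E 0 0 := by
      rw [lie_E]; simp
    have b2 : ⁅(E 0 0 : W p 1 F), (E (Pi.single 0 2) 0 : W p 1 F)⁆ =
        (2 : F) • E (Pi.single 0 1) 0 := by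
      rw [lie_E, zero_add, single_sub_single]; simp
    have b3 : ⁅(E (Pi.single 0 1) 0 : W p 1 F), (E (Pi.single 0 2) 0 : W p 1 F)⁆ =
        E (Pi.single 0 2) 0 := by
      rw [lie_E, ← Pi.single_add, single_sub_single]
      simp only [Pi.single_eq_same]
      norm_num
      module
    have b1' := lie_skew (E 0 0 : W p 1 F) (E (Pi.single 0 1) 0 : W p 1 F)
    have b2' := lie_skew (E 0 0 : W p 1 F) (E (Pi.single 0 2) 0 : W p 1 F)
    have b3' := lie_skew (E (Pi.single 0 1) 0 : W p 1 F) (E (Pi.single 0 2) 0 : W p 1 F)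
    rw [b1, neg_eq_iff_eq_neg] at b1'
    rw [b2, neg_eq_iff_eq_neg] at b2'
    rw [b3, neg_eq_iff_eq_neg] at b3'
    have tr : ∀ M : sl (Fin 2) F, M.1 1 1 = - M.1 0 0 := by
      intro M
      have h : Matrix.trace M.1 = 0 := M.2
      rw [Matrix.trace_fin_two] at h
      exact eq_neg_of_add_eq_zero_right h
    simp only [sl_bracket, Matrix.sub_apply, Matrix.mul_apply, Fin.sum_univ_two, tr, lie_add,
      lie_sub, add_lie, sub_lie, smul_lie, lie_smul, lie_self, b1, b2, b3, b1', b2', b3']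
    module

theorem slTwoHom_apply (M : sl (Fin 2) F) : slTwoHom p F M =
    M.1 1 0 • E 0 0 + (2 * M.1 0 0) • E (Pi.single 0 1) 0 - M.1 0 1 • E (Pi.single 0 2) 0 := rfl

variable [Fact p.Prime]

theorem slTwoHom_injective (hp2 : p ≠ 2) : Function.Injective (slTwoHom p F) := by
  have hp3 := three_le hp2
  rw [injective_iff_map_eq_zero]
  intro M hM
  rw [slTwoHom_apply] at hM
  have hne : ∀ s t : ℕ, (Pi.single 0 s : Fin 1 → ℕ) = Pi.single 0 t ↔ s = t := fun s t ↦
    ⟨fun h ↦ by simpa using congrFun h 0, fun h ↦ by rw [h]⟩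
  have hco : ∀ s < 3, coefW (Pi.single 0 s) 0 (M.1 1 0 • E (Pi.single 0 0) 0 +
      (2 * M.1 0 0) • E (Pi.single 0 1) 0 - M.1 0 1 • E (Pi.single 0 2) 0 : W p 1 F) = 0 := by
    intro s _
    rw [Pi.single_zero, hM, map_zero]
  have hlt : ∀ s < 3, ∀ i, (Pi.single 0 s : Fin 1 → ℕ) i < p := by
    intro s hs i
    rw [Subsingleton.elim i 0, Pi.single_eq_same]
    omega
  have h0 := hco 0 (by norm_num)
  have h1 := hco 1 (by norm_num)
  have h2 := hco 2 (by norm_num)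
  simp only [map_add, map_sub, map_smul, coefW_E (hlt 0 (by norm_num)),
    coefW_E (hlt 1 (by norm_num)), coefW_E (hlt 2 (by norm_num)), hne] at h0 h1 h2
  norm_num at h0 h1 h2
  have h1' := h1.resolve_left (two_ne_zero' hp2)
  have tr : M.1 1 1 = 0 := by
    have h : Matrix.trace M.1 = 0 := M.2
    rwa [Matrix.trace_fin_two, h1', zero_add] at h
  apply Subtype.ext
  ext i j
  fin_cases i <;> fin_cases j
  · exact h1'
  · exact h2
  · exact h0
  · exact tr

/-- For $p=3$ the fields $\partial$, $x\partial$, $x^2\partial$ are the whole monomial basis. -/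
theorem slTwoHom_surjective (hp : p = 3) : Function.Surjective (slTwoHom p F) := by
  have h2 : (2 : F) ≠ 0 := two_ne_zero' (p := p) (by omega)
  intro x
  induction x using W_induction with
  | hE a j ha =>
    obtain rfl : j = 0 := Subsingleton.elim _ _
    obtain ⟨s, rfl⟩ : ∃ s, a = Pi.single 0 s :=
      ⟨a 0, by funext t; rw [Subsingleton.elim t 0, Pi.single_eq_same]⟩
    have hs := ha 0
    rw [Pi.single_eq_same, hp] at hs
    interval_cases s
    · refine ⟨⟨!![0, 0; 1, 0], ?_⟩, ?_⟩
      · exact mem_sl_two (by simp)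
      · simp [slTwoHom_apply]
    · refine ⟨⟨!![2⁻¹, 0; 0, -2⁻¹], ?_⟩, ?_⟩
      · exact mem_sl_two (by simp)
      · simp [slTwoHom_apply, h2]
    · refine ⟨⟨!![0, -1; 0, 0], ?_⟩, ?_⟩
      · exact mem_sl_two (by simp)
      · simp [slTwoHom_apply]
  | hadd x y hx hy =>
    obtain ⟨M, rfl⟩ := hx
    obtain ⟨N, rfl⟩ := hy
    exact ⟨M + N, map_add _ _ _⟩
  | hsmul c x hx =>
    obtain ⟨M, rfl⟩ := hx
    exact ⟨c • M, map_smul _ _ _⟩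
  | h0 => exact ⟨0, map_zero _⟩

theorem nonempty_equiv_slTwo (hp : p = 3) : Nonempty (W p 1 F ≃ₗ⁅F⁆ sl (Fin 2) F) :=
  ⟨(LieEquiv.ofBijective (slTwoHom p F)
    ⟨slTwoHom_injective (by omega), slTwoHom_surjective hp⟩).symm⟩

end SpecialLinear

end WittJacobson

end

theorem theorem1p1 (p : ℕ) [Fact p.Prime] (hp : p ≠ 2) (F : Type*) [Field F] [CharP F p]
    (n : ℕ) :
    (¬ (n = 1 ∧ p = 3) →
      LinearIndependent F (fun i : Fin n ↦ WittJacobson.sqClass p F i) ∧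
      Submodule.span F (Set.range fun i : Fin n ↦ WittJacobson.sqClass p F i) = ⊤ ∧
      Module.rank F (WittJacobson.H2 F (WittJacobson.W p n F) (WittJacobson.W p n F)) = n) ∧
    (n = 1 ∧ p = 3 →
      Nonempty (WittJacobson.W p n F ≃ₗ⁅F⁆ LieAlgebra.SpecialLinear.sl (Fin 2) F) ∧
      Subsingleton (WittJacobson.H2 F (WittJacobson.W p n F) (WittJacobson.W p n F))) := by
  refine ⟨fun h ↦ ⟨WittJacobson.linearIndependent_sqClass hp h, WittJacobson.span_sqClass hp,
    WittJacobson.rank_H2 hp h⟩, fun h ↦ ⟨?_, WittJacobson.subsingleton_H2 hp h⟩⟩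
  obtain ⟨rfl, h3⟩ := h
  exact WittJacobson.nonempty_equiv_slTwo h3
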